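/- **Setting.** Let $U=\mathbb R^{\infty}$ (sequences indexed by $\mathbb N=\{1,2,\dots\}$), let $\gamma=\bigotimes_{j\in\mathbb N}N(0,1)$ be the standard Gaussian product measure on $U$ and $\gamma_N$ that on $\mathbb R^N$. Let $X$ be a complex separable Hilbert space, $b=(b_j)_{j\in\mathbb N}\in(0,\infty)^\infty$, $\xi,\delta>0$. A vector $\varrho\in(0,\infty)^N$ is *$(b,\xi)$-admissible* if $\sum_{j=1}^N b_j\varrho_j\le\xi$. A function $u\in L^2(U,X;\gamma)$ is *$(b,\xi,\delta,X)$-holomorphic* if there are functions $u_N:\mathbb R^N\to X$ ($N\in\mathbb N$) such that 1. for every $N$ and every admissible $\varrho\in(0,\infty)^N$, $u_N$ has a holomorphic extension (again denoted $u_N$) to $\{z\in\mathbb C^N:|\operatorname{Im}z_j|<\varrho_j\ \forall j\}$, and $u_N(y_1,\dots,y_N)=u_M(y_1,\dots,y_N,0,\dots,0)$ for all $N<M$ and $y\in\mathbb R^N$; 2. for every $N$ there is $\varphi_N:\mathbb R^N\to[0,\infty)$ with $\|\varphi_N\|_{L^2(\mathbb R^N;\gamma_N)}\le\delta$ and $\|u_N(y+z)\|_X\le\varphi_N(y)$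 for all $y\in\mathbb R^N$, all admissible $\varrho$ and all $z\in\mathbb C^N$ with $|z_j|<\varrho_j$ for all $j$; 3. with $\tilde u_N(y):=u_N(y_1,\dots,y_N)$ for $y\in U$, $\lim_{N\to\infty}\|u-\tilde u_N\|_{L^2(U,X;\gamma)}=0$. Point values of such a $u$ are understood as $u(y_1,\dots,y_N,0,0,\dots):=u_N(y_1,\dots,y_N)$. Let $\mathcal F$ be the set of finitely supported sequences $\nu\in\mathbb N_0^{\infty}$, ordered componentwise. For $n\in\mathbb N_0$ let $\chi_{n,0}<\dots<\chi_{n,n}$ be the Gauss–Hermite points, i.e. the roots of the probabilists' Hermite polynomial of degree $n+1$. Let $I_n$ be the univariate Lagrange interpolation operator at these points, and $I_{-1}:=0$. For finite $\Lambda\subseteq\mathcal F$, the Smolyak interpolation operator and its set of interpolation points are $$\mathbf I_\Lambda:=\sum_{\nu\in\Lambda}\bigotimes_{j\in\mathbb N}(I_{\nu_j}-I_{\nu_j-1}),\qquad \mathrm{pts}(\Lambda):=\{(\chi_{\nu_j,\mu_j})_{j\in\mathbb N}:\nu\in\Lambda,\ \mu\in\mathcal F,\ \mu\le\nu\}.$$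 **Theorem.** Let $p\in(0,2/3)$, let $b\in(0,\infty)^\infty$ with $b\in\ell^p(\mathbb N)$, and let $u$ be $(b,\xi,\delta,X)$-holomorphic. Let $K>0$, $\tau>0$ and $r\in\mathbb N$ be such that $\frac{(r-\tau)\,p}{2(1-p)}>2$ (for example $\tau=3$ and $r>4/p-1$). For $j\in\mathbb N$, $\nu\in\mathcal F$ and $\varepsilon>0$ set $$\varrho_j:=b_j^{p-1}\frac{\xi}{4\sqrt{r!}\,\|b\|_{\ell^p}},\qquad c_{1,\nu}:=\prod_{j\in\operatorname{supp}\nu}\max\{1,K\varrho_j\}^{2}\,\nu_j^{\,r-\tau},\qquad \Lambda_{1,\varepsilon}:=\{\nu\in\mathcal F:c_{1,\nu}^{-1}\ge\varepsilon\},$$ where $\|b\|_{\ell^p}=(\sum_j b_j^p)^{1/p}$. Then every $\Lambda_{1,\varepsilon}$, $\varepsilon>0$, is finite and downward closed (with $\nu$ it contains every $\mu\le\nu$), and there exist $C>0$ and, for every $n\in\mathbb N$, a number $\varepsilon_n>0$ such that $|\mathrm{pts}(\Lambda_{1,\varepsilon_n})|\le n$ and $$\|u-\mathbf I_{\Lambda_{1,\varepsilon_n}}u\|_{L^2(U,X;\gamma)}\le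 C\,n^{-\frac1p+\frac32}.$$ -/

import Mathlib

open MeasureTheory ProbabilityTheory Filter Topology
open scoped ENNReal

noncomputable section

namespace SparseGrid

/-- The standard Gaussian product measure on `U = ℝ^∞`. -/
def gammaInf : Measure (ℕ → ℝ) :=
  Measure.infinitePi (fun _ : ℕ => gaussianReal 0 1)

/-- The standard Gaussian measure on `ℝ^N`. -/
def gammaFin (N : ℕ) : Measure (Fin N → ℝ) :=
  Measure.pi (fun _ : Fin N => gaussianReal 0 1)

/-! ### Holomorphy -/

/-- `ϱ ∈ (0,∞)^N` is `(b, ξ)`-admissible. -/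
def Admissible (b : ℕ → ℝ) (ξ : ℝ) {N : ℕ} (ϱ : Fin N → ℝ) : Prop :=
  (∀ j, 0 < ϱ j) ∧ ∑ j : Fin N, b j * ϱ j ≤ ξ

/-- The product of strips `|Im z_j| < ϱ_j`. -/
def strip {N : ℕ} (ϱ : Fin N → ℝ) : Set (Fin N → ℂ) :=
  {z | ∀ j, |(z j).im| < ϱ j}

/-- The polydisc `|z_j| < ϱ_j`. -/
def polydisc {N : ℕ} (ϱ : Fin N → ℝ) : Set (Fin N → ℂ) :=
  {z | ∀ j, ‖z j‖ < ϱ j}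

/-- The function on `U` that depends on the first `N` coordinates only, through `f`. -/
def liftFin {X : Type*} {N : ℕ} (f : (Fin N → ℝ) → X) : (ℕ → ℝ) → X :=
  fun y => f (fun i => y i)

/-- The vector `(y_1, …, y_N, 0, …, 0) ∈ ℝ^M`. -/
def padZero {N : ℕ} (M : ℕ) (y : Fin N → ℝ) : Fin M → ℝ :=
  fun i => if h : (i : ℕ) < N then y ⟨i, h⟩ else 0

/-- `u` is `(b, ξ, δ, X)`-holomorphic, with the functions `u_N : ℝ^N → X` of the definition
being `uN N` for `N ≥ 1` (the value `uN 0` is irrelevant). The holomorphic extension of `u_N` to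
a strip is unique, so that the bound by `φ` may be stated together with its existence. -/
structure IsHolomorphicVia {X : Type*} [NormedAddCommGroup X] [InnerProductSpace ℂ X]
    (b : ℕ → ℝ) (ξ δ : ℝ) (u : (ℕ → ℝ) → X) (uN : (N : ℕ) → (Fin N → ℝ) → X) : Prop where
  memLp : MemLp u 2 gammaInf
  extension : ∀ N : ℕ, 0 < N → ∃ φ : (Fin N → ℝ) → ℝ,
    (∀ y, 0 ≤ φ y) ∧ MemLp φ 2 (gammaFin N) ∧
    eLpNorm φ 2 (gammaFin N) ≤ ENNReal.ofReal δ ∧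
    ∀ ϱ : Fin N → ℝ, Admissible b ξ ϱ → ∃ F : (Fin N → ℂ) → X,
      DifferentiableOn ℂ F (strip ϱ) ∧
      (∀ y : Fin N → ℝ, F (fun i => (y i : ℂ)) = uN N y) ∧
      ∀ y : Fin N → ℝ, ∀ z ∈ polydisc ϱ, ‖F (fun i => (y i : ℂ) + z i)‖ ≤ φ y
  consistent : ∀ N M : ℕ, 0 < N → N < M → ∀ y : Fin N → ℝ, uN N y = uN M (padZero M y)
  tendsto : Tendsto (fun N => eLpNorm (fun y => u y - liftFin (uN N) y) 2 gammaInf) atTop (𝓝 0)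

open Classical in
/-- The point values `u(y_1, …, y_N, 0, 0, …) := u_N(y_1, …, y_N)` at sequences `y` with finitely
many nonzero entries. The value `0` elsewhere is never used. -/
def pointEval {X : Type*} [Zero X] (uN : (N : ℕ) → (Fin N → ℝ) → X) : (ℕ → ℝ) → X :=
  fun y => if h : ∃ N : ℕ, 0 < N ∧ ∀ j, N ≤ j → y j = 0 then liftFin (uN (Nat.find h)) y else 0

/-! ### Smolyak interpolation -/

/-- The Gauss-Hermite points `χ_{n,0} < ⋯ < χ_{n,n}`, the roots of the Hermite polynomial of
degree `n + 1` in increasing order. -/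
def gaussHermite (n j : ℕ) : ℝ :=
  ((((Polynomial.hermite (n + 1)).map (Int.castRingHom ℝ)).roots.toFinset).sort).getD j 0

/-- The `j`-th Lagrange basis polynomial for the nodes `χ_{n,0}, …, χ_{n,n}`. -/
def lagrangeBasis (n j : ℕ) (y : ℝ) : ℝ :=
  ∏ i ∈ (Finset.range (n + 1)).erase j,
    (y - gaussHermite n i) / (gaussHermite n j - gaussHermite n i)

/-- The grid point `(χ_{ν_j, μ_j})_j`. -/
def gridPoint (ν μ : ℕ →₀ ℕ) : ℕ → ℝ := fun j => gaussHermite (ν j) (μ j)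

/-- The tensorized interpolation operator `I_ν`; the factors with `ν_j = 0` equal `1`. -/
def tensorInterp {X : Type*} [NormedAddCommGroup X] [InnerProductSpace ℂ X]
    (ν : ℕ →₀ ℕ) (f : (ℕ → ℝ) → X) (y : ℕ → ℝ) : X :=
  ∑ μ ∈ Finset.Icc 0 ν,
    ((∏ j ∈ ν.support, lagrangeBasis (ν j) (μ j) (y j) : ℝ) : ℂ) • f (gridPoint ν μ)

/-- The operator `⨂_j (I_{ν_j} - I_{ν_j - 1})` with `I_{-1} = 0`, multiplied out:
the set `s` collects the coordinates in which `- I_{ν_j - 1}` is taken, and it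
lies in the support of `ν` because `I_{-1} = 0`. -/
def tensorDiff {X : Type*} [NormedAddCommGroup X] [InnerProductSpace ℂ X]
    (ν : ℕ →₀ ℕ) (f : (ℕ → ℝ) → X) (y : ℕ → ℝ) : X :=
  ∑ s ∈ ν.support.powerset,
    (-1 : ℂ) ^ s.card • tensorInterp (ν - ∑ j ∈ s, Finsupp.single j 1) f y

/-- The Smolyak interpolation operator `I_Λ` for a finite set `Λ`. -/
def smolyak {X : Type*} [NormedAddCommGroup X] [InnerProductSpace ℂ X]
    (Λ : Finset (ℕ →₀ ℕ)) (f : (ℕ → ℝ) → X) (y : ℕ → ℝ) : X :=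
  ∑ ν ∈ Λ, tensorDiff ν f y

/-- The interpolation points used by `I_Λ`. -/
def pts (Λ : Set (ℕ →₀ ℕ)) : Set (ℕ → ℝ) :=
  {x | ∃ ν ∈ Λ, ∃ μ ≤ ν, x = gridPoint ν μ}

/-! ### The multiindex sets -/

/-- `ϱ_j = b_j^{p-1} ξ / (4 √(r!) ‖b‖_{ℓ^p})`. -/
def varrho (b : ℕ → ℝ) (p ξ : ℝ) (r : ℕ) (j : ℕ) : ℝ :=
  b j ^ (p - 1) * (ξ / (4 * √(r.factorial : ℝ) * (∑' i, |b i| ^ p) ^ (1 / p)))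

/-- `c_{k,ν} = ∏_{j ∈ supp ν} max{1, K ϱ_j}^{2k} ν_j^{r-τ}`. -/
def weight (k : ℕ) (K τ : ℝ) (r : ℕ) (ϱ : ℕ → ℝ) (ν : ℕ →₀ ℕ) : ℝ :=
  ∏ j ∈ ν.support, max 1 (K * ϱ j) ^ (2 * k) * (ν j : ℝ) ^ ((r : ℝ) - τ)

/-- `Λ_ε = {ν : c_ν⁻¹ ≥ ε}`. -/
def indexSet (c : (ℕ →₀ ℕ) → ℝ) (ε : ℝ) : Set (ℕ →₀ ℕ) := {ν | ε ≤ (c ν)⁻¹}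

end SparseGrid

end

open SparseGrid

/-!
Tensor-product Lagrange interpolation is exact below its degree, so on a lower set `Λ` the Smolyak
operator reproduces every Hermite polynomial with index in `Λ`, and the error of `u` is a sum over
the remaining Hermite coefficients of `u`, each multiplied by a stability bound for the operator
that is polynomial in the index.

Shifting the arguments of the Hermite coefficients into the complex strip and applying Bessel's
inequality to a suitable mixed orthonormal system shows that the Hermite coefficients are square
summable against a weight that grows like `c_ν` times any power of the index. By the Cauchy–Schwarz
inequality both the error and the number of interpolation points are then governed by one convergent
sum over multi-indices, namely `∑_ν c_ν^{-t}` with polynomial factors, where `t = p / (2 (1 - p))`.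
-/

noncomputable section

namespace SparseGrid

/-! ### Hermite polynomials -/

open Polynomial in
/-- The probabilists' Hermite polynomial of degree `n`, evaluated at `x`. Working with the value
rather than with the polynomial lets one definition serve `ℝ` and `ℂ`. -/
def hermiteEval {A : Type*} [CommRing A] (n : ℕ) (x : A) : A := aeval x (hermite n)

section Algebra

open Polynomial

theorem derivative_hermite_succ (n : ℕ) :
    derivative (hermite (n + 1)) = ((n : ℤ[X]) + 1) * hermite n := by
  induction n with
  | zero => simp
  | succ n ih =>
    have hder : derivative ((n : ℤ[X]) + 1) = 0 := by simp
    rw [hermite_succ (n + 1), ih, derivative_sub, derivative_mul, derivative_X, derivative_mul,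
      hder, ih, hermite_succ n]
    push_cast
    ring

theorem hermite_add_two (n : ℕ) :
    hermite (n + 2) = X * hermite (n + 1) - ((n : ℤ[X]) + 1) * hermite n := by
  rw [hermite_succ (n + 1), derivative_hermite_succ]

variable {A : Type*} [CommRing A]

@[simp] theorem hermiteEval_zero (x : A) : hermiteEval 0 x = 1 := by
  simp [hermiteEval]

@[simp] theorem hermiteEval_one (x : A) : hermiteEval 1 x = x := by
  simp [hermiteEval]

theorem hermiteEval_add_two (n : ℕ) (x : A) :
    hermiteEval (n + 2) x = x * hermiteEval (n + 1) x - ((n : A) + 1) * hermiteEval n x := by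
  rw [hermiteEval, hermite_add_two]
  simp only [hermiteEval, map_sub, map_mul, map_add, aeval_X, map_natCast, map_one]

end Algebra

theorem christoffel_darboux {F : Type*} [Field F] [CharZero F] (n : ℕ) (x y : F) :
    (x - y) * ∑ l ∈ Finset.range (n + 1), hermiteEval l x * hermiteEval l y / (l.factorial : F) =
      (hermiteEval (n + 1) x * hermiteEval n y - hermiteEval n x * hermiteEval (n + 1) y) /
        (n.factorial : F) := by
  induction n with
  | zero => simp
  | succ n ih =>
    have hfact : (n.factorial : F) ≠ 0 := by exact_mod_cast n.factorial_ne_zero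
    have hsucc : (n : F) + 1 ≠ 0 := by exact_mod_cast n.succ_ne_zero
    rw [Finset.sum_range_succ, mul_add, ih, hermiteEval_add_two, hermiteEval_add_two,
      Nat.factorial_succ]
    push_cast
    field_simp
    ring

theorem christoffel_darboux_self {F : Type*} [Field F] [CharZero F] (n : ℕ) (x : F) :
    ∑ l ∈ Finset.range (n + 1), hermiteEval l x ^ 2 / (l.factorial : F) =
      (hermiteEval (n + 1) x ^ 2 + ((n : F) + 1) * hermiteEval n x ^ 2 -
        x * hermiteEval (n + 1) x * hermiteEval n x) / (n.factorial : F) := by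
  induction n with
  | zero => simp; ring
  | succ n ih =>
    have hfact : (n.factorial : F) ≠ 0 := by exact_mod_cast n.factorial_ne_zero
    have hsucc : (n : F) + 1 ≠ 0 := by exact_mod_cast n.succ_ne_zero
    rw [Finset.sum_range_succ, ih, hermiteEval_add_two, Nat.factorial_succ]
    push_cast
    field_simp
    ring

/-- The Hermite polynomial normalized in `L²` of the standard Gaussian. -/
def hermiteN (n : ℕ) (x : ℝ) : ℝ := hermiteEval n x / √(n.factorial : ℝ)

@[simp] theorem hermiteN_zero (x : ℝ) : hermiteN 0 x = 1 := by simp [hermiteN]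

theorem hermiteN_mul (n : ℕ) (x y : ℝ) :
    hermiteN n x * hermiteN n y = hermiteEval n x * hermiteEval n y / (n.factorial : ℝ) := by
  rw [hermiteN, hermiteN, div_mul_div_comm, Real.mul_self_sqrt (by positivity)]

theorem hermiteN_sq (n : ℕ) (x : ℝ) :
    hermiteN n x ^ 2 = hermiteEval n x ^ 2 / (n.factorial : ℝ) := by
  rw [sq, sq, hermiteN_mul]

theorem sqrt_mul_hermiteN_add_two (n : ℕ) (x : ℝ) :
    √(n + 2) * hermiteN (n + 2) x = x * hermiteN (n + 1) x - √(n + 1) * hermiteN n x := by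
  have hsq : √((n : ℝ) + 1) ^ 2 = n + 1 := Real.sq_sqrt (by positivity)
  have hn : √((n : ℝ) + 2) ≠ 0 := by positivity
  simp only [hermiteN, Nat.factorial_succ, Nat.cast_mul, Nat.cast_add, Nat.cast_one, Nat.cast_ofNat,
    add_assoc, one_add_one_eq_two, Real.sqrt_mul (by positivity : (0 : ℝ) ≤ n + 2),
    Real.sqrt_mul (by positivity : (0 : ℝ) ≤ n + 1), hermiteEval_add_two]
  field_simp
  rw [hsq]
  ring

/-- The inverse of the Christoffel function, the diagonal of the reproducing kernel of the
polynomials of degree less than `n`. -/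
def christoffelInv (n : ℕ) (x : ℝ) : ℝ := ∑ l ∈ Finset.range n, hermiteN l x ^ 2

theorem christoffelInv_succ (n : ℕ) (x : ℝ) :
    christoffelInv (n + 1) x = christoffelInv n x + hermiteN n x ^ 2 :=
  Finset.sum_range_succ ..

theorem christoffelInv_pos (n : ℕ) (x : ℝ) : 0 < christoffelInv (n + 1) x :=
  Finset.sum_pos' (fun _ _ => sq_nonneg _) ⟨0, by simp, by simp⟩

theorem sub_mul_hermiteN_sq_le {m : ℕ} {x : ℝ} (hx : x ^ 2 ≤ 4 * m) (k : ℕ) :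
    ((k : ℝ) + 1 - m) * hermiteN (k + 1) x ^ 2 ≤ christoffelInv (k + 1) x := by
  have hdiag := christoffel_darboux_self k x
  simp only [← hermiteN_sq] at hdiag
  rw [christoffelInv, hdiag, hermiteN_sq, Nat.factorial_succ, le_div_iff₀ (by positivity)]
  set a := hermiteEval (k + 1) x
  set c := hermiteEval k x
  have hcancel : ((k : ℝ) + 1 - m) * (a ^ 2 / (((k + 1) * k.factorial : ℕ) : ℝ)) * k.factorial =
      ((k : ℝ) + 1 - m) * a ^ 2 / ((k : ℝ) + 1) := by
    push_cast
    field_simp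
  rw [hcancel, div_le_iff₀ (by positivity)]
  nlinarith [sq_nonneg (2 * ((k : ℝ) + 1) * c - x * a), mul_nonneg (sub_nonneg.2 hx) (sq_nonneg a)]

theorem succ_mul_hermiteN_sq_le {m : ℕ} {x : ℝ} (hx : x ^ 2 ≤ 4 * m) (i : ℕ) :
    ((i : ℝ) + 1) * hermiteN (m + i + 1) x ^ 2 ≤ christoffelInv (m + i + 1) x := by
  have h := sub_mul_hermiteN_sq_le hx (m + i)
  rwa [Nat.cast_add, show (m : ℝ) + i + 1 - m = i + 1 by ring] at h

theorem christoffelInv_add_le {m : ℕ} {x : ℝ} (hx : x ^ 2 ≤ 4 * m) (i : ℕ) :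
    christoffelInv (m + i + 1) x ≤ (i + 1) * christoffelInv (m + 1) x := by
  induction i with
  | zero => simp
  | succ i ih =>
    have hnew : hermiteN (m + i + 1) x ^ 2 ≤ christoffelInv (m + 1) x :=
      le_of_mul_le_mul_left ((succ_mul_hermiteN_sq_le hx i).trans ih) (by positivity)
    rw [← add_assoc, christoffelInv_succ]
    push_cast
    linarith

/-- In the oscillatory region `x² ≤ 4m` the size of every normalized Hermite polynomial is
controlled by the first `m + 1` of them. -/
theorem hermiteN_sq_le_christoffelInv {m : ℕ} {x : ℝ} (hx : x ^ 2 ≤ 4 * m) (k : ℕ) :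
    hermiteN k x ^ 2 ≤ christoffelInv (m + 1) x := by
  rcases le_or_gt k m with hkm | hmk
  · exact Finset.single_le_sum (f := fun l => hermiteN l x ^ 2) (fun _ _ => sq_nonneg _)
      (Finset.mem_range.2 (Nat.lt_succ_of_le hkm))
  · obtain ⟨i, rfl⟩ := Nat.exists_eq_add_of_lt hmk
    exact le_of_mul_le_mul_left
      ((succ_mul_hermiteN_sq_le hx i).trans (christoffelInv_add_le hx i)) (by positivity)

/-! ### Zeros of Hermite polynomials -/

/-- The quadratic form of the Jacobi matrix of the Hermite polynomials at the vector of their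
values at `x`, which is an eigenvector up to the last entry. -/
theorem mul_christoffelInv (n : ℕ) (x : ℝ) :
    x * christoffelInv (n + 1) x =
      2 * ∑ k ∈ Finset.range n, √(k + 1) * (hermiteN k x * hermiteN (k + 1) x) +
        √(n + 1) * (hermiteN n x * hermiteN (n + 1) x) := by
  induction n with
  | zero => simp [christoffelInv, hermiteN]
  | succ n ih =>
    have hrec := sqrt_mul_hermiteN_add_two n x
    rw [christoffelInv_succ, mul_add, ih, Finset.sum_range_succ]
    push_cast
    rw [add_assoc (n : ℝ), one_add_one_eq_two, mul_left_comm √((n : ℝ) + 2), hrec]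
    ring

theorem sq_le_of_hermiteEval_eq_zero {m : ℕ} {x : ℝ} (hx : hermiteEval (m + 1) x = 0) :
    x ^ 2 ≤ 4 * m := by
  set v : ℕ → ℝ := fun k => hermiteN k x
  have hv : v (m + 1) = 0 := by simp [v, hermiteN, hx]
  have hjacobi : x * christoffelInv (m + 1) x =
      ∑ k ∈ Finset.range m, √(k + 1) * (2 * (v k * v (k + 1))) := by
    rw [mul_christoffelInv, ← show v (m + 1) = hermiteN (m + 1) x from rfl, hv, mul_zero, mul_zero,
      add_zero, Finset.mul_sum]
    exact Finset.sum_congr rfl fun k _ => mul_left_comm _ _ _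
  have hterm : ∀ k ∈ Finset.range m,
      |√(k + 1) * (2 * (v k * v (k + 1)))| ≤ √m * (v k ^ 2 + v (k + 1) ^ 2) := fun k hk => by
    have hkm : (k : ℝ) + 1 ≤ m := by exact_mod_cast Finset.mem_range.1 hk
    rw [abs_mul, abs_of_nonneg (Real.sqrt_nonneg _)]
    gcongr
    exact abs_le.2 ⟨by nlinarith [sq_nonneg (v k + v (k + 1))],
      by nlinarith [sq_nonneg (v k - v (k + 1))]⟩
  have hshift : ∑ k ∈ Finset.range m, v (k + 1) ^ 2 ≤ christoffelInv (m + 1) x := by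
    rw [christoffelInv, Finset.sum_range_succ']
    exact le_add_of_nonneg_right (sq_nonneg _)
  have hinit : ∑ k ∈ Finset.range m, v k ^ 2 ≤ christoffelInv (m + 1) x := by
    rw [christoffelInv_succ]
    exact le_add_of_nonneg_right (sq_nonneg _)
  have hle : |x| ≤ 2 * √m := by
    refine le_of_mul_le_mul_right ?_ (christoffelInv_pos m x)
    calc |x| * christoffelInv (m + 1) x
        = |x * christoffelInv (m + 1) x| := by
          rw [abs_mul, abs_of_pos (christoffelInv_pos m x)]
      _ ≤ ∑ k ∈ Finset.range m, √m * (v k ^ 2 + v (k + 1) ^ 2) := by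
          rw [hjacobi]
          exact (Finset.abs_sum_le_sum_abs _ _).trans (Finset.sum_le_sum hterm)
      _ ≤ √m * (2 * christoffelInv (m + 1) x) := by
          rw [← Finset.mul_sum, Finset.sum_add_distrib]
          gcongr
          linarith
      _ = 2 * √m * christoffelInv (m + 1) x := by ring
  calc x ^ 2 = |x| ^ 2 := (sq_abs x).symm
    _ ≤ (2 * √m) ^ 2 := by gcongr
    _ = 4 * m := by rw [mul_pow, Real.sq_sqrt (by positivity)]; norm_num

section Roots

open Polynomial

/-- The real Hermite polynomial of degree `n`, whose roots are the Gauss-Hermite points. -/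
def hermiteReal (n : ℕ) : ℝ[X] := (hermite n).map (Int.castRingHom ℝ)

theorem eval_hermiteReal (n : ℕ) (x : ℝ) : (hermiteReal n).eval x = hermiteEval n x := by
  rw [hermiteReal, hermiteEval, eval_map, aeval_def]
  rfl

theorem hermiteReal_monic (n : ℕ) : (hermiteReal n).Monic := (hermite_monic n).map _

theorem natDegree_hermiteReal (n : ℕ) : (hermiteReal n).natDegree = n := by
  rw [hermiteReal, (hermite_monic n).natDegree_map, natDegree_hermite]

theorem map_hermiteEval {A B : Type*} [CommRing A] [CommRing B] (f : A →+* B) (n : ℕ) (x : A) :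
    f (hermiteEval n x) = hermiteEval n (f x) :=
  (aeval_algHom_apply f.toIntAlgHom x (hermite n)).symm

theorem im_eq_zero_of_hermiteEval_eq_zero {n : ℕ} {z : ℂ} (hz : hermiteEval (n + 1) z = 0) :
    z.im = 0 := by
  have hpos : 0 < ∑ l ∈ Finset.range (n + 1), ‖hermiteEval l z‖ ^ 2 / (l.factorial : ℝ) :=
    Finset.sum_pos' (fun i _ => by positivity) ⟨0, by simp, by simp⟩
  have hkernel : ∑ l ∈ Finset.range (n + 1),
      hermiteEval l z * hermiteEval l ((starRingEnd ℂ) z) / (l.factorial : ℂ) =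
      ((∑ l ∈ Finset.range (n + 1), ‖hermiteEval l z‖ ^ 2 / (l.factorial : ℝ) : ℝ) : ℂ) := by
    push_cast
    exact Finset.sum_congr rfl fun l _ => by rw [← map_hermiteEval, Complex.mul_conj']
  have h := christoffel_darboux n z ((starRingEnd ℂ) z)
  rw [hkernel, ← map_hermiteEval _ (n + 1), hz, map_zero, zero_mul, mul_zero, sub_zero, zero_div,
    mul_eq_zero, Complex.ofReal_eq_zero, or_iff_left hpos.ne'] at h
  exact Complex.conj_eq_iff_im.1 (sub_eq_zero.1 h).symm

theorem hermiteReal_splits (n : ℕ) : (hermiteReal n).Splits := by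
  rcases n with _ | n
  · simp [hermiteReal]
  have hC : ((hermiteReal (n + 1)).map (algebraMap ℝ ℂ)).Splits := IsAlgClosed.splits _
  refine Splits.of_splits_map_of_injective (algebraMap ℝ ℂ).injective hC fun a ha => ?_
  have hroot : hermiteEval (n + 1) a = 0 := by
    have h := (mem_roots'.1 ha).2
    rwa [IsRoot.def, hermiteReal, Polynomial.map_map, eval_map,
      RingHom.ext_int ((algebraMap ℝ ℂ).comp (Int.castRingHom ℝ)) (algebraMap ℤ ℂ)] at h
  exact ⟨a.re, Complex.ext (by simp) (by simp [im_eq_zero_of_hermiteEval_eq_zero hroot])⟩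

theorem hermiteEval_ne_zero_of_succ {n : ℕ} {x : ℝ} (hx : hermiteEval (n + 1) x = 0) :
    hermiteEval n x ≠ 0 := fun h => by
  have hdiag := christoffel_darboux_self n x
  simp only [← hermiteN_sq, hx, h] at hdiag
  have hpos := christoffelInv_pos n x
  rw [christoffelInv, hdiag] at hpos
  simp at hpos

theorem nodup_roots_hermiteReal (n : ℕ) : (hermiteReal n).roots.Nodup := by
  rcases n with _ | n
  · simp [hermiteReal]
  refine Multiset.nodup_iff_count_le_one.2 fun a => ?_
  rw [count_roots]
  by_contra! hlt
  obtain ⟨hroot, hder⟩ :=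
    (one_lt_rootMultiplicity_iff_isRoot (hermiteReal_monic (n + 1)).ne_zero).1 hlt
  rw [IsRoot.def, eval_hermiteReal] at hroot
  rw [IsRoot.def, hermiteReal, derivative_map, derivative_hermite_succ] at hder
  simp only [Polynomial.map_mul, Polynomial.map_add, Polynomial.map_natCast, Polynomial.map_one,
    eval_mul, eval_add, eval_natCast, eval_one] at hder
  exact hermiteEval_ne_zero_of_succ hroot ((eval_hermiteReal n a).symm.trans
    ((mul_eq_zero.1 hder).resolve_left (by positivity)))

theorem card_roots_hermiteReal (n : ℕ) : (hermiteReal n).roots.toFinset.card = n := by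
  rw [Multiset.toFinset_card_of_nodup (nodup_roots_hermiteReal n),
    ← (hermiteReal_splits n).natDegree_eq_card_roots, natDegree_hermiteReal]

theorem gaussHermite_eq_orderEmbOfFin {n i : ℕ} (hi : i < n + 1) :
    gaussHermite n i = (hermiteReal (n + 1)).roots.toFinset.orderEmbOfFin
      (card_roots_hermiteReal (n + 1)) ⟨i, hi⟩ := by
  rw [Finset.orderEmbOfFin_apply]
  exact List.getD_eq_getElem _ _ _

theorem hermiteEval_gaussHermite {n i : ℕ} (hi : i < n + 1) :
    hermiteEval (n + 1) (gaussHermite n i) = 0 := by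
  rw [gaussHermite_eq_orderEmbOfFin hi, ← eval_hermiteReal]
  exact (mem_roots'.1 (Multiset.mem_toFinset.1 (Finset.orderEmbOfFin_mem _ _ _))).2

theorem gaussHermite_injOn (n : ℕ) :
    Set.InjOn (gaussHermite n) (Finset.range (n + 1) : Finset ℕ) := by
  intro i hi j hj hij
  rw [Finset.mem_coe, Finset.mem_range] at hi hj
  rw [gaussHermite_eq_orderEmbOfFin hi, gaussHermite_eq_orderEmbOfFin hj] at hij
  exact congrArg Fin.val ((Finset.orderEmbOfFin _ _).injective hij)

@[simp] theorem gaussHermite_zero_zero : gaussHermite 0 0 = 0 := by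
  simpa using hermiteEval_gaussHermite zero_lt_one

/-! ### Lagrange interpolation at the Gauss-Hermite points -/

theorem lagrangeBasis_eq_eval (n i : ℕ) (y : ℝ) :
    lagrangeBasis n i y = (Lagrange.basis (Finset.range (n + 1)) (gaussHermite n) i).eval y := by
  rw [Lagrange.basis, eval_prod, lagrangeBasis]
  refine Finset.prod_congr rfl fun j _ => ?_
  simp only [Lagrange.basisDivisor, eval_mul, eval_C, eval_sub, eval_X, div_eq_inv_mul]

/-- The univariate interpolation operator `I_n` at the Gauss-Hermite points. -/
def interp (n : ℕ) (f : ℝ → ℝ) (y : ℝ) : ℝ :=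
  ∑ i ∈ Finset.range (n + 1), lagrangeBasis n i y * f (gaussHermite n i)

theorem interp_eval_of_degree_lt {n : ℕ} {q : ℝ[X]} (hq : q.degree < (n + 1 : ℕ)) (y : ℝ) :
    interp n (fun x => q.eval x) y = q.eval y := by
  have hinterp := Lagrange.eq_interpolate (f := q) (gaussHermite_injOn n)
    (by rwa [Finset.card_range])
  rw [congrArg (eval y) hinterp, Lagrange.interpolate_apply, eval_finsetSum, interp]
  refine Finset.sum_congr rfl fun i _ => ?_
  rw [eval_mul, eval_C, lagrangeBasis_eq_eval, mul_comm]

theorem hermiteN_eq_eval (k : ℕ) (y : ℝ) :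
    hermiteN k y = (C (√(k.factorial : ℝ))⁻¹ * hermiteReal k).eval y := by
  rw [eval_mul, eval_C, eval_hermiteReal, hermiteN, div_eq_inv_mul]

theorem interp_hermiteN_of_le {n k : ℕ} (hk : k ≤ n) (y : ℝ) :
    interp n (hermiteN k) y = hermiteN k y := by
  have hdeg : (C (√(k.factorial : ℝ))⁻¹ * hermiteReal k).degree < (n + 1 : ℕ) := by
    rw [degree_C_mul (inv_ne_zero (by positivity)),
      degree_eq_natDegree (hermiteReal_monic k).ne_zero, natDegree_hermiteReal]
    exact_mod_cast Nat.lt_succ_of_le hk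
  simpa only [← hermiteN_eq_eval] using interp_eval_of_degree_lt hdeg y

/-- The reproducing kernel of the polynomials of degree less than `n` in `L²` of the standard
Gaussian. -/
def hermiteKernel (n : ℕ) (x y : ℝ) : ℝ := ∑ l ∈ Finset.range n, hermiteN l x * hermiteN l y

theorem hermiteKernel_self (n : ℕ) (x : ℝ) : hermiteKernel n x x = christoffelInv n x :=
  Finset.sum_congr rfl fun _ _ => (sq _).symm

theorem hermiteKernel_gaussHermite_of_ne {n i j : ℕ} (hi : i < n + 1) (hj : j < n + 1)
    (hij : i ≠ j) : hermiteKernel (n + 1) (gaussHermite n i) (gaussHermite n j) = 0 := by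
  have h := christoffel_darboux n (gaussHermite n i) (gaussHermite n j)
  simp only [hermiteEval_gaussHermite hi, hermiteEval_gaussHermite hj, zero_mul, mul_zero,
    sub_zero, zero_div, ← hermiteN_mul] at h
  refine (mul_eq_zero.1 h).resolve_left (sub_ne_zero.2 fun he => hij ?_)
  exact gaussHermite_injOn n (Finset.mem_coe.2 (Finset.mem_range.2 hi))
    (Finset.mem_coe.2 (Finset.mem_range.2 hj)) he

theorem interp_hermiteKernel (n : ℕ) (x y : ℝ) :
    interp n (hermiteKernel (n + 1) x) y = hermiteKernel (n + 1) x y := by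
  calc interp n (hermiteKernel (n + 1) x) y
      = ∑ l ∈ Finset.range (n + 1), hermiteN l x * interp n (hermiteN l) y := by
        simp only [interp, hermiteKernel, Finset.mul_sum]
        rw [Finset.sum_comm]
        exact Finset.sum_congr rfl fun l _ => Finset.sum_congr rfl fun i _ => mul_left_comm _ _ _
    _ = hermiteKernel (n + 1) x y := Finset.sum_congr rfl fun l hl => by
        rw [interp_hermiteN_of_le (Nat.lt_succ_iff.1 (Finset.mem_range.1 hl))]

theorem lagrangeBasis_eq_hermiteKernel {n i : ℕ} (hi : i < n + 1) (y : ℝ) :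
    lagrangeBasis n i y = hermiteKernel (n + 1) (gaussHermite n i) y /
      christoffelInv (n + 1) (gaussHermite n i) := by
  rw [← interp_hermiteKernel, interp, Finset.sum_eq_single_of_mem i (Finset.mem_range.2 hi)
      fun j hj hji => by
        rw [hermiteKernel_gaussHermite_of_ne hi (Finset.mem_range.1 hj) hji.symm, mul_zero],
    hermiteKernel_self, mul_div_cancel_right₀ _ (christoffelInv_pos n _).ne']

end Roots

/-! ### The univariate Gaussian measure -/

/-- The standard Gaussian measure on `ℝ`, each factor of `gammaInf` and `gammaFin`. -/
abbrev gauss : Measure ℝ := gaussianReal 0 1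

theorem continuous_hermiteEval (n : ℕ) : Continuous (hermiteEval n : ℝ → ℝ) := by
  simpa only [eval_hermiteReal] using (hermiteReal n).continuous

theorem hasDerivAt_hermiteEval_succ (n : ℕ) (x : ℝ) :
    HasDerivAt (hermiteEval (n + 1)) (((n : ℝ) + 1) * hermiteEval n x) x := by
  have hder : (hermiteReal (n + 1)).derivative.eval x = ((n : ℝ) + 1) * hermiteEval n x := by
    rw [← eval_hermiteReal, hermiteReal, Polynomial.derivative_map, derivative_hermite_succ]
    simp [hermiteReal]
  rw [← hder]
  exact ((hermiteReal (n + 1)).hasDerivAt x).congr_of_eventuallyEq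
    (.of_forall fun y => (eval_hermiteReal _ y).symm)

theorem memLp_hermiteEval (n : ℕ) {p : ℝ≥0∞} (hp : p ≠ ∞) : MemLp (hermiteEval n) p gauss := by
  induction n using Nat.twoStepInduction generalizing p with
  | zero => exact (memLp_const (1 : ℝ)).ae_eq (.of_forall fun x => (hermiteEval_zero x).symm)
  | one => exact (memLp_id_gaussianReal' p hp).ae_eq (.of_forall fun x => (hermiteEval_one x).symm)
  | more n ih ih' =>
    have hp2 : 2 * p ≠ ∞ := ENNReal.mul_ne_top (by simp) hp
    have : ENNReal.HolderTriple (2 * p) (2 * p) p := ⟨by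
      rw [ENNReal.mul_inv (by simp) (by simp), ← two_mul, ← mul_assoc,
        ENNReal.mul_inv_cancel (by simp) (by simp), one_mul]⟩
    have hrec : (hermiteEval (n + 2) : ℝ → ℝ) =
        (fun x => id x * hermiteEval (n + 1) x) - fun x => ((n : ℝ) + 1) * hermiteEval n x :=
      funext fun x => hermiteEval_add_two n x
    rw [hrec]
    exact ((ih' hp2).mul' (memLp_id_gaussianReal' (2 * p) hp2)).sub ((ih hp).const_mul _)

theorem hasDerivAt_gaussianPDFReal (x : ℝ) :
    HasDerivAt (gaussianPDFReal 0 1) (-x * gaussianPDFReal 0 1 x) x := by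
  have hexponent : HasDerivAt (fun x : ℝ => -(x - 0) ^ 2 / (2 * ((1 : NNReal) : ℝ))) (-x) x := by
    refine ((((hasDerivAt_id x).sub_const 0).pow 2).neg.div_const _).congr_deriv ?_
    simp
    ring
  rw [gaussianPDFReal_def]
  refine (hexponent.exp.const_mul _).congr_deriv ?_
  ring

theorem hasDerivAt_gaussianPDFReal_mul_hermiteEval (m : ℕ) (x : ℝ) :
    HasDerivAt (fun x => gaussianPDFReal 0 1 x * hermiteEval m x)
      (-(gaussianPDFReal 0 1 x * hermiteEval (m + 1) x)) x := by
  rcases m with _ | m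
  · simpa [mul_comm] using hasDerivAt_gaussianPDFReal x
  · refine ((hasDerivAt_gaussianPDFReal x).mul (hasDerivAt_hermiteEval_succ m x)).congr_deriv ?_
    rw [hermiteEval_add_two]
    ring

theorem integrable_smul_of_memLp_two {𝕜 Ω X : Type*} [RCLike 𝕜] [MeasurableSpace Ω] {μ : Measure Ω}
    [NormedAddCommGroup X] [NormedSpace 𝕜 X] {g : Ω → 𝕜} {f : Ω → X} (hg : MemLp g 2 μ)
    (hf : MemLp f 2 μ) : Integrable (fun ω => g ω • f ω) μ :=
  memLp_one_iff_integrable.1 (MemLp.smul (p := 2) (q := 2) hf hg)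

section Vector

variable {X : Type*} [NormedAddCommGroup X] [NormedSpace ℝ X]

theorem integrable_gauss_iff {f : ℝ → X} :
    Integrable f gauss ↔ Integrable (fun x => gaussianPDFReal 0 1 x • f x) := by
  rw [gauss, gaussianReal_of_var_ne_zero _ one_ne_zero,
    integrable_withDensity_iff_integrable_smul' (measurable_gaussianPDF _ _)
      (ae_of_all _ fun _ => gaussianPDF_lt_top)]
  simp only [toReal_gaussianPDF]

theorem integrable_hermiteEval_smul (m : ℕ) {g : ℝ → X} (hg : MemLp g 2 gauss) :
    Integrable (fun x => hermiteEval m x • g x) gauss :=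
  integrable_smul_of_memLp_two (memLp_hermiteEval m (by simp)) hg

theorem integral_hermiteEval_smul_deriv (m : ℕ) {g g' : ℝ → X}
    (hd : ∀ x, HasDerivAt g (g' x) x) (hg : MemLp g 2 gauss) (hg' : MemLp g' 2 gauss) :
    ∫ x, hermiteEval m x • g' x ∂gauss = ∫ x, hermiteEval (m + 1) x • g x ∂gauss := by
  have hder := integrable_gauss_iff.1 (integrable_hermiteEval_smul m hg')
  have hsucc := integrable_gauss_iff.1 (integrable_hermiteEval_smul (m + 1) hg)
  have hself := integrable_gauss_iff.1 (integrable_hermiteEval_smul m hg)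
  have hparts := integral_bilinear_hasDerivAt_right_eq_neg_left_of_integrable
    (L := ContinuousLinearMap.lsmul ℝ ℝ)
    (fun x _ => hasDerivAt_gaussianPDFReal_mul_hermiteEval m x) (fun x _ => hd x)
    (by simpa [mul_smul] using hder) (by simpa [mul_smul] using hsucc.neg)
    (by simpa [mul_smul] using hself)
  rw [gauss, integral_gaussianReal_eq_integral_smul one_ne_zero,
    integral_gaussianReal_eq_integral_smul one_ne_zero]
  simpa [mul_smul, integral_neg] using hparts

end Vector

theorem integral_hermiteEval_succ (m : ℕ) : ∫ x, hermiteEval (m + 1) x ∂gauss = 0 := by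
  simpa using (integral_hermiteEval_smul_deriv m (g := fun _ => (1 : ℝ))
    (fun x => hasDerivAt_const x 1) (memLp_const 1) (memLp_const 0)).symm

theorem integral_hermiteEval_mul (m n : ℕ) :
    ∫ x, hermiteEval m x * hermiteEval n x ∂gauss = if m = n then (n.factorial : ℝ) else 0 := by
  induction n generalizing m with
  | zero => cases m <;> simp [integral_hermiteEval_succ]
  | succ n ih =>
    rcases m with _ | m
    · simp [integral_hermiteEval_succ]
    have hparts := integral_hermiteEval_smul_deriv m (hasDerivAt_hermiteEval_succ n)
      (memLp_hermiteEval _ (by simp)) ((memLp_hermiteEval _ (by simp)).const_mul _)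
    simp only [smul_eq_mul, mul_left_comm _ ((n : ℝ) + 1)] at hparts
    rw [← hparts, integral_const_mul, ih]
    simp only [Nat.add_right_cancel_iff, Nat.factorial_succ, mul_ite, mul_zero]
    push_cast
    rfl

theorem memLp_hermiteN (n : ℕ) {p : ℝ≥0∞} (hp : p ≠ ∞) : MemLp (hermiteN n) p gauss :=
  ((memLp_hermiteEval n hp).const_mul (√(n.factorial : ℝ))⁻¹).ae_eq
    (.of_forall fun _ => (div_eq_inv_mul _ _).symm)

theorem continuous_hermiteN (n : ℕ) : Continuous (hermiteN n) :=
  (continuous_hermiteEval n).div_const _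

theorem integral_hermiteN_mul (m n : ℕ) :
    ∫ x, hermiteN m x * hermiteN n x ∂gauss = if m = n then 1 else 0 := by
  simp only [hermiteN, div_mul_div_comm]
  rw [integral_div, integral_hermiteEval_mul]
  split_ifs with h
  · rw [h, Real.mul_self_sqrt (by positivity), div_self (by positivity)]
  · exact zero_div _

theorem integral_sum_hermiteN_sq (s : Finset ℕ) (a : ℕ → ℝ) :
    ∫ y, (∑ l ∈ s, a l * hermiteN l y) ^ 2 ∂gauss = ∑ l ∈ s, a l ^ 2 := by
  have hinteg : ∀ l k : ℕ, Integrable (fun y => a l * a k * (hermiteN l y * hermiteN k y)) gauss :=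
    fun l k => ((memLp_hermiteN l (p := 2) (by simp)).integrable_mul
      (memLp_hermiteN k (p := 2) (by simp))).const_mul _
  simp only [sq (Finset.sum _ _), Finset.sum_mul_sum, mul_mul_mul_comm]
  rw [integral_finsetSum _ fun l _ => integrable_finsetSum _ fun k _ => hinteg l k]
  refine Finset.sum_congr rfl fun l hl => ?_
  rw [integral_finsetSum _ fun k _ => hinteg l k]
  simp only [integral_const_mul, integral_hermiteN_mul, mul_ite, mul_one, mul_zero,
    Finset.sum_ite_eq, if_pos hl, sq]

/-! ### Norms of interpolants of Hermite polynomials -/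

theorem eLpNorm_two_eq_ofReal_sqrt_integral {Ω : Type*} [MeasurableSpace Ω] {μ : Measure Ω}
    {f : Ω → ℝ} (hf : MemLp f 2 μ) :
    eLpNorm f 2 μ = ENNReal.ofReal (√(∫ x, f x ^ 2 ∂μ)) := by
  rw [hf.eLpNorm_eq_integral_rpow_norm (by simp) (by simp), Real.sqrt_eq_rpow]
  simp

theorem continuous_lagrangeBasis (n i : ℕ) : Continuous (lagrangeBasis n i) := by
  unfold lagrangeBasis
  fun_prop

theorem lagrangeBasis_eq_sum_hermiteN {n i : ℕ} (hi : i < n + 1) (y : ℝ) :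
    lagrangeBasis n i y = ∑ l ∈ Finset.range (n + 1), hermiteN l (gaussHermite n i) /
      christoffelInv (n + 1) (gaussHermite n i) * hermiteN l y := by
  simp only [lagrangeBasis_eq_hermiteKernel hi, hermiteKernel, Finset.sum_div, mul_div_right_comm]

theorem memLp_lagrangeBasis {n i : ℕ} (hi : i < n + 1) : MemLp (lagrangeBasis n i) 2 gauss :=
  (memLp_finsetSum _ fun l _ => (memLp_hermiteN l (by simp)).const_mul _).ae_eq
    (.of_forall fun y => (lagrangeBasis_eq_sum_hermiteN hi y).symm)

theorem integral_lagrangeBasis_sq {n i : ℕ} (hi : i < n + 1) :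
    ∫ y, lagrangeBasis n i y ^ 2 ∂gauss = (christoffelInv (n + 1) (gaussHermite n i))⁻¹ := by
  simp only [lagrangeBasis_eq_sum_hermiteN hi]
  rw [integral_sum_hermiteN_sq]
  simp only [div_pow, ← Finset.sum_div]
  rw [← christoffelInv, sq, div_self_mul_self']

theorem eLpNorm_hermiteN (n : ℕ) : eLpNorm (hermiteN n) 2 gauss = 1 := by
  rw [eLpNorm_two_eq_ofReal_sqrt_integral (memLp_hermiteN n (by simp))]
  simp [sq, integral_hermiteN_mul]

theorem continuous_interp (n : ℕ) (f : ℝ → ℝ) : Continuous (interp n f) :=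
  continuous_finsetSum _ fun i _ => (continuous_lagrangeBasis n i).mul_const _

theorem eLpNorm_hermiteN_smul_lagrangeBasis_le {n i : ℕ} (hi : i < n + 1) (k : ℕ) :
    eLpNorm (hermiteN k (gaussHermite n i) • lagrangeBasis n i) 2 gauss ≤ 1 := by
  have hle := hermiteN_sq_le_christoffelInv
    (sq_le_of_hermiteEval_eq_zero (hermiteEval_gaussHermite hi)) k
  rw [eLpNorm_const_smul, eLpNorm_two_eq_ofReal_sqrt_integral (memLp_lagrangeBasis hi),
    integral_lagrangeBasis_sq hi, ← ofReal_norm, ← ENNReal.ofReal_mul (norm_nonneg _),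
    Real.norm_eq_abs, ← Real.sqrt_sq_eq_abs, ← Real.sqrt_mul (sq_nonneg _), ← div_eq_mul_inv,
    ENNReal.ofReal_le_one, Real.sqrt_le_one]
  exact (div_le_one (christoffelInv_pos n _)).2 hle

theorem eLpNorm_interp_hermiteN_le (n k : ℕ) :
    eLpNorm (interp n (hermiteN k)) 2 gauss ≤ (n + 1 : ℕ) := by
  have hsum : interp n (hermiteN k) = ∑ i ∈ Finset.range (n + 1),
      hermiteN k (gaussHermite n i) • lagrangeBasis n i := by
    ext y
    simp [interp, mul_comm]
  rw [hsum]
  refine (eLpNorm_sum_le (fun i _ => ((continuous_lagrangeBasis n i).const_smul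
    (hermiteN k (gaussHermite n i))).aestronglyMeasurable) (by norm_num)).trans ?_
  exact (Finset.sum_le_card_nsmul _ _ 1 fun i hi =>
    eLpNorm_hermiteN_smul_lagrangeBasis_le (Finset.mem_range.1 hi) k).trans (by simp)

/-- The difference `I_n - I_{n-1}` of univariate interpolation operators, with `I_{-1} = 0`. -/
def interpDiff (n : ℕ) (f : ℝ → ℝ) (y : ℝ) : ℝ :=
  interp n f y - if n = 0 then 0 else interp (n - 1) f y

theorem sum_interpDiff (n : ℕ) (f : ℝ → ℝ) (y : ℝ) :
    ∑ m ∈ Finset.range (n + 1), interpDiff m f y = interp n f y := by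
  induction n with
  | zero => simp [interpDiff]
  | succ n ih => rw [Finset.sum_range_succ, ih]; simp [interpDiff]

theorem interpDiff_hermiteN_of_lt {n k : ℕ} (h : k < n) (y : ℝ) :
    interpDiff n (hermiteN k) y = 0 := by
  rw [interpDiff, if_neg (by omega), interp_hermiteN_of_le h.le,
    interp_hermiteN_of_le (by omega), sub_self]

theorem continuous_interpDiff (n : ℕ) (f : ℝ → ℝ) : Continuous (interpDiff n f) := by
  unfold interpDiff
  split_ifs
  · exact (continuous_interp n f).sub continuous_const
  · exact (continuous_interp n f).sub (continuous_interp _ f)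

theorem eLpNorm_interpDiff_hermiteN_le (n k : ℕ) :
    eLpNorm (interpDiff n (hermiteN k)) 2 gauss ≤ (2 * (n + 1) : ℕ) := by
  rcases n with _ | n
  · have hinterp : interpDiff 0 (hermiteN k) = interp 0 (hermiteN k) := by
      ext y
      simp [interpDiff]
    rw [hinterp]
    exact (eLpNorm_interp_hermiteN_le 0 k).trans (by norm_num)
  · refine (eLpNorm_sub_le (continuous_interp (n + 1) _).aestronglyMeasurable
      (continuous_interp n _).aestronglyMeasurable (by norm_num)).trans ?_
    refine (add_le_add (eLpNorm_interp_hermiteN_le _ k) (eLpNorm_interp_hermiteN_le _ k)).trans ?_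
    exact_mod_cast (by omega)

/-! ### Cauchy's formula and Hermite coefficients -/

instance fact_two_pi_pos : Fact (0 < 2 * Real.pi) := ⟨Real.two_pi_pos⟩

/-- The angles, parametrizing the circles of Cauchy's formula. -/
abbrev Angle : Type := AddCircle (2 * Real.pi)

/-- The uniform distribution of an angle. -/
abbrev uniformAngle : Measure Angle := AddCircle.haarAddCircle

theorem norm_fourier_apply (l : ℤ) (θ : Angle) : ‖fourier l θ‖ = 1 := Circle.norm_coe _

theorem integral_fourier (l : ℤ) :
    ∫ θ : Angle, fourier l θ ∂uniformAngle = if l = 0 then 1 else 0 := by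
  simpa [fourierCoeff, Pi.single_apply, eq_comm] using
    congrFun (fourierCoeff_fourier (T := 2 * Real.pi) l) 0

/-- The horizontal strip `|Im z| < ρ`, the univariate case of `strip`. -/
def strip₁ (ρ : ℝ) : Set ℂ := {z | |z.im| < ρ}

theorem isOpen_strip₁ (ρ : ℝ) : IsOpen (strip₁ ρ) :=
  isOpen_lt (by fun_prop) continuous_const

theorem ofReal_add_mem_strip₁ {ρ : ℝ} (y : ℝ) {w : ℂ} (hw : ‖w‖ < ρ) : (y : ℂ) + w ∈ strip₁ ρ := by
  simpa [strip₁] using (Complex.abs_im_le_norm w).trans_lt hw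

theorem norm_mul_fourier {R : ℝ} (hR : 0 ≤ R) (l : ℤ) (θ : Angle) : ‖R * fourier l θ‖ = R := by
  rw [norm_mul, norm_fourier_apply, mul_one, Complex.norm_real, Real.norm_of_nonneg hR]

/-- A holomorphic function on a strip together with a square integrable bound on the discs around
the real points. -/
structure StripBound₁ {X : Type*} [NormedAddCommGroup X] [NormedSpace ℂ X]
    (ρ : ℝ) (φ : ℝ → ℝ) (h : ℂ → X) : Prop where
  integrable_sq : Integrable (fun y => φ y ^ 2) gauss
  diff : DifferentiableOn ℂ h (strip₁ ρ)
  bound : ∀ (y : ℝ) (w : ℂ), ‖w‖ < ρ → ‖h (y + w)‖ ≤ φ y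

section Cauchy

variable {X : Type*} [NormedAddCommGroup X] [NormedSpace ℂ X]

theorem diffContOnCl_ball_of_strip₁ {h : ℂ → X} {ρ R : ℝ} (hh : DifferentiableOn ℂ h (strip₁ ρ))
    (hRρ : R < ρ) (y : ℝ) : DiffContOnCl ℂ h (Metric.ball (y : ℂ) R) := by
  refine (hh.mono fun z hz => ?_).diffContOnCl
  have hz' : ‖z - y‖ ≤ R := mem_closedBall_iff_norm.1 (Metric.closure_ball_subset_closedBall hz)
  simpa using ofReal_add_mem_strip₁ y (hz'.trans_lt hRρ)

theorem fourierCoeff_circle [CompleteSpace X] {h : ℂ → X} {y : ℂ} {R : ℝ} (hR : 0 < R)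
    (hh : DiffContOnCl ℂ h (Metric.ball y R)) (l : ℕ) :
    fourierCoeff (fun θ : Angle => h (y + R * fourier 1 θ)) l =
      ((R ^ l / l.factorial : ℝ) : ℂ) • iteratedDeriv l h y := by
  have hR' : (R : ℂ) ≠ 0 := by exact_mod_cast hR.ne'
  have hfourier : ∀ (m : ℤ) (θ : ℝ), fourier m (θ : Angle) = Complex.exp (θ * Complex.I) ^ m :=
    fun m θ => by
      rw [fourier_coe_apply, ← Complex.exp_int_mul]
      congr 1
      push_cast
      field_simp
  have hintegrand : ∀ θ : ℝ, deriv (circleMap y R) θ •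
      (1 / (circleMap y R θ - y) ^ (l + 1)) • h (circleMap y R θ) = (Complex.I * ((R : ℂ) ^ l)⁻¹) •
        (fourier (-l) (θ : Angle) • h (y + R * fourier 1 (θ : Angle))) := fun θ => by
    have hexp := Complex.exp_ne_zero (θ * Complex.I)
    rw [hfourier, hfourier, zpow_one, deriv_circleMap, smul_smul, smul_smul, zpow_neg,
      zpow_natCast, circleMap, circleMap, add_sub_cancel_left, zero_add]
    congr 1
    field_simp
    ring
  have hcauchy := hh.circleIntegral_one_div_sub_center_pow_smul hR l
  simp only [circleIntegral, hintegrand, intervalIntegral.integral_smul] at hcauchy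
  rw [fourierCoeff_eq_intervalIntegral _ _ 0, zero_add, ← Complex.coe_smul,
    (eq_inv_smul_iff₀ (by simp [hR'])).2 hcauchy, smul_smul, smul_smul]
  congr 1
  push_cast
  field_simp

variable {h : ℂ → X} {ρ R : ℝ} {φ : ℝ → ℝ}

theorem hasDerivAt_iteratedDeriv [CompleteSpace X] (hh : DifferentiableOn ℂ h (strip₁ ρ))
    (hρ : 0 < ρ) (l : ℕ) (y : ℝ) :
    HasDerivAt (fun y : ℝ => iteratedDeriv l h (y : ℂ)) (iteratedDeriv (l + 1) h (y : ℂ)) y := by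
  have hy : (y : ℂ) ∈ strip₁ ρ := by simpa using ofReal_add_mem_strip₁ y (w := 0) (by simpa)
  have hanalytic : AnalyticAt ℂ h (y : ℂ) := hh.analyticOnNhd (isOpen_strip₁ ρ) _ hy
  have hd : DifferentiableAt ℂ (iteratedDeriv l h) (y : ℂ) := by
    rw [iteratedDeriv_eq_iterate]
    exact (hanalytic.iterated_deriv l).differentiableAt
  rw [iteratedDeriv_succ]
  simpa using! hd.hasDerivAt.scomp y Complex.ofRealCLM.hasDerivAt

theorem memLp_iteratedDeriv [CompleteSpace X] (hh : StripBound₁ ρ φ h) (hR : 0 < R) (hRρ : R < ρ)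
    (l : ℕ) : MemLp (fun y : ℝ => iteratedDeriv l h (y : ℂ)) 2 gauss := by
  have hc : Continuous (fun y : ℝ => iteratedDeriv l h (y : ℂ)) :=
    continuous_iff_continuousAt.2 fun y =>
      (hasDerivAt_iteratedDeriv hh.diff (hR.trans hRρ) l y).continuousAt
  rw [memLp_two_iff_integrable_sq_norm hc.aestronglyMeasurable]
  refine (hh.integrable_sq.const_mul ((l.factorial / R ^ l) ^ 2)).mono'
    (hc.norm.pow 2).aestronglyMeasurable (ae_of_all _ fun y => ?_)
  have hcauchy := Complex.norm_iteratedDeriv_le_of_forall_mem_sphere_norm_le l hR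
    (diffContOnCl_ball_of_strip₁ hh.diff hRρ y) (C := φ y) fun z hz => by
      simpa using hh.bound y (z - y) ((mem_sphere_iff_norm.1 hz).trans_lt hRρ)
  rw [Real.norm_eq_abs, abs_of_nonneg (by positivity), ← mul_pow]
  refine pow_le_pow_left₀ (norm_nonneg _) (hcauchy.trans_eq ?_) 2
  ring

theorem integral_hermiteEval_smul_iteratedDeriv [CompleteSpace X] (hh : StripBound₁ ρ φ h)
    (hR : 0 < R) (hRρ : R < ρ) (l m : ℕ) :
    ∫ y : ℝ, hermiteEval m y • iteratedDeriv l h (y : ℂ) ∂gauss =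
      ∫ y : ℝ, hermiteEval (m + l) y • h (y : ℂ) ∂gauss := by
  induction l generalizing m with
  | zero => simp
  | succ l ih =>
    rw [integral_hermiteEval_smul_deriv m (hasDerivAt_iteratedDeriv hh.diff (hR.trans hRρ) l)
      (memLp_iteratedDeriv hh hR hRρ l) (memLp_iteratedDeriv hh hR hRρ (l + 1)), ih (m + 1),
      Nat.add_right_comm, Nat.add_assoc]

/-- The law of a Gaussian variable together with an independent uniform angle. -/
abbrev gaussAngle : Measure (ℝ × Angle) := gauss.prod uniformAngle

theorem integrable_fourier_hermiteEval_smul (hh : StripBound₁ ρ φ h) (hR : 0 < R) (hRρ : R < ρ)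
    (l : ℤ) (m : ℕ) :
    Integrable (fun ω : ℝ × Angle => (fourier l ω.2 * (hermiteEval m ω.1 : ℝ)) •
      h (ω.1 + R * fourier 1 ω.2)) gaussAngle := by
  have hnorm : ∀ θ : Angle, ‖(R : ℂ) * fourier 1 θ‖ < ρ := fun θ =>
    (norm_mul_fourier hR.le 1 θ).trans_lt hRρ
  have hcont : Continuous (fun ω : ℝ × Angle => h (ω.1 + R * fourier 1 ω.2)) :=
    hh.diff.continuousOn.comp_continuous (by fun_prop) fun ω => ofReal_add_mem_strip₁ _ (hnorm _)
  have hkernel : Continuous (fun ω : ℝ × Angle => fourier l ω.2 * (hermiteEval m ω.1 : ℝ)) :=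
    ((map_continuous (fourier l)).comp continuous_snd).mul
      (Complex.continuous_ofReal.comp ((continuous_hermiteEval m).comp continuous_fst))
  refine (((memLp_hermiteEval m (p := 2) (by simp)).integrable_sq.add
    hh.integrable_sq).comp_fst uniformAngle).mono'
      (hkernel.smul hcont).aestronglyMeasurable (ae_of_all _ fun ω => ?_)
  rw [norm_smul, norm_mul, norm_fourier_apply, one_mul, Complex.norm_real, Real.norm_eq_abs]
  have hb := hh.bound ω.1 _ (hnorm ω.2)
  calc |hermiteEval m ω.1| * ‖h (ω.1 + R * fourier 1 ω.2)‖
      ≤ |hermiteEval m ω.1| * φ ω.1 := by gcongr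
    _ ≤ hermiteEval m ω.1 ^ 2 + φ ω.1 ^ 2 := by
        nlinarith [sq_nonneg (|hermiteEval m ω.1| - φ ω.1), sq_abs (hermiteEval m ω.1),
          sq_nonneg (|hermiteEval m ω.1| + φ ω.1)]

/-- Averaging over circles differentiates `l` times by Cauchy's formula, and integrating by parts
moves the derivatives to the Hermite polynomial. -/
theorem integral_fourier_hermiteEval_smul [CompleteSpace X] (hh : StripBound₁ ρ φ h) (hR : 0 < R)
    (hRρ : R < ρ) (l m : ℕ) :
    ∫ ω : ℝ × Angle, (fourier (-l) ω.2 * (hermiteEval m ω.1 : ℝ)) •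
        h (ω.1 + R * fourier 1 ω.2) ∂gaussAngle =
      ∫ ω : ℝ × Angle, ((R ^ l / l.factorial * hermiteEval (m + l) ω.1 : ℝ) : ℂ) • h ω.1
        ∂gaussAngle := by
  have hinner : ∀ y : ℝ, ∫ θ : Angle, (fourier (-l) θ * (hermiteEval m y : ℝ)) •
      h (y + R * fourier 1 θ) ∂uniformAngle = (R ^ l / l.factorial : ℝ) •
        (hermiteEval m y • iteratedDeriv l h (y : ℂ)) := fun y => by
    simp only [mul_comm (fourier _ _) ((hermiteEval m y : ℝ) : ℂ), mul_smul]
    rw [integral_smul, ← fourierCoeff,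
      fourierCoeff_circle hR (diffContOnCl_ball_of_strip₁ hh.diff hRρ y), Complex.coe_smul,
      Complex.coe_smul, smul_comm]
  rw [integral_prod _ (integrable_fourier_hermiteEval_smul hh hR hRρ _ m)]
  simp only [hinner]
  rw [integral_smul, integral_hermiteEval_smul_iteratedDeriv hh hR hRρ, integral_fun_fst
    (fun y : ℝ => ((R ^ l / l.factorial * hermiteEval (m + l) y : ℝ) : ℂ) • h y)]
  simp only [probReal_univ, one_smul, Complex.coe_smul, mul_smul]
  rw [integral_smul]

end Cauchy

/-! ### Bessel's inequality for vector-valued functions -/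

theorem sum_norm_sq_le_of_pairwise_inner_eq_zero {𝕜 E ι : Type*} [RCLike 𝕜] [NormedAddCommGroup E]
    [InnerProductSpace 𝕜 E] {S : Finset ι} {v : ι → E} {g : E}
    (horth : ∀ k ∈ S, ∀ l ∈ S, k ≠ l → inner 𝕜 (v k) (v l) = 0)
    (hg : ∀ k ∈ S, inner 𝕜 (v k) g = (‖v k‖ : 𝕜) ^ 2) : ∑ k ∈ S, ‖v k‖ ^ 2 ≤ ‖g‖ ^ 2 := by
  have hsum : inner 𝕜 (∑ k ∈ S, v k) (∑ k ∈ S, v k) = ((∑ k ∈ S, ‖v k‖ ^ 2 : ℝ) : 𝕜) := by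
    rw [sum_inner]
    push_cast
    refine Finset.sum_congr rfl fun k hk => ?_
    rw [inner_sum, Finset.sum_eq_single_of_mem k hk fun l hl hlk => horth k hk l hl hlk.symm]
    exact inner_self_eq_norm_sq_to_K _
  have hinner : inner 𝕜 (∑ k ∈ S, v k) g = ((∑ k ∈ S, ‖v k‖ ^ 2 : ℝ) : 𝕜) := by
    rw [sum_inner]
    push_cast
    exact Finset.sum_congr rfl hg
  have hnorm : ‖∑ k ∈ S, v k‖ ^ 2 = ∑ k ∈ S, ‖v k‖ ^ 2 := by
    rw [inner_self_eq_norm_sq_to_K] at hsum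
    exact_mod_cast hsum
  have hsub := norm_sub_sq (𝕜 := 𝕜) (∑ k ∈ S, v k) g
  rw [hinner, hnorm, RCLike.ofReal_re] at hsub
  nlinarith [sq_nonneg ‖∑ k ∈ S, v k - g‖]

theorem inner_toLp_toLp {Ω X : Type*} [MeasurableSpace Ω] {μ : Measure Ω} [NormedAddCommGroup X]
    [InnerProductSpace ℂ X] {f g : Ω → X} (hf : MemLp f 2 μ) (hg : MemLp g 2 μ) :
    inner ℂ (hf.toLp f) (hg.toLp g) = ∫ ω, inner ℂ (f ω) (g ω) ∂μ := by
  rw [L2.inner_def]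
  refine integral_congr_ae ?_
  filter_upwards [hf.coeFn_toLp, hg.coeFn_toLp] with ω hfω hgω
  rw [hfω, hgω]

theorem norm_toLp_sq {Ω X : Type*} [MeasurableSpace Ω] {μ : Measure Ω} [NormedAddCommGroup X]
    [InnerProductSpace ℂ X] {f : Ω → X} (hf : MemLp f 2 μ) :
    ‖hf.toLp f‖ ^ 2 = ∫ ω, ‖f ω‖ ^ 2 ∂μ := by
  have hself := inner_toLp_toLp hf hf
  simp only [inner_self_eq_norm_sq_to_K, ← RCLike.ofReal_pow, integral_ofReal] at hself
  exact RCLike.ofReal_inj.1 hself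

theorem sum_norm_sq_integral_le {Ω X ι : Type*} [MeasurableSpace Ω] {μ : Measure Ω}
    [NormedAddCommGroup X] [InnerProductSpace ℂ X] [CompleteSpace X] [DecidableEq ι]
    {S : Finset ι} {ψ : ι → Ω → ℂ} {G : Ω → X} (hG : MemLp G 2 μ) (hψ : ∀ k, MemLp (ψ k) 2 μ)
    (horth : ∀ k l, ∫ ω, (starRingEnd ℂ) (ψ k ω) * ψ l ω ∂μ = if k = l then 1 else 0) :
    ∑ k ∈ S, ‖∫ ω, (starRingEnd ℂ) (ψ k ω) • G ω ∂μ‖ ^ 2 ≤ ∫ ω, ‖G ω‖ ^ 2 ∂μ := by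
  set c : ι → X := fun k => ∫ ω, (starRingEnd ℂ) (ψ k ω) • G ω ∂μ
  have hψc : ∀ k, MemLp (fun ω => ψ k ω • c k) 2 μ := fun k => by
    simpa using! (hψ k).continuousLinearMap_comp ((ContinuousLinearMap.id ℂ ℂ).smulRight (c k))
  have hψG : ∀ k, Integrable (fun ω => (starRingEnd ℂ) (ψ k ω) • G ω) μ := fun k =>
    memLp_one_iff_integrable.1 (hG.smul (p := 2) (q := 2) (hψ k).star)
  have hinner : ∀ k l, inner ℂ ((hψc k).toLp _) ((hψc l).toLp _) =
      if k = l then (‖c k‖ : ℂ) ^ 2 else 0 := fun k l => by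
    simp only [inner_toLp_toLp, inner_smul_left, inner_smul_right, ← mul_assoc]
    rw [integral_mul_const]
    simp only [mul_comm (ψ l _), horth]
    split_ifs with hkl
    · rw [hkl, one_mul, inner_self_eq_norm_sq_to_K]
      rfl
    · exact zero_mul _
  have hnorm : ∀ k, (‖(hψc k).toLp _‖ : ℂ) ^ 2 = (‖c k‖ : ℂ) ^ 2 := fun k => by
    simpa [inner_self_eq_norm_sq_to_K] using hinner k k
  have hG_inner : ∀ k, inner ℂ ((hψc k).toLp _) (hG.toLp G) = (‖c k‖ : ℂ) ^ 2 := fun k => by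
    simp only [inner_toLp_toLp, inner_smul_left, ← inner_smul_right]
    rw [integral_inner (hψG k)]
    exact inner_self_eq_norm_sq_to_K _
  have hbessel := sum_norm_sq_le_of_pairwise_inner_eq_zero (𝕜 := ℂ) (S := S)
    (v := fun k => (hψc k).toLp _) (g := hG.toLp G)
    (fun k _ l _ hkl => (hinner k l).trans (if_neg hkl))
    (fun k _ => (hG_inner k).trans (hnorm k).symm)
  rw [norm_toLp_sq] at hbessel
  refine (Finset.sum_congr rfl fun k _ => ?_).trans_le hbessel
  exact_mod_cast (hnorm k).symm

/-! ### Weighted summability of the Hermite coefficients -/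

/-- The normalized Hermite polynomials of `N` variables, an orthonormal basis of `L²(ℝ^N; γ_N)`. -/
def hermiteProd {N : ℕ} (ν : Fin N → ℕ) (y : Fin N → ℝ) : ℝ := ∏ j, hermiteN (ν j) (y j)

/-- The Hermite coefficients of a function of `N` variables. -/
def hermiteCoeff {X : Type*} [NormedAddCommGroup X] [NormedSpace ℝ X] {N : ℕ}
    (f : (Fin N → ℝ) → X) (ν : Fin N → ℕ) : X :=
  ∫ y, hermiteProd ν y • f y ∂gammaFin N

theorem continuous_hermiteProd {N : ℕ} (ν : Fin N → ℕ) : Continuous (hermiteProd ν) :=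
  continuous_finsetProd _ fun j _ => (continuous_hermiteN (ν j)).comp (continuous_apply j)

theorem memLp_two_prod {𝕜 ι : Type*} [RCLike 𝕜] [Fintype ι] {E : ι → Type*}
    [∀ i, MeasurableSpace (E i)] {m : ∀ i, Measure (E i)} [∀ i, SigmaFinite (m i)]
    {f : ∀ i, E i → 𝕜} (hf : ∀ i, MemLp (f i) 2 (m i)) :
    MemLp (fun ω : ∀ i, E i => ∏ i, f i (ω i)) 2 (Measure.pi m) := by
  have hmeas : AEStronglyMeasurable (fun ω : ∀ i, E i => ∏ i, f i (ω i)) (Measure.pi m) :=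
    Finset.aestronglyMeasurable_fun_prod _ fun i _ =>
      (hf i).1.comp_quasiMeasurePreserving (Measure.quasiMeasurePreserving_eval _ i)
  rw [memLp_two_iff_integrable_sq_norm hmeas]
  simp only [norm_prod, ← Finset.prod_pow]
  exact Integrable.fintype_prod_dep fun i => (hf i).integrable_norm_pow (by simp)

section Resampling

variable {ι : Type*} [Fintype ι] [DecidableEq ι] {E : ι → Type*} [∀ i, MeasurableSpace (E i)]
  {m : ∀ i, Measure (E i)} [∀ i, IsProbabilityMeasure (m i)]

theorem measurePreserving_update (j : ι) :
    MeasurePreserving (fun p : (∀ i, E i) × E j => Function.update p.1 j p.2)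
      ((Measure.pi m).prod (m j)) (Measure.pi m) := by
  have hmeas : Measurable (fun p : (∀ i, E i) × E j => Function.update p.1 j p.2) :=
    measurable_update'
  refine ⟨hmeas, (Measure.pi_eq fun s hs => ?_).symm⟩
  have hpreimage : (fun p : (∀ i, E i) × E j => Function.update p.1 j p.2) ⁻¹' Set.univ.pi s =
      Set.univ.pi (Function.update s j Set.univ) ×ˢ s j := by
    ext p
    simp only [Set.mem_preimage, Set.mem_prod, Set.mem_univ_pi]
    refine ⟨fun hp => ⟨fun i => ?_, by simpa using hp j⟩, fun hp i => ?_⟩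
    all_goals rcases eq_or_ne i j with rfl | hij
    · simp
    · simpa [hij] using hp i
    · simpa using hp.2
    · simpa [hij] using hp.1 i
  rw [Measure.map_apply hmeas (.univ_pi hs), hpreimage, Measure.prod_prod, Measure.pi_pi,
    ← Finset.prod_erase_mul _ _ (Finset.mem_univ j), ← Finset.prod_erase_mul Finset.univ
      (fun i => m i (s i)) (Finset.mem_univ j)]
  rw [Function.update_self, measure_univ, mul_one]
  congr 1
  refine Finset.prod_congr rfl fun i hi => ?_
  rw [Function.update_of_ne (Finset.ne_of_mem_erase hi)]

theorem integrable_comp_update {X : Type*} [NormedAddCommGroup X] (j : ι)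
    {f : (∀ i, E i) → X} (hf : Integrable f (Measure.pi m)) :
    Integrable (fun p : (∀ i, E i) × E j => f (Function.update p.1 j p.2))
      ((Measure.pi m).prod (m j)) :=
  (measurePreserving_update j).integrable_comp_of_integrable hf

theorem integral_pi_eq_integral_update {X : Type*} [NormedAddCommGroup X] [NormedSpace ℝ X]
    (j : ι) {f : (∀ i, E i) → X} (hf : Integrable f (Measure.pi m)) :
    ∫ ω, f ω ∂Measure.pi m = ∫ ω, ∫ a, f (Function.update ω j a) ∂m j ∂Measure.pi m := by
  have hmp := measurePreserving_update (m := m) j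
  rw [← integral_prod _ (integrable_comp_update j hf), ← integral_map hmp.measurable.aemeasurable
    (by rw [hmp.map_eq]; exact hf.aestronglyMeasurable), hmp.map_eq]

end Resampling

/-- The law of `N` independent pairs of a Gaussian variable and a uniform angle. -/
abbrev gaussAnglePi (N : ℕ) : Measure (Fin N → ℝ × Angle) := Measure.pi fun _ => gaussAngle

theorem measurePreserving_fst_gaussAnglePi (N : ℕ) :
    MeasurePreserving (fun (ω : Fin N → ℝ × Angle) j => (ω j).1) (gaussAnglePi N) (gammaFin N) :=
  measurePreserving_pi _ _ fun _ => measurePreserving_fst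

theorem integral_comp_fst_gaussAnglePi {X : Type*} [NormedAddCommGroup X] [NormedSpace ℝ X]
    {N : ℕ} {f : (Fin N → ℝ) → X} (hf : AEStronglyMeasurable f (gammaFin N)) :
    ∫ ω : Fin N → ℝ × Angle, f (fun j => (ω j).1) ∂gaussAnglePi N = ∫ y, f y ∂gammaFin N := by
  have hmp := measurePreserving_fst_gaussAnglePi N
  rw [← hmp.map_eq, integral_map hmp.measurable.aemeasurable (by rwa [hmp.map_eq])]

section CircleKernel

variable {N : ℕ} (s : Finset (Fin N)) (R : Fin N → ℝ) (α μ : Fin N → ℕ)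

/-- The displacement from the real point: it moves on the circle of radius `R j` in each coordinate
`j` outside `s`, and vanishes in the coordinates of `s`, where Cauchy's formula has been applied. -/
def circleShift (ω : Fin N → ℝ × Angle) : Fin N → ℂ :=
  fun j => if j ∈ s then 0 else R j * fourier 1 (ω j).2

/-- The point at which the holomorphic function is evaluated, given Gaussians and angles. -/
def circlePoint (ω : Fin N → ℝ × Angle) : Fin N → ℂ := fun j => (ω j).1 + circleShift s R ω j

/-- The factor in coordinate `j` of the kernel against which the function is integrated: a
character times a Hermite polynomial outside `s`, and in `s` the Hermite polynomial of higher order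
that `integral_fourier_hermiteEval_smul` puts in its place. -/
def circleKernel (j : Fin N) (a : ℝ × Angle) : ℂ :=
  if j ∈ s then ((R j ^ α j / (α j).factorial * hermiteEval (μ j + α j) a.1 : ℝ) : ℂ)
  else fourier (-(α j)) a.2 * (hermiteEval (μ j) a.1 : ℝ)

theorem continuous_circleKernel (j : Fin N) : Continuous (circleKernel s R α μ j) := by
  unfold circleKernel
  have hH := fun n => (continuous_hermiteEval n).comp (continuous_fst (X := ℝ) (Y := Angle))
  split_ifs
  · exact Complex.continuous_ofReal.comp (continuous_const.mul (hH _))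
  · exact ((map_continuous (fourier (-(α j : ℤ)))).comp continuous_snd).mul
      (Complex.continuous_ofReal.comp (hH _))

theorem integrable_norm_circleKernel_sq (j : Fin N) :
    Integrable (fun a => ‖circleKernel s R α μ j a‖ ^ 2) gaussAngle := by
  have hH := fun n c => (((memLp_hermiteEval n (p := 2) (by simp)).const_mul
    c).integrable_norm_pow (by simp)).comp_fst (ν := uniformAngle)
  unfold circleKernel
  split_ifs
  · simpa only [Complex.norm_real] using hH (μ j + α j) (R j ^ α j / (α j).factorial)
  · simpa only [norm_mul, norm_fourier_apply, Complex.norm_real, norm_one] using hH (μ j) 1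

theorem memLp_prod_circleKernel :
    MemLp (fun ω : Fin N → ℝ × Angle => ∏ j, circleKernel s R α μ j (ω j)) 2 (gaussAnglePi N) :=
  memLp_two_prod fun j => (memLp_two_iff_integrable_sq_norm
    (continuous_circleKernel s R α μ j).aestronglyMeasurable).2
      (integrable_norm_circleKernel_sq s R α μ j)

variable {s R α μ}

theorem circlePoint_update_of_notMem {j : Fin N} (hj : j ∉ s) (ω : Fin N → ℝ × Angle)
    (a : ℝ × Angle) : circlePoint s R (Function.update ω j a) =
      Function.update (circlePoint s R ω) j (a.1 + R j * fourier 1 a.2) := by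
  funext i
  rcases eq_or_ne i j with rfl | hij
  · simp [circlePoint, circleShift, hj]
  · simp [circlePoint, circleShift, hij]

theorem circlePoint_insert_update (j : Fin N) (ω : Fin N → ℝ × Angle) (a : ℝ × Angle) :
    circlePoint (insert j s) R (Function.update ω j a) =
      Function.update (circlePoint s R ω) j (a.1 : ℂ) := by
  funext i
  rcases eq_or_ne i j with rfl | hij
  · simp [circlePoint, circleShift]
  · simp [circlePoint, circleShift, hij]

theorem prod_circleKernel_update (j : Fin N) (ω : Fin N → ℝ × Angle) (a : ℝ × Angle) :
    ∏ i, circleKernel s R α μ i (Function.update ω j a i) =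
      (∏ i ∈ Finset.univ.erase j, circleKernel s R α μ i (ω i)) * circleKernel s R α μ j a := by
  rw [← Finset.prod_erase_mul _ _ (Finset.mem_univ j), Function.update_self]
  congr 1
  refine Finset.prod_congr rfl fun i hi => ?_
  rw [Function.update_of_ne (Finset.ne_of_mem_erase hi)]

theorem prod_erase_circleKernel_insert (j : Fin N) (ω : Fin N → ℝ × Angle) :
    ∏ i ∈ Finset.univ.erase j, circleKernel (insert j s) R α μ i (ω i) =
      ∏ i ∈ Finset.univ.erase j, circleKernel s R α μ i (ω i) :=
  Finset.prod_congr rfl fun i hi => by simp [circleKernel, Finset.ne_of_mem_erase hi]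

end CircleKernel

/-- A holomorphic function on a product of strips with an `L²` bound on polydiscs. -/
structure StripBound {X : Type*} [NormedAddCommGroup X] [NormedSpace ℂ X] {N : ℕ}
    (ρ : Fin N → ℝ) (φ : (Fin N → ℝ) → ℝ) (F : (Fin N → ℂ) → X) : Prop where
  memLp : MemLp φ 2 (gammaFin N)
  diff : DifferentiableOn ℂ F (strip ρ)
  bound : ∀ y : Fin N → ℝ, ∀ z ∈ polydisc ρ, ‖F (fun i => (y i : ℂ) + z i)‖ ≤ φ y

section Strip

variable {X : Type*} [NormedAddCommGroup X] [NormedSpace ℂ X] {N : ℕ}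
  {ρ R : Fin N → ℝ} {φ : (Fin N → ℝ) → ℝ} {F : (Fin N → ℂ) → X}

theorem circleShift_mem_polydisc (hR : ∀ j, 0 < R j) (hRρ : ∀ j, R j < ρ j) (s : Finset (Fin N))
    (ω : Fin N → ℝ × Angle) : circleShift s R ω ∈ polydisc ρ := fun j => by
  unfold circleShift
  split_ifs
  · simpa using (hR j).trans (hRρ j)
  · exact (norm_mul_fourier (hR j).le 1 _).trans_lt (hRρ j)

theorem add_mem_strip {z : Fin N → ℂ} (hz : z ∈ polydisc ρ) (y : Fin N → ℝ) :
    (fun i => (y i : ℂ) + z i) ∈ strip ρ :=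
  fun j => ofReal_add_mem_strip₁ (y j) (hz j)

theorem stripBound₁_update (hF : StripBound ρ φ F) {y : Fin N → ℝ} {z : Fin N → ℂ}
    (hz : z ∈ polydisc ρ) {j : Fin N}
    (hφ : Integrable (fun t => φ (Function.update y j t) ^ 2) gauss) :
    StripBound₁ (ρ j) (fun t => φ (Function.update y j t))
      (fun w => F (Function.update (fun i => (y i : ℂ) + z i) j w)) where
  integrable_sq := hφ
  diff := by
    refine hF.diff.comp (fun w _ => ?_) fun w hw i => ?_
    · exact (hasFDerivAt_update (𝕜 := ℂ) (E := fun _ : Fin N => ℂ) _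
        w).differentiableAt.differentiableWithinAt
    · rcases eq_or_ne i j with rfl | hij
      · simpa [strip₁] using hw
      · simpa [hij] using add_mem_strip hz y i
  bound t w hw := by
    have hsplit : Function.update (fun i => (y i : ℂ) + z i) j (t + w) =
        fun i => (Function.update y j t i : ℂ) + Function.update z j w i := by
      funext i
      rcases eq_or_ne i j with rfl | hij <;> simp [*]
    rw [hsplit]
    refine hF.bound _ _ fun i => ?_
    rcases eq_or_ne i j with rfl | hij
    · simpa using hw
    · simpa [hij] using hz i

theorem continuous_comp_ofReal (hF : StripBound ρ φ F) (hρ : ∀ j, 0 < ρ j) :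
    Continuous (fun y : Fin N → ℝ => F fun i => (y i : ℂ)) :=
  hF.diff.continuousOn.comp_continuous (by fun_prop) fun y => by
    simpa using add_mem_strip (z := 0) (fun j => by simpa using hρ j) y

theorem continuous_comp_circlePoint (hF : StripBound ρ φ F) (hR : ∀ j, 0 < R j)
    (hRρ : ∀ j, R j < ρ j) (s : Finset (Fin N)) :
    Continuous (fun ω => F (circlePoint s R ω)) := by
  refine hF.diff.continuousOn.comp_continuous (continuous_pi fun j => ?_) fun ω =>
    add_mem_strip (circleShift_mem_polydisc hR hRρ s ω) _
  have hfourier : Continuous fun ω : Fin N → ℝ × Angle => fourier 1 (ω j).2 :=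
    (map_continuous (fourier 1)).comp (continuous_snd.comp (continuous_apply j))
  unfold circlePoint circleShift
  split_ifs <;> fun_prop

theorem memLp_comp_circlePoint (hF : StripBound ρ φ F) (hR : ∀ j, 0 < R j)
    (hRρ : ∀ j, R j < ρ j) (s : Finset (Fin N)) :
    MemLp (fun ω => F (circlePoint s R ω)) 2 (gaussAnglePi N) :=
  (hF.memLp.comp_measurePreserving (measurePreserving_fst_gaussAnglePi N)).mono
    (continuous_comp_circlePoint hF hR hRρ s).aestronglyMeasurable (ae_of_all _ fun ω =>
      (hF.bound _ _ (circleShift_mem_polydisc hR hRρ s ω)).trans (le_abs_self _))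

theorem integral_norm_comp_circlePoint_sq_le (hF : StripBound ρ φ F) (hR : ∀ j, 0 < R j)
    (hRρ : ∀ j, R j < ρ j) (s : Finset (Fin N)) :
    ∫ ω, ‖F (circlePoint s R ω)‖ ^ 2 ∂gaussAnglePi N ≤ ∫ y, φ y ^ 2 ∂gammaFin N := by
  rw [← integral_comp_fst_gaussAnglePi hF.memLp.integrable_sq.aestronglyMeasurable]
  refine integral_mono ((memLp_comp_circlePoint hF hR hRρ s).integrable_norm_pow (by simp))
    (hF.memLp.comp_measurePreserving (measurePreserving_fst_gaussAnglePi N)).integrable_sq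
    fun ω => pow_le_pow_left₀ (norm_nonneg _) ?_ 2
  exact hF.bound _ _ (circleShift_mem_polydisc hR hRρ s ω)

theorem integrable_circleKernel_smul (hF : StripBound ρ φ F) (hR : ∀ j, 0 < R j)
    (hRρ : ∀ j, R j < ρ j) (s : Finset (Fin N)) (α μ : Fin N → ℕ) :
    Integrable (fun ω => (∏ j, circleKernel s R α μ j (ω j)) • F (circlePoint s R ω))
      (gaussAnglePi N) :=
  integrable_smul_of_memLp_two (memLp_prod_circleKernel s R α μ)
    (memLp_comp_circlePoint hF hR hRρ s)

variable [CompleteSpace X]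

theorem integral_circleKernel_smul_insert (hF : StripBound ρ φ F) (hR : ∀ j, 0 < R j)
    (hRρ : ∀ j, R j < ρ j) {s : Finset (Fin N)} (α μ : Fin N → ℕ) {j : Fin N} (hj : j ∉ s) :
    ∫ ω, (∏ i, circleKernel s R α μ i (ω i)) • F (circlePoint s R ω) ∂gaussAnglePi N =
      ∫ ω, (∏ i, circleKernel (insert j s) R α μ i (ω i)) • F (circlePoint (insert j s) R ω)
        ∂gaussAnglePi N := by
  have hφ : ∀ᵐ ω ∂gaussAnglePi N,
      Integrable (fun t => φ (Function.update (fun i => (ω i).1) j t) ^ 2) gauss :=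
    (measurePreserving_fst_gaussAnglePi N).quasiMeasurePreserving.ae
      (integrable_comp_update (m := fun _ : Fin N => gauss) j hF.memLp.integrable_sq).prod_right_ae
  rw [integral_pi_eq_integral_update j (integrable_circleKernel_smul hF hR hRρ s α μ),
    integral_pi_eq_integral_update j (integrable_circleKernel_smul hF hR hRρ _ α μ)]
  refine integral_congr_ae ?_
  filter_upwards [hφ] with ω hω
  simp only [circlePoint_update_of_notMem hj, circlePoint_insert_update, prod_circleKernel_update,
    prod_erase_circleKernel_insert, mul_smul (∏ _ ∈ _, _)]
  rw [integral_smul, integral_smul]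
  congr 1
  simp only [circleKernel, if_neg hj, if_pos (Finset.mem_insert_self j s)]
  exact integral_fourier_hermiteEval_smul
    (stripBound₁_update hF (circleShift_mem_polydisc hR hRρ s ω) hω) (hR j) (hRρ j) (α j) (μ j)

theorem integral_circleKernel_smul_eq (hF : StripBound ρ φ F) (hR : ∀ j, 0 < R j)
    (hRρ : ∀ j, R j < ρ j) (s : Finset (Fin N)) (α μ : Fin N → ℕ) :
    ∫ ω, (∏ j, circleKernel ∅ R α μ j (ω j)) • F (circlePoint ∅ R ω) ∂gaussAnglePi N =
      ∫ ω, (∏ j, circleKernel s R α μ j (ω j)) • F (circlePoint s R ω) ∂gaussAnglePi N := by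
  induction s using Finset.induction_on with
  | empty => rfl
  | insert j s hj ih => rw [ih, integral_circleKernel_smul_insert hF hR hRρ α μ hj]

theorem prod_circleKernel_univ (R : Fin N → ℝ) (α μ : Fin N → ℕ) (ω : Fin N → ℝ × Angle) :
    ∏ i, circleKernel Finset.univ R α μ i (ω i) =
      (((∏ j, (R j ^ α j / (α j).factorial * √((μ j + α j).factorial : ℝ))) *
        hermiteProd (fun j => μ j + α j) (fun j => (ω j).1) : ℝ) : ℂ) := by
  rw [hermiteProd, ← Finset.prod_mul_distrib, Complex.ofReal_prod]
  refine Finset.prod_congr rfl fun j _ => ?_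
  rw [circleKernel, if_pos (Finset.mem_univ _), hermiteN]
  congr 1
  field_simp

theorem integral_circleKernel_smul_eq_hermiteCoeff (hF : StripBound ρ φ F) (hR : ∀ j, 0 < R j)
    (hRρ : ∀ j, R j < ρ j) (α μ : Fin N → ℕ) :
    ∫ ω, (∏ j, circleKernel ∅ R α μ j (ω j)) • F (circlePoint ∅ R ω) ∂gaussAnglePi N =
      (∏ j, (R j ^ α j / (α j).factorial * √((μ j + α j).factorial : ℝ))) •
        hermiteCoeff (fun y => F fun i => (y i : ℂ)) (fun j => μ j + α j) := by
  have hpoint : ∀ ω, circlePoint Finset.univ R ω = fun i => ((ω i).1 : ℂ) := fun ω => by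
    funext i
    simp [circlePoint, circleShift]
  rw [integral_circleKernel_smul_eq hF hR hRρ Finset.univ]
  simp only [prod_circleKernel_univ, hpoint, Complex.coe_smul, mul_smul]
  rw [integral_smul, integral_comp_fst_gaussAnglePi
    (f := fun y => hermiteProd (fun j => μ j + α j) y • F fun i => (y i : ℂ))]
  · rfl
  · exact ((continuous_hermiteProd _).smul
      (continuous_comp_ofReal hF fun j => (hR j).trans (hRρ j))).aestronglyMeasurable

end Strip

section MixedFamily

variable {N : ℕ}

/-- The products of characters and normalized Hermite polynomials, an orthonormal family. -/
def charHermite (α μ : Fin N → ℕ) (ω : Fin N → ℝ × Angle) : ℂ :=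
  ∏ j, (fourier (α j) (ω j).2 * (hermiteN (μ j) (ω j).1 : ℝ))

theorem integral_conj_fourier_hermiteN_mul (k l m n : ℕ) :
    ∫ a : ℝ × Angle, (starRingEnd ℂ) (fourier k a.2 * (hermiteN m a.1 : ℝ)) *
      (fourier l a.2 * (hermiteN n a.1 : ℝ)) ∂gaussAngle = if k = l ∧ m = n then 1 else 0 := by
  have hfactor : ∀ a : ℝ × Angle, (starRingEnd ℂ) (fourier k a.2 * (hermiteN m a.1 : ℝ)) *
      (fourier l a.2 * (hermiteN n a.1 : ℝ)) =
        ((hermiteN m a.1 * hermiteN n a.1 : ℝ) : ℂ) * fourier (-(k : ℤ) + l) a.2 := fun a => by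
    rw [map_mul, Complex.conj_ofReal, ← fourier_neg, fourier_add]
    push_cast
    ring
  have hzero : -(k : ℤ) + l = 0 ↔ k = l := by omega
  simp only [hfactor]
  rw [integral_prod_mul (fun y : ℝ => ((hermiteN m y * hermiteN n y : ℝ) : ℂ))
    (fun θ : Angle => fourier (-(k : ℤ) + l) θ), integral_complex_ofReal, integral_hermiteN_mul,
    integral_fourier]
  by_cases hkl : k = l <;> by_cases hmn : m = n <;> simp [hzero, hkl, hmn]

theorem integral_conj_charHermite_mul (α μ α' μ' : Fin N → ℕ) :
    ∫ ω, (starRingEnd ℂ) (charHermite α μ ω) * charHermite α' μ' ω ∂gaussAnglePi N =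
      if α = α' ∧ μ = μ' then 1 else 0 := by
  simp only [charHermite, map_prod, ← Finset.prod_mul_distrib]
  rw [integral_fintype_prod_eq_prod (μ := fun _ : Fin N => gaussAngle) (f := fun j a =>
    (starRingEnd ℂ) (fourier (α j) a.2 * (hermiteN (μ j) a.1 : ℝ)) *
      (fourier (α' j) a.2 * (hermiteN (μ' j) a.1 : ℝ)))]
  simp only [integral_conj_fourier_hermiteN_mul, Finset.prod_ite_zero, Finset.prod_const_one,
    Finset.mem_univ, true_imp_iff, forall_and, funext_iff]

theorem conj_charHermite (R : Fin N → ℝ) (α μ : Fin N → ℕ) (ω : Fin N → ℝ × Angle) :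
    (starRingEnd ℂ) (charHermite α μ ω) =
      ((∏ j, (√((μ j).factorial : ℝ))⁻¹ : ℝ) : ℂ) * ∏ j, circleKernel ∅ R α μ j (ω j) := by
  rw [charHermite, map_prod, Complex.ofReal_prod, ← Finset.prod_mul_distrib]
  refine Finset.prod_congr rfl fun j _ => ?_
  rw [map_mul, ← fourier_neg, Complex.conj_ofReal, circleKernel, if_neg (by simp), hermiteN]
  push_cast
  ring

theorem memLp_charHermite (α μ : Fin N → ℕ) : MemLp (charHermite α μ) 2 (gaussAnglePi N) := by
  refine ((memLp_prod_circleKernel ∅ 1 α μ).const_mul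
    ((∏ j, (√((μ j).factorial : ℝ))⁻¹ : ℝ) : ℂ)).star.ae_eq (.of_forall fun ω => ?_)
  rw [Pi.star_apply, ← conj_charHermite]
  exact star_star _

end MixedFamily

/-- Bessel's inequality for the orthonormal family `charHermite (a ν) (ν - a ν)`: averaging over
circles with `a ν j` derivatives in coordinate `j` turns the growth of the derivatives of `F` into
a weight on the Hermite coefficients. -/
theorem sum_weight_mul_hermiteCoeff_sq_le {X : Type*} [NormedAddCommGroup X]
    [InnerProductSpace ℂ X] [CompleteSpace X] {N : ℕ} {ρ R : Fin N → ℝ} {φ : (Fin N → ℝ) → ℝ}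
    {F : (Fin N → ℂ) → X} (hF : StripBound ρ φ F) (hR : ∀ j, 0 < R j) (hRρ : ∀ j, R j < ρ j)
    (S : Finset (Fin N → ℕ)) {a : (Fin N → ℕ) → Fin N → ℕ} (ha : ∀ ν j, a ν j ≤ ν j) :
    ∑ ν ∈ S, (∏ j, ((R j ^ a ν j / (a ν j).factorial) ^ 2 *
      ((ν j).factorial / (ν j - a ν j).factorial))) *
        ‖hermiteCoeff (fun y => F fun i => (y i : ℂ)) ν‖ ^ 2 ≤ ∫ y, φ y ^ 2 ∂gammaFin N := by
  have horth : ∀ ν ν' : Fin N → ℕ, ∫ ω, (starRingEnd ℂ) (charHermite (a ν) (ν - a ν) ω) *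
      charHermite (a ν') (ν' - a ν') ω ∂gaussAnglePi N = if ν = ν' then 1 else 0 := fun ν ν' => by
    rw [integral_conj_charHermite_mul]
    refine if_congr ⟨fun h => ?_, fun h => h ▸ ⟨rfl, rfl⟩⟩ rfl rfl
    rw [← tsub_add_cancel_of_le (show a ν ≤ ν from ha ν), h.2, h.1]
    exact tsub_add_cancel_of_le (show a ν' ≤ ν' from ha ν')
  refine le_trans (le_of_eq (Finset.sum_congr rfl fun ν _ => ?_))
    ((sum_norm_sq_integral_le (S := S) (memLp_comp_circlePoint hF hR hRρ ∅)
      (fun _ => memLp_charHermite _ _) horth).trans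
      (integral_norm_comp_circlePoint_sq_le hF hR hRρ ∅))
  have hν : (fun j => (ν - a ν) j + a ν j) = ν := tsub_add_cancel_of_le (show a ν ≤ ν from ha ν)
  simp only [conj_charHermite R, mul_smul]
  rw [integral_smul, integral_circleKernel_smul_eq_hermiteCoeff hF hR hRρ, hν, Complex.coe_smul,
    smul_smul, norm_smul, mul_pow, Real.norm_eq_abs, sq_abs, ← Finset.prod_mul_distrib,
    ← Finset.prod_pow]
  congr 1
  refine Finset.prod_congr rfl fun j _ => ?_
  rw [congrFun hν j, mul_pow, mul_pow, inv_pow, Real.sq_sqrt (by positivity),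
    Real.sq_sqrt (by positivity), Pi.sub_apply]
  ring

/-! ### Completeness of the Hermite polynomials -/

section Completeness

variable {N : ℕ}

instance isProbabilityMeasure_gammaFin : IsProbabilityMeasure (gammaFin N) := by
  unfold gammaFin
  infer_instance

instance isOpenPosMeasure_gammaFin : (gammaFin N).IsOpenPosMeasure := by
  have : gauss.IsOpenPosMeasure :=
    (gaussianReal_absolutelyContinuous' 0 one_ne_zero).isOpenPosMeasure
  unfold gammaFin
  infer_instance

theorem memLp_hermiteProd (ν : Fin N → ℕ) : MemLp (hermiteProd ν) 2 (gammaFin N) :=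
  memLp_two_prod fun j => memLp_hermiteN (ν j) (by simp)

theorem integral_hermiteProd_mul (ν ν' : Fin N → ℕ) :
    ∫ y, hermiteProd ν y * hermiteProd ν' y ∂gammaFin N = if ν = ν' then 1 else 0 := by
  simp only [hermiteProd, ← Finset.prod_mul_distrib]
  rw [gammaFin, integral_fintype_prod_eq_prod (μ := fun _ : Fin N => gauss)
    (f := fun j a => hermiteN (ν j) a * hermiteN (ν' j) a)]
  simp only [integral_hermiteN_mul, Finset.prod_ite_zero, Finset.prod_const_one, Finset.mem_univ,
    true_imp_iff, funext_iff]

/-- The complex Hermite polynomials as a polynomial sequence, which therefore spans `ℂ[X]`. -/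
def hermiteSequence : Polynomial.Sequence ℂ where
  elems' n := (Polynomial.hermite n).map (Int.castRingHom ℂ)
  degree_eq' n := by
    rw [(Polynomial.hermite_monic n).degree_map, Polynomial.degree_hermite]

theorem eval_hermiteSequence (n : ℕ) (x : ℝ) :
    (hermiteSequence n).eval (x : ℂ) = √(n.factorial : ℝ) * (hermiteN n x : ℂ) := by
  have hcast : (hermiteSequence n).eval (x : ℂ) = hermiteEval n (x : ℂ) := by
    rw [hermiteEval, Polynomial.aeval_def, ← Polynomial.eval_map]
    rfl
  have hfact : √(n.factorial : ℝ) ≠ 0 := by positivity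
  rw [hcast, hermiteN, ← Complex.ofReal_mul, mul_div_cancel₀ _ hfact]
  exact (map_hermiteEval Complex.ofRealHom n x).symm

theorem exists_eval_eq_sum_hermiteN (q : Polynomial ℂ) :
    ∃ (s : Finset ℕ) (c : ℕ → ℂ), ∀ x : ℝ, q.eval (x : ℂ) = ∑ i ∈ s, c i * hermiteN i x := by
  have hspan := hermiteSequence.span fun n =>
    (((Polynomial.hermite_monic n).map (Int.castRingHom ℂ)).leadingCoeff ▸ isUnit_one :
      IsUnit (hermiteSequence n).leadingCoeff)
  obtain ⟨c, rfl⟩ := Finsupp.mem_span_range_iff_exists_finsupp.1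
    (hspan ▸ Submodule.mem_top : q ∈ Submodule.span ℂ (Set.range hermiteSequence))
  refine ⟨c.support, fun i => c i * √(i.factorial : ℝ), fun x => ?_⟩
  rw [Finsupp.sum, Polynomial.eval_finsetSum]
  refine Finset.sum_congr rfl fun i _ => ?_
  rw [Polynomial.eval_smul, eval_hermiteSequence, smul_eq_mul, mul_assoc]

section Real

variable {h : (Fin N → ℝ) → ℝ}

theorem integral_prod_eval_mul_eq_zero (hh : MemLp h 2 (gammaFin N))
    (h0 : ∀ ν, hermiteCoeff h ν = 0) (q : Fin N → Polynomial ℂ) :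
    ∫ y, (∏ j, (q j).eval (y j : ℂ)) * (h y : ℂ) ∂gammaFin N = 0 := by
  choose s c hc using fun j => exists_eval_eq_sum_hermiteN (q j)
  have hexpand : ∀ y : Fin N → ℝ, (∏ j, (q j).eval (y j : ℂ)) * (h y : ℂ) =
      ∑ ν ∈ Fintype.piFinset s, (∏ j, c j (ν j)) * ((hermiteProd ν y • h y : ℝ) : ℂ) := fun y => by
    rw [Finset.prod_congr rfl fun j _ => hc j (y j), Finset.prod_univ_sum, Finset.sum_mul]
    refine Finset.sum_congr rfl fun ν _ => ?_
    rw [Finset.prod_mul_distrib, hermiteProd, smul_eq_mul, mul_assoc]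
    push_cast
    rfl
  simp only [hexpand]
  rw [integral_finsetSum _ fun ν _ =>
    (integrable_smul_of_memLp_two (memLp_hermiteProd ν) hh).ofReal.const_mul _]
  refine Finset.sum_eq_zero fun ν _ => ?_
  rw [integral_const_mul, integral_complex_ofReal]
  exact mul_eq_zero_of_right _ (by exact_mod_cast h0 ν)

theorem memLp_exp_abs (t : ℝ) : MemLp (fun x => Real.exp |t * x|) 2 gauss := by
  have hc : Continuous (fun x => Real.exp |t * x|) := by fun_prop
  rw [memLp_two_iff_integrable_sq hc.aestronglyMeasurable]
  refine (integrable_exp_mul_abs (integrable_exp_mul_gaussianReal (2 * |t|))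
    (integrable_exp_mul_gaussianReal (-(2 * |t|)))).congr (ae_of_all _ fun x => ?_)
  simp only [← Real.exp_nat_mul, abs_mul, Nat.cast_ofNat, mul_assoc]

/-- The partial sums of the power series of `exp (c X)`. -/
def expPartialSum (c : ℂ) (n : ℕ) : Polynomial ℂ :=
  ∑ k ∈ Finset.range n, Polynomial.C (c ^ k / k.factorial) * Polynomial.X ^ k

theorem eval_expPartialSum (c : ℂ) (n : ℕ) (x : ℂ) :
    (expPartialSum c n).eval x = ∑ k ∈ Finset.range n, (c * x) ^ k / k.factorial := by
  simp [expPartialSum, Polynomial.eval_finsetSum, mul_pow, mul_div_right_comm]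

theorem norm_eval_expPartialSum_le (t : ℝ) (n : ℕ) (x : ℝ) :
    ‖(expPartialSum (t * Complex.I) n).eval (x : ℂ)‖ ≤ Real.exp |t * x| := by
  rw [eval_expPartialSum]
  refine (norm_sum_le _ _).trans (le_of_eq_of_le ?_ (Real.sum_le_exp_of_nonneg (abs_nonneg _) n))
  simp [abs_mul]

theorem tendsto_eval_expPartialSum (c x : ℂ) :
    Tendsto (fun n => (expPartialSum c n).eval x) atTop (𝓝 (Complex.exp (c * x))) := by
  simp only [eval_expPartialSum, Complex.exp_eq_exp_ℂ]
  exact (NormedSpace.expSeries_div_hasSum_exp (𝔸 := ℂ) (c * x)).tendsto_sum_nat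

theorem integral_exp_mul_eq_zero (hh : MemLp h 2 (gammaFin N)) (h0 : ∀ ν, hermiteCoeff h ν = 0)
    (t : Fin N → ℝ) :
    ∫ y, Complex.exp ((∑ j, t j * y j : ℝ) * Complex.I) * (h y : ℂ) ∂gammaFin N = 0 := by
  have hprod : ∀ y : Fin N → ℝ, Complex.exp ((∑ j, t j * y j : ℝ) * Complex.I) =
      ∏ j, Complex.exp (t j * Complex.I * y j) := fun y => by
    rw [← Complex.exp_sum]
    push_cast
    rw [Finset.sum_mul]
    exact congrArg _ (Finset.sum_congr rfl fun j _ => mul_right_comm _ _ _)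
  have hlim : Tendsto (fun n => ∫ y, (∏ j, (expPartialSum (t j * Complex.I) n).eval (y j : ℂ)) *
      (h y : ℂ) ∂gammaFin N) atTop
      (𝓝 (∫ y, Complex.exp ((∑ j, t j * y j : ℝ) * Complex.I) * (h y : ℂ) ∂gammaFin N)) := by
    refine tendsto_integral_of_dominated_convergence
      (fun y => ‖(∏ j, Real.exp |t j * y j|) • h y‖) (fun n => ?_) ?_
      (fun n => ae_of_all _ fun y => ?_) (ae_of_all _ fun y => ?_)
    · exact (Continuous.aestronglyMeasurable (by fun_prop)).mul hh.ofReal.1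
    · exact (integrable_smul_of_memLp_two (memLp_two_prod fun j => memLp_exp_abs (t j)) hh).norm
    · rw [norm_mul, norm_prod, norm_smul, norm_prod, Complex.norm_real]
      gcongr with j
      simpa only [Real.norm_eq_abs, Real.abs_exp] using norm_eval_expPartialSum_le (t j) n (y j)
    · rw [hprod]
      exact (tendsto_finsetProd _ fun j _ => tendsto_eval_expPartialSum _ _).mul_const _
  refine tendsto_nhds_unique hlim ?_
  simp only [integral_prod_eval_mul_eq_zero hh h0, tendsto_const_nhds]

theorem charFunDual_withDensity_ofReal (hc : Continuous h) (L : StrongDual ℝ (Fin N → ℝ)) :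
    charFunDual ((gammaFin N).withDensity fun y => ENNReal.ofReal (h y)) L =
      ∫ y, ((max (h y) 0 : ℝ) : ℂ) * Complex.exp (L y * Complex.I) ∂gammaFin N := by
  rw [charFunDual_apply, integral_withDensity_eq_integral_toReal_smul (by fun_prop)
    (ae_of_all _ fun _ => ENNReal.ofReal_lt_top)]
  simp only [ENNReal.toReal_ofReal', ← Complex.coe_smul, smul_eq_mul]

theorem integrable_ofReal_mul_exp {g : (Fin N → ℝ) → ℝ} (hg : Integrable g (gammaFin N))
    (L : StrongDual ℝ (Fin N → ℝ)) :
    Integrable (fun y => (g y : ℂ) * Complex.exp (L y * Complex.I)) (gammaFin N) :=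
  hg.ofReal.mul_bdd (c := 1) (Continuous.aestronglyMeasurable (by fun_prop))
    (ae_of_all _ fun y => (Complex.norm_exp_ofReal_mul_I _).le)

/-- The positive and the negative part of `h` are densities of finite measures with the same
characteristic function. -/
theorem withDensity_ofReal_eq_withDensity_ofReal_neg (hc : Continuous h)
    (hi : Integrable h (gammaFin N)) (h0 : ∀ t : Fin N → ℝ,
      ∫ y, Complex.exp ((∑ j, t j * y j : ℝ) * Complex.I) * (h y : ℂ) ∂gammaFin N = 0) :
    (gammaFin N).withDensity (fun y => ENNReal.ofReal (h y)) =
      (gammaFin N).withDensity (fun y => ENNReal.ofReal (-h y)) := by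
  have := isFiniteMeasure_withDensity_ofReal hi.2
  have : IsFiniteMeasure ((gammaFin N).withDensity fun y => ENNReal.ofReal (-h y)) :=
    isFiniteMeasure_withDensity_ofReal hi.neg.2
  refine Measure.ext_of_charFunDual (funext fun L => ?_)
  have hL : ∀ y, L y = ∑ j, L (Pi.single j 1) * y j := fun y => by
    conv_lhs => rw [pi_eq_sum_univ' y]
    simp [mul_comm]
  rw [charFunDual_withDensity_ofReal hc,
    charFunDual_withDensity_ofReal (h := fun y => -h y) hc.neg, ← sub_eq_zero,
    ← integral_sub (integrable_ofReal_mul_exp hi.pos_part L)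
      (integrable_ofReal_mul_exp (g := fun y => max (-h y) 0) hi.neg.pos_part L),
    ← h0 fun j => L (Pi.single j 1)]
  refine integral_congr_ae (ae_of_all _ fun y => ?_)
  simp only [← hL]
  rw [← sub_mul, mul_comm, ← Complex.ofReal_sub, max_zero_sub_eq_self]

theorem eq_zero_of_integral_exp_eq_zero (hc : Continuous h) (hi : Integrable h (gammaFin N))
    (h0 : ∀ t : Fin N → ℝ,
      ∫ y, Complex.exp ((∑ j, t j * y j : ℝ) * Complex.I) * (h y : ℂ) ∂gammaFin N = 0) :
    h = 0 := by
  have hae := (withDensity_eq_iff (by fun_prop) (by fun_prop) hi.lintegral_lt_top.ne).1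
    (withDensity_ofReal_eq_withDensity_ofReal_neg hc hi h0)
  refine (Continuous.ae_eq_iff_eq (gammaFin N) hc continuous_const).1 ?_
  filter_upwards [hae] with y hy
  have hmax := congrArg ENNReal.toReal hy
  rw [ENNReal.toReal_ofReal', ENNReal.toReal_ofReal'] at hmax
  exact (max_zero_sub_eq_self (h y)).symm.trans (sub_eq_zero.2 hmax)

end Real

variable {X : Type*} [NormedAddCommGroup X]

theorem eq_zero_of_hermiteCoeff_eq_zero [NormedSpace ℝ X] [CompleteSpace X]
    {d : (Fin N → ℝ) → X} (hc : Continuous d) (hd : MemLp d 2 (gammaFin N))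
    (h0 : ∀ ν, hermiteCoeff d ν = 0) : d = 0 := by
  funext y
  refine SeparatingDual.eq_zero_of_forall_dual_eq_zero (R := ℝ) fun L => ?_
  have hLd : MemLp (fun y => L (d y)) 2 (gammaFin N) := hd.continuousLinearMap_comp L
  have hcoeff : ∀ ν, hermiteCoeff (fun y => L (d y)) ν = 0 := fun ν => by
    have hcomm := L.integral_comp_comm (integrable_smul_of_memLp_two (memLp_hermiteProd ν) hd)
    simp only [map_smul] at hcomm
    rw [hermiteCoeff, hcomm, ← hermiteCoeff, h0, map_zero]
  exact congrFun (eq_zero_of_integral_exp_eq_zero (L.continuous.comp hc)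
    (hLd.integrable (by simp)) (integral_exp_mul_eq_zero hLd hcoeff)) y

/-! ### Hermite series -/

theorem eLpNorm_le_tsum_of_hasSum {Ω ι : Type*} [MeasurableSpace Ω] {μ : Measure Ω}
    [Countable ι] {p : ℝ≥0∞} (hp : 1 ≤ p) {F : ι → Ω → X} {f : Ω → X}
    (hF : ∀ i, AEStronglyMeasurable (F i) μ) (h : ∀ x, HasSum (fun i => F i x) (f x)) :
    eLpNorm f p μ ≤ ∑' i, eLpNorm (F i) p μ := by
  obtain ⟨s, hs⟩ := exists_seq_tendsto (atTop : Filter (Finset ι))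
  have hfatou : eLpNorm f p μ ≤ liminf (fun n => eLpNorm (∑ i ∈ s n, F i) p μ) atTop :=
    Lp.eLpNorm_lim_le_liminf_eLpNorm (fun n => Finset.aestronglyMeasurable_sum _ fun i _ => hF i) f
      (ae_of_all _ fun x => by simpa only [Finset.sum_apply] using! (h x).comp hs)
  refine hfatou.trans (liminf_le_of_le (by isBoundedDefault) fun b hb => ?_)
  obtain ⟨n, hn⟩ := hb.exists
  exact (hn.trans (eLpNorm_sum_le (fun i _ => hF i) hp)).trans (ENNReal.sum_le_tsum _)

theorem eLpNorm_fun_smul_const {Ω 𝕜 : Type*} [MeasurableSpace Ω] [NormedField 𝕜]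
    [NormedSpace 𝕜 X] (μ : Measure Ω) (p : ℝ≥0∞) (f : Ω → 𝕜) (x : X) :
    eLpNorm (fun y => f y • x) p μ = ‖x‖ₑ * eLpNorm f p μ := by
  rw [← eLpNorm_norm f, ← enorm_norm x, ← eLpNorm_const_smul]
  exact eLpNorm_congr_norm_ae (ae_of_all _ fun y => by simp [norm_smul, mul_comm])

section Series

variable [NormedSpace ℝ X]

theorem eLpNorm_hermiteProd_smul (ν : Fin N → ℕ) (x : X) :
    eLpNorm (fun y => hermiteProd ν y • x) 2 (gammaFin N) = ENNReal.ofReal ‖x‖ := by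
  have hone : eLpNorm (hermiteProd ν) 2 (gammaFin N) = 1 := by
    rw [eLpNorm_two_eq_ofReal_sqrt_integral (memLp_hermiteProd ν)]
    simp [sq, integral_hermiteProd_mul]
  rw [eLpNorm_fun_smul_const, hone, mul_one, ofReal_norm]

theorem exists_eventually_abs_hermiteN_le (x : ℝ) :
    ∃ B : ℝ, ∀ᶠ z in 𝓝 x, ∀ k, |hermiteN k z| ≤ B := by
  obtain ⟨m, hm⟩ := exists_nat_gt (x ^ 2)
  have hcont : Continuous (christoffelInv (m + 1)) :=
    continuous_finsetSum _ fun l _ => (continuous_hermiteN l).pow 2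
  refine ⟨√(christoffelInv (m + 1) x + 1), ?_⟩
  filter_upwards [(hcont.tendsto x).eventually_lt_const (lt_add_one _),
    ((continuous_pow 2).tendsto x).eventually_lt_const hm] with z hz hzm k
  have hz4 : z ^ 2 ≤ 4 * m := by linarith [sq_nonneg z]
  exact Real.abs_le_sqrt ((hermiteN_sq_le_christoffelInv hz4 k).trans hz.le)

theorem exists_eventually_abs_hermiteProd_le (y : Fin N → ℝ) :
    ∃ B : ℝ, ∀ᶠ z in 𝓝 y, ∀ ν, |hermiteProd ν z| ≤ B := by
  choose B hB using fun j => exists_eventually_abs_hermiteN_le (y j)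
  refine ⟨∏ j, B j, ?_⟩
  have hall : ∀ᶠ z in 𝓝 y, ∀ j k, |hermiteN k (z j)| ≤ B j :=
    eventually_all.2 fun j => ((continuous_apply j).tendsto y).eventually (hB j)
  filter_upwards [hall] with z hz ν
  rw [hermiteProd, Finset.abs_prod]
  exact Finset.prod_le_prod (fun j _ => abs_nonneg _) fun j _ => hz j (ν j)

variable {x : (Fin N → ℕ) → X}

theorem exists_eventually_norm_hermiteProd_smul_le (x : (Fin N → ℕ) → X) (y : Fin N → ℝ) :
    ∃ B : ℝ, ∀ᶠ z in 𝓝 y, ∀ ν, ‖hermiteProd ν z • x ν‖ ≤ B * ‖x ν‖ := by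
  obtain ⟨B, hB⟩ := exists_eventually_abs_hermiteProd_le y
  refine ⟨B, hB.mono fun z hz ν => ?_⟩
  rw [norm_smul]
  exact mul_le_mul_of_nonneg_right (hz ν) (norm_nonneg _)

theorem integral_abs_hermiteProd_mul_le (ν μ : Fin N → ℕ) :
    ∫ y, |hermiteProd ν y * hermiteProd μ y| ∂gammaFin N ≤ 1 := by
  have hsq := fun κ : Fin N → ℕ => (memLp_hermiteProd κ).integrable_sq
  have hmean : ∫ y, (hermiteProd ν y ^ 2 + hermiteProd μ y ^ 2) / 2 ∂gammaFin N = 1 := by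
    rw [integral_div, integral_add (hsq ν) (hsq μ)]
    simp [sq, integral_hermiteProd_mul]
  rw [← hmean]
  refine integral_mono ((memLp_hermiteProd ν).integrable_mul (memLp_hermiteProd μ)).abs
    (((hsq ν).add (hsq μ)).div_const 2) fun y => ?_
  rw [abs_mul, le_div_iff₀ two_pos, ← sq_abs (hermiteProd ν y), ← sq_abs (hermiteProd μ y)]
  linarith [two_mul_le_add_sq |hermiteProd ν y| |hermiteProd μ y|]

variable [CompleteSpace X]

theorem summable_hermiteProd_smul (hx : Summable fun ν => ‖x ν‖) (y : Fin N → ℝ) :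
    Summable fun ν => hermiteProd ν y • x ν := by
  obtain ⟨B, hB⟩ := exists_eventually_norm_hermiteProd_smul_le x y
  exact .of_norm_bounded (hx.mul_left B) hB.self_of_nhds

theorem continuous_tsum_hermiteProd_smul (hx : Summable fun ν => ‖x ν‖) :
    Continuous fun y : Fin N → ℝ => ∑' ν, hermiteProd ν y • x ν := by
  refine continuous_iff_continuousAt.2 fun y => ?_
  obtain ⟨B, hB⟩ := exists_eventually_norm_hermiteProd_smul_le x y
  exact (continuousOn_tsum (s := {z | ∀ ν, ‖hermiteProd ν z • x ν‖ ≤ B * ‖x ν‖})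
    (fun ν => ((continuous_hermiteProd ν).smul continuous_const).continuousOn) (hx.mul_left B)
    fun ν z hz => hz ν).continuousAt hB

theorem memLp_tsum_hermiteProd_smul (hx : Summable fun ν => ‖x ν‖) :
    MemLp (fun y => ∑' ν, hermiteProd ν y • x ν) 2 (gammaFin N) := by
  refine ⟨(continuous_tsum_hermiteProd_smul hx).aestronglyMeasurable, ?_⟩
  have hle := eLpNorm_le_tsum_of_hasSum (μ := gammaFin N) (F := fun ν y => hermiteProd ν y • x ν)
    one_le_two (fun ν => ((continuous_hermiteProd ν).smul continuous_const).aestronglyMeasurable)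
    fun y => (summable_hermiteProd_smul hx y).hasSum
  rw [tsum_congr fun ν => eLpNorm_hermiteProd_smul ν (x ν)] at hle
  exact hle.trans_lt hx.tsum_ofReal_lt_top

theorem hermiteCoeff_tsum_hermiteProd_smul (hx : Summable fun ν => ‖x ν‖) (μ : Fin N → ℕ) :
    hermiteCoeff (fun y => ∑' ν, hermiteProd ν y • x ν) μ = x μ := by
  have hinteg : ∀ ν, Integrable (fun y => (hermiteProd μ y * hermiteProd ν y) • x ν) (gammaFin N) :=
    fun ν => ((memLp_hermiteProd μ).integrable_mul (memLp_hermiteProd ν)).smul_const _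
  have hnorm : ∀ ν, ∫ y, ‖(hermiteProd μ y * hermiteProd ν y) • x ν‖ ∂gammaFin N ≤ ‖x ν‖ :=
    fun ν => by
      simp only [norm_smul, integral_mul_const]
      exact mul_le_of_le_one_left (norm_nonneg _) (integral_abs_hermiteProd_mul_le μ ν)
  have hsum := hasSum_integral_of_summable_integral_norm hinteg
    (hx.of_nonneg_of_le (fun ν => integral_nonneg fun _ => norm_nonneg _) hnorm)
  have horth : ∀ ν, ∫ y, (hermiteProd μ y * hermiteProd ν y) • x ν ∂gammaFin N =
      if ν = μ then x μ else 0 := fun ν => by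
    rw [integral_smul_const, integral_hermiteProd_mul]
    rcases eq_or_ne ν μ with rfl | hne <;> simp [*, Ne.symm]
  simp only [horth] at hsum
  rw [← hsum.unique (hasSum_ite_eq μ (x μ)), hermiteCoeff]
  simp only [mul_smul, (summable_hermiteProd_smul hx _).tsum_const_smul]

theorem hasSum_hermiteProd_smul {f : (Fin N → ℝ) → X} (hc : Continuous f)
    (hf : MemLp f 2 (gammaFin N)) (hs : Summable fun ν => ‖hermiteCoeff f ν‖) (y : Fin N → ℝ) :
    HasSum (fun ν => hermiteProd ν y • hermiteCoeff f ν) (f y) := by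
  have hcg := continuous_tsum_hermiteProd_smul hs
  have hg := memLp_tsum_hermiteProd_smul hs
  have hdiff : f - (fun y => ∑' ν, hermiteProd ν y • hermiteCoeff f ν) = 0 := by
    refine eq_zero_of_hermiteCoeff_eq_zero (hc.sub hcg) (hf.sub hg) fun ν => ?_
    have hsub := integral_sub (integrable_smul_of_memLp_two (memLp_hermiteProd ν) hf)
      (integrable_smul_of_memLp_two (memLp_hermiteProd ν) hg)
    simp only [← smul_sub] at hsub
    exact hsub.trans (sub_eq_zero.2 (hermiteCoeff_tsum_hermiteProd_smul hs ν).symm)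
  rw [congrFun (sub_eq_zero.1 hdiff) y]
  exact (summable_hermiteProd_smul hs y).hasSum

end Series

end Completeness

/-! ### Smolyak interpolation of product functions -/

theorem Icc_zero_eq_finsupp {ι : Type*} [DecidableEq ι] {μ : ι →₀ ℕ} {T : Finset ι}
    (hT : μ.support ⊆ T) :
    Finset.Icc 0 μ = T.finsupp fun j => Finset.range (μ j + 1) := by
  ext κ
  simp only [Finset.mem_Icc, zero_le, true_and, Finset.mem_finsupp_iff, Finset.mem_range,
    Nat.lt_succ_iff]
  refine ⟨fun h => ⟨(Finsupp.support_mono h).trans hT, fun j _ => h j⟩, fun h j => ?_⟩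
  by_cases hj : j ∈ T
  · exact h.2 j hj
  · simp [Finsupp.notMem_support_iff.1 fun hκ => hj (h.1 hκ)]

theorem sum_Icc_zero_prod {ι R : Type*} [DecidableEq ι] [CommSemiring R] {μ : ι →₀ ℕ}
    {T : Finset ι} (hT : μ.support ⊆ T) (g : ι → ℕ → R) :
    ∑ κ ∈ Finset.Icc 0 μ, ∏ j ∈ T, g j (κ j) =
      ∏ j ∈ T, ∑ k ∈ Finset.range (μ j + 1), g j k := by
  rw [Icc_zero_eq_finsupp hT, Finset.finsupp, Finset.sum_map, Finset.prod_sum]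
  refine Finset.sum_congr (by congr!) fun κ _ => ?_
  rw [← Finset.prod_attach]
  exact Finset.prod_congr rfl fun j _ => by simp

@[simp] theorem lagrangeBasis_zero_zero (y : ℝ) : lagrangeBasis 0 0 y = 1 := by
  simp [lagrangeBasis]

theorem sub_sum_single_apply {ι : Type*} [DecidableEq ι] (μ : ι →₀ ℕ) (s : Finset ι) (j : ι) :
    (μ - ∑ i ∈ s, Finsupp.single i 1 : ι →₀ ℕ) j = if j ∈ s then μ j - 1 else μ j := by
  rw [Finsupp.tsub_apply, Finsupp.finsetSum_apply]
  simp only [Finsupp.single_apply, Finset.sum_ite_eq']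
  split_ifs <;> simp

section Product

variable {μ : ℕ →₀ ℕ} {T : Finset ℕ}

/-- The subsets of `μ.support` suffice because `I_{-1} = 0`. -/
theorem prod_interpDiff_eq_sum_powerset (hμ : μ.support ⊆ T) (g : ℕ → ℝ → ℝ) (y : ℕ → ℝ) :
    ∏ j ∈ T, interpDiff (μ j) (g j) (y j) = ∑ s ∈ μ.support.powerset, (-1) ^ s.card *
      ∏ j ∈ T, interp ((μ - ∑ i ∈ s, Finsupp.single i 1 : ℕ →₀ ℕ) j) (g j) (y j) := by
  simp only [interpDiff]
  rw [Finset.prod_sub, ← Finset.sum_subset (Finset.powerset_mono.2 hμ)]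
  · refine Finset.sum_congr rfl fun s hs => ?_
    have hsμ := Finset.mem_powerset.1 hs
    rw [mul_assoc, ← Finset.prod_sdiff (hsμ.trans hμ)]
    refine congrArg₂ _ rfl (congrArg₂ _ (Finset.prod_congr rfl fun j hj => ?_)
      (Finset.prod_congr rfl fun j hj => ?_))
    · rw [sub_sum_single_apply, if_neg (Finset.mem_sdiff.1 hj).2]
    · rw [sub_sum_single_apply, if_pos hj, if_neg (Finsupp.mem_support_iff.1 (hsμ hj))]
  · intro s _ hs
    obtain ⟨j, hjs, hjμ⟩ := Finset.not_subset.1 (mt Finset.mem_powerset.2 hs)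
    exact mul_eq_zero_of_right _
      (Finset.prod_eq_zero hjs (if_pos (Finsupp.notMem_support_iff.1 hjμ)))

variable {X : Type*} [NormedAddCommGroup X] [InnerProductSpace ℂ X]

theorem tensorInterp_prod_smul (hμ : μ.support ⊆ T) (g : ℕ → ℝ → ℝ) (x : X) (y : ℕ → ℝ) :
    tensorInterp μ (fun y => (∏ j ∈ T, g j (y j)) • x) y =
      (∏ j ∈ T, interp (μ j) (g j) (y j)) • x := by
  simp only [interp]
  rw [← sum_Icc_zero_prod hμ fun j k => lagrangeBasis (μ j) k (y j) * g j (gaussHermite (μ j) k),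
    Finset.sum_smul, tensorInterp]
  refine Finset.sum_congr rfl fun κ hκ => ?_
  have hbasis : ∏ j ∈ μ.support, lagrangeBasis (μ j) (κ j) (y j) =
      ∏ j ∈ T, lagrangeBasis (μ j) (κ j) (y j) := by
    refine Finset.prod_subset hμ fun j _ hj => ?_
    have hμj := Finsupp.notMem_support_iff.1 hj
    have hκj : κ j = 0 := Nat.eq_zero_of_le_zero (hμj ▸ (Finset.mem_Icc.1 hκ).2 j)
    rw [hκj, hμj, lagrangeBasis_zero_zero]
  rw [hbasis, Complex.coe_smul, smul_smul, Finset.prod_mul_distrib]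
  rfl

theorem tensorDiff_prod_smul (hμ : μ.support ⊆ T) (g : ℕ → ℝ → ℝ) (x : X) (y : ℕ → ℝ) :
    tensorDiff μ (fun y => (∏ j ∈ T, g j (y j)) • x) y =
      (∏ j ∈ T, interpDiff (μ j) (g j) (y j)) • x := by
  rw [prod_interpDiff_eq_sum_powerset hμ, Finset.sum_smul, tensorDiff]
  refine Finset.sum_congr rfl fun s _ => ?_
  rw [tensorInterp_prod_smul ((Finsupp.support_mono tsub_le_self).trans hμ), mul_smul,
    ← Complex.coe_smul ((-1) ^ s.card)]
  push_cast
  rfl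

end Product

/-! ### Smolyak interpolation of Hermite polynomials -/

/-- The tensorized normalized Hermite polynomial on `ℝ^∞`. The factors outside the support of `ν`
equal `1`, so that the product is finite. -/
def hermiteSeq (ν : ℕ →₀ ℕ) (y : ℕ → ℝ) : ℝ := ∏ j ∈ ν.support, hermiteN (ν j) (y j)

theorem hermiteSeq_eq_prod {ν : ℕ →₀ ℕ} {T : Finset ℕ} (hT : ν.support ⊆ T) (y : ℕ → ℝ) :
    hermiteSeq ν y = ∏ j ∈ T, hermiteN (ν j) (y j) := by
  refine Finset.prod_subset hT fun j _ hj => ?_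
  rw [Finsupp.notMem_support_iff.1 hj, hermiteN_zero]

section Smolyak

variable {X : Type*} [NormedAddCommGroup X] [InnerProductSpace ℂ X] {Λ : Finset (ℕ →₀ ℕ)}

theorem tensorDiff_hermiteSeq_of_le {μ ν : ℕ →₀ ℕ} (h : μ ≤ ν) (x : X) (y : ℕ → ℝ) :
    tensorDiff μ (fun y => hermiteSeq ν y • x) y =
      (∏ j ∈ ν.support, interpDiff (μ j) (hermiteN (ν j)) (y j)) • x :=
  tensorDiff_prod_smul (Finsupp.support_mono h) (fun j => hermiteN (ν j)) x y

theorem tensorDiff_hermiteSeq_of_not_le {μ ν : ℕ →₀ ℕ} (h : ¬ μ ≤ ν) (x : X) (y : ℕ → ℝ) :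
    tensorDiff μ (fun y => hermiteSeq ν y • x) y = 0 := by
  obtain ⟨j, hj⟩ : ∃ j, ν j < μ j := by simpa [Finsupp.le_def] using h
  simp only [hermiteSeq_eq_prod (Finset.subset_union_right (s₁ := μ.support))]
  rw [tensorDiff_prod_smul Finset.subset_union_left fun j => hermiteN (ν j),
    Finset.prod_eq_zero (i := j) _ (interpDiff_hermiteN_of_lt hj _), zero_smul]
  exact Finset.mem_union_left _ (Finsupp.mem_support_iff.2 (by omega))

open Classical in
theorem smolyak_hermiteSeq (Λ : Finset (ℕ →₀ ℕ)) (ν : ℕ →₀ ℕ) (x : X) (y : ℕ → ℝ) :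
    smolyak Λ (fun y => hermiteSeq ν y • x) y =
      (∑ μ ∈ Λ with μ ≤ ν, ∏ j ∈ ν.support, interpDiff (μ j) (hermiteN (ν j)) (y j)) • x := by
  rw [smolyak, Finset.sum_smul, Finset.sum_filter]
  refine Finset.sum_congr rfl fun μ _ => ?_
  split_ifs with h
  · exact tensorDiff_hermiteSeq_of_le h x y
  · exact tensorDiff_hermiteSeq_of_not_le h x y

theorem smolyak_hermiteSeq_of_mem (hΛ : IsLowerSet (Λ : Set (ℕ →₀ ℕ))) {ν : ℕ →₀ ℕ} (hν : ν ∈ Λ)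
    (x : X) (y : ℕ → ℝ) : smolyak Λ (fun y => hermiteSeq ν y • x) y = hermiteSeq ν y • x := by
  classical
  have hfilter : {μ ∈ Λ | μ ≤ ν} = Finset.Icc 0 ν := by
    ext μ
    simp only [Finset.mem_filter, Finset.mem_Icc, zero_le, true_and]
    exact ⟨fun h => h.2, fun h => ⟨hΛ h hν, h⟩⟩
  rw [smolyak_hermiteSeq, hfilter,
    sum_Icc_zero_prod subset_rfl fun j k => interpDiff k (hermiteN (ν j)) (y j)]
  simp only [sum_interpDiff, interp_hermiteN_of_le le_rfl, hermiteSeq]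

theorem hasSum_tensorInterp {ι : Type*} {g : ι → (ℕ → ℝ) → X} {f : (ℕ → ℝ) → X}
    (h : ∀ y, HasSum (fun i => g i y) (f y)) (μ : ℕ →₀ ℕ) (y : ℕ → ℝ) :
    HasSum (fun i => tensorInterp μ (g i) y) (tensorInterp μ f y) :=
  hasSum_sum fun _ _ => (h _).const_smul _

theorem hasSum_smolyak {ι : Type*} {g : ι → (ℕ → ℝ) → X} {f : (ℕ → ℝ) → X}
    (h : ∀ y, HasSum (fun i => g i y) (f y)) (Λ : Finset (ℕ →₀ ℕ)) (y : ℕ → ℝ) :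
    HasSum (fun i => smolyak Λ (g i) y) (smolyak Λ f y) :=
  hasSum_sum fun _ _ => hasSum_sum fun _ _ => (hasSum_tensorInterp h _ y).const_smul _

theorem gridPoint_apply_eq_zero {μ κ : ℕ →₀ ℕ} (hκ : κ ≤ μ) {j : ℕ} (hj : μ j = 0) :
    gridPoint μ κ j = 0 := by
  have hκj : κ j = 0 := Nat.eq_zero_of_le_zero (hj ▸ hκ j)
  rw [gridPoint, hκj, hj, gaussHermite_zero_zero]

theorem smolyak_congr {N : ℕ} (hN : ∀ ν ∈ Λ, ν.support ⊆ Finset.range N) {f g : (ℕ → ℝ) → X}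
    (hfg : ∀ y : ℕ → ℝ, (∀ j, N ≤ j → y j = 0) → f y = g y) : smolyak Λ f = smolyak Λ g := by
  funext y
  unfold smolyak tensorDiff tensorInterp
  refine Finset.sum_congr rfl fun ν hν => Finset.sum_congr rfl fun s _ =>
    congrArg _ (Finset.sum_congr rfl fun κ hκ => ?_)
  rw [hfg]
  intro j hj
  have hνj : ν j = 0 := Finsupp.notMem_support_iff.1 fun h =>
    hj.not_gt (Finset.mem_range.1 (hN ν hν h))
  exact gridPoint_apply_eq_zero (Finset.mem_Icc.1 hκ).2
    (by rw [Finsupp.tsub_apply, hνj, zero_tsub])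

theorem continuous_smolyak (Λ : Finset (ℕ →₀ ℕ)) (f : (ℕ → ℝ) → X) : Continuous (smolyak Λ f) := by
  unfold smolyak tensorDiff tensorInterp
  refine continuous_finsetSum _ fun ν _ => continuous_finsetSum _ fun s _ =>
    (continuous_finsetSum _ fun κ _ => ?_).const_smul _
  exact (Complex.continuous_ofReal.comp (continuous_finsetProd _ fun j _ =>
    (continuous_lagrangeBasis _ _).comp (continuous_apply j))).smul continuous_const

end Smolyak

/-! ### Stability of Smolyak interpolation -/

theorem eLpNorm_prod_gammaInf (s : Finset ℕ) {g : ℕ → ℝ → ℝ} (hg : ∀ j, Measurable (g j))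
    {p : ℝ≥0∞} (hp : p ≠ 0) (hp' : p ≠ ∞) :
    eLpNorm (fun y : ℕ → ℝ => ∏ j ∈ s, g j (y j)) p gammaInf = ∏ j ∈ s, eLpNorm (g j) p gauss := by
  have hm : ∀ j, Measurable fun x => ‖g j x‖ₑ ^ p.toReal := fun j => (hg j).enorm.pow_const _
  have hind : iIndepFun (fun (j : ℕ) (y : ℕ → ℝ) => ‖g j (y j)‖ₑ ^ p.toReal) gammaInf :=
    iIndepFun_infinitePi (P := fun _ : ℕ => gaussianReal 0 1) hm
  have hlintegral : ∀ j, ∫⁻ y, ‖g j (y j)‖ₑ ^ p.toReal ∂gammaInf =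
      ∫⁻ x, ‖g j x‖ₑ ^ p.toReal ∂gauss := fun j =>
    (measurePreserving_eval_infinitePi (fun _ : ℕ => gaussianReal 0 1) j).lintegral_comp (hm j)
  simp only [eLpNorm_eq_lintegral_rpow_enorm_toReal hp hp']
  rw [ENNReal.prod_rpow_of_nonneg (by positivity)]
  simp only [← hlintegral]
  rw [← lintegral_prod_eq_prod_lintegral_of_indepFun s _ hind fun j =>
    (hm j).comp (measurable_pi_apply j)]
  refine congrArg (· ^ _) (lintegral_congr fun y => ?_)
  rw [ENNReal.prod_rpow_of_nonneg ENNReal.toReal_nonneg, ← ofReal_norm, norm_prod,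
    ENNReal.ofReal_prod_of_nonneg fun j _ => norm_nonneg _]
  simp only [ofReal_norm]

theorem continuous_hermiteSeq (ν : ℕ →₀ ℕ) : Continuous (hermiteSeq ν) :=
  continuous_finsetProd _ fun j _ => (continuous_hermiteN _).comp (continuous_apply j)

theorem eLpNorm_hermiteSeq (ν : ℕ →₀ ℕ) : eLpNorm (hermiteSeq ν) 2 gammaInf = 1 := by
  refine (eLpNorm_prod_gammaInf ν.support (fun j => (continuous_hermiteN (ν j)).measurable)
    (by simp) (by simp)).trans ?_
  simp only [eLpNorm_hermiteN, Finset.prod_const_one]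

/-- A polynomially growing bound for the norm of Smolyak interpolation at `hermiteSeq ν`, uniform
in the index set of the interpolation operator. -/
def stabilityBound (ν : ℕ →₀ ℕ) : ℕ := ∏ j ∈ ν.support, 8 * ν j ^ 2

theorem one_le_stabilityBound (ν : ℕ →₀ ℕ) : 1 ≤ stabilityBound ν :=
  Nat.one_le_iff_ne_zero.2 (Finset.prod_ne_zero_iff.2 fun j hj => by
    have := Finsupp.mem_support_iff.1 hj
    positivity)

theorem sum_Icc_prod_le_stabilityBound (ν : ℕ →₀ ℕ) :
    ∑ μ ∈ Finset.Icc 0 ν, ∏ j ∈ ν.support, 2 * (μ j + 1) ≤ stabilityBound ν := by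
  rw [sum_Icc_zero_prod subset_rfl fun _ k => 2 * (k + 1)]
  refine Finset.prod_le_prod' fun j hj => ?_
  have hν : 1 ≤ ν j := Nat.one_le_iff_ne_zero.2 (Finsupp.mem_support_iff.1 hj)
  calc ∑ k ∈ Finset.range (ν j + 1), 2 * (k + 1)
      ≤ ∑ _k ∈ Finset.range (ν j + 1), 2 * (ν j + 1) := by
        refine Finset.sum_le_sum fun k hk => ?_
        have := Finset.mem_range.1 hk
        omega
    _ = 2 * (ν j + 1) ^ 2 := by
        rw [Finset.sum_const, Finset.card_range, smul_eq_mul]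
        ring
    _ ≤ 8 * ν j ^ 2 := by nlinarith

theorem continuous_prod_interpDiff_hermiteN (μ ν : ℕ →₀ ℕ) :
    Continuous fun y : ℕ → ℝ => ∏ j ∈ ν.support, interpDiff (μ j) (hermiteN (ν j)) (y j) :=
  continuous_finsetProd _ fun j _ => (continuous_interpDiff _ _).comp (continuous_apply j)

open Classical in
theorem eLpNorm_sum_prod_interpDiff_le (Λ : Finset (ℕ →₀ ℕ)) (ν : ℕ →₀ ℕ) :
    eLpNorm (∑ μ ∈ Λ with μ ≤ ν, fun y : ℕ → ℝ =>
      ∏ j ∈ ν.support, interpDiff (μ j) (hermiteN (ν j)) (y j)) 2 gammaInf ≤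
        stabilityBound ν := by
  have hterm : ∀ μ : ℕ →₀ ℕ, eLpNorm (fun y : ℕ → ℝ =>
      ∏ j ∈ ν.support, interpDiff (μ j) (hermiteN (ν j)) (y j)) 2 gammaInf ≤
        (∏ j ∈ ν.support, 2 * (μ j + 1) : ℕ) := fun μ => by
    rw [eLpNorm_prod_gammaInf _ (g := fun j => interpDiff (μ j) (hermiteN (ν j)))
      (fun j => (continuous_interpDiff _ _).measurable) (by simp) (by simp), Nat.cast_prod]
    exact Finset.prod_le_prod' fun j _ => eLpNorm_interpDiff_hermiteN_le _ _
  refine (eLpNorm_sum_le (fun μ _ =>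
    (continuous_prod_interpDiff_hermiteN μ ν).aestronglyMeasurable) one_le_two).trans
      ((Finset.sum_le_sum fun μ _ => hterm μ).trans ?_)
  rw [← Nat.cast_sum, Nat.cast_le]
  refine (Finset.sum_le_sum_of_subset fun μ hμ => ?_).trans (sum_Icc_prod_le_stabilityBound ν)
  exact Finset.mem_Icc.2 ⟨zero_le, (Finset.mem_filter.1 hμ).2⟩

theorem eLpNorm_hermiteSeq_sub_smolyak_le {X : Type*} [NormedAddCommGroup X]
    [InnerProductSpace ℂ X] (Λ : Finset (ℕ →₀ ℕ)) (ν : ℕ →₀ ℕ) (x : X) :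
    eLpNorm (fun y => hermiteSeq ν y • x - smolyak Λ (fun y => hermiteSeq ν y • x) y) 2 gammaInf ≤
      ENNReal.ofReal (‖x‖ * (2 * stabilityBound ν)) := by
  classical
  have hfactor : (fun y => hermiteSeq ν y • x - smolyak Λ (fun y => hermiteSeq ν y • x) y) =
      fun y => (hermiteSeq ν - ∑ μ ∈ Λ with μ ≤ ν, fun y : ℕ → ℝ =>
        ∏ j ∈ ν.support, interpDiff (μ j) (hermiteN (ν j)) (y j)) y • x := by
    funext y
    rw [smolyak_hermiteSeq, Pi.sub_apply, sub_smul, Finset.sum_apply]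
  have htwo : ENNReal.ofReal (2 * stabilityBound ν) = stabilityBound ν + stabilityBound ν := by
    rw [two_mul, ENNReal.ofReal_add (Nat.cast_nonneg _) (Nat.cast_nonneg _),
      ENNReal.ofReal_natCast]
  rw [hfactor, eLpNorm_fun_smul_const, ENNReal.ofReal_mul (norm_nonneg _), ofReal_norm, htwo]
  gcongr
  refine (eLpNorm_sub_le (continuous_hermiteSeq ν).aestronglyMeasurable
    (Finset.aestronglyMeasurable_sum _ fun μ _ =>
      (continuous_prod_interpDiff_hermiteN μ ν).aestronglyMeasurable) one_le_two).trans ?_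
  refine add_le_add ?_ (eLpNorm_sum_prod_interpDiff_le Λ ν)
  rw [eLpNorm_hermiteSeq]
  exact_mod_cast one_le_stabilityBound ν

/-! ### Multiindices in finitely many variables -/

/-- The multiindex on `ℕ` that extends a multiindex in `N` variables by zero. -/
def extendIndex {N : ℕ} (ν : Fin N → ℕ) : ℕ →₀ ℕ :=
  (Finsupp.equivFunOnFinite.symm ν).embDomain Fin.valEmbedding

theorem extendIndex_injective (N : ℕ) : Function.Injective (extendIndex (N := N)) :=
  (Finsupp.embDomain_injective _).comp Finsupp.equivFunOnFinite.symm.injective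

theorem prod_support_extendIndex {N : ℕ} {M : Type*} [CommMonoid M] (ν : Fin N → ℕ)
    (g : ℕ → ℕ → M) (hg : ∀ j, g j 0 = 1) :
    ∏ j ∈ (extendIndex ν).support, g j (extendIndex ν j) = ∏ i : Fin N, g i (ν i) := by
  change (extendIndex ν).prod g = _
  rw [extendIndex, Finsupp.prod_embDomain, Finsupp.prod_fintype _ _ fun i => hg _]
  rfl

theorem hermiteSeq_extendIndex {N : ℕ} (ν : Fin N → ℕ) (y : ℕ → ℝ) :
    hermiteSeq (extendIndex ν) y = hermiteProd ν (fun i => y i) :=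
  prod_support_extendIndex ν (fun j n => hermiteN n (y j)) fun _ => hermiteN_zero _

theorem sum_extendIndex_le_tsum {N : ℕ} {G : (ℕ →₀ ℕ) → ℝ} (hG0 : ∀ ν, 0 ≤ G ν) (hG : Summable G)
    (T : Finset (Fin N → ℕ)) : ∑ ν ∈ T, G (extendIndex ν) ≤ ∑' ν, G ν := by
  classical
  rw [← Finset.sum_image (f := G) (extendIndex_injective N).injOn]
  exact hG.sum_le_tsum _ fun ν _ => hG0 ν

/-! ### Summability over multiindices -/

theorem sum_ite_eq_zero_le_exp {a : ℝ} {c : ℕ → ℝ} (ha : 0 ≤ a) (hc : ∀ n, 0 ≤ c n)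
    (hcs : Summable c) (n : ℕ) :
    ∑ k ∈ Finset.range (n + 1), (if k = 0 then 1 else a * c k) ≤ Real.exp (a * ∑' k, c k) := by
  have htail : ∑ k ∈ Finset.range n, c (k + 1) ≤ ∑' k, c k :=
    calc ∑ k ∈ Finset.range n, c (k + 1) ≤ ∑ k ∈ Finset.range (n + 1), c k := by
          rw [Finset.sum_range_succ']
          exact le_add_of_nonneg_right (hc 0)
      _ ≤ ∑' k, c k := hcs.sum_le_tsum _ fun k _ => hc k
  simp only [Finset.sum_range_succ', Nat.add_eq_zero_iff, one_ne_zero, and_false, if_false, if_true]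
  rw [← Finset.mul_sum]
  exact (add_le_add_left (mul_le_mul_of_nonneg_left htail ha) 1).trans (Real.add_one_le_exp _)

section

variable {ι : Type*}

theorem prod_support_eq_prod_ite {μ ν : ι →₀ ℕ} (hν : ν ≤ μ) (g : ι → ℕ → ℝ) :
    ∏ j ∈ ν.support, g j (ν j) = ∏ j ∈ μ.support, if ν j = 0 then 1 else g j (ν j) := by
  refine (Finset.prod_congr rfl fun j hj => ?_).trans
    (Finset.prod_subset (Finsupp.support_mono hν) fun j _ hj => ?_)
  · rw [if_neg (Finsupp.mem_support_iff.1 hj)]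
  · rw [if_pos (Finsupp.notMem_support_iff.1 hj)]

theorem summable_prod_support {A : ι → ℝ} {c : ℕ → ℝ} (hA : ∀ j, 0 ≤ A j) (hc : ∀ n, 0 ≤ c n)
    (hAs : Summable A) (hcs : Summable c) :
    Summable fun ν : ι →₀ ℕ => ∏ j ∈ ν.support, A j * c (ν j) := by
  classical
  refine summable_of_sum_le (c := Real.exp ((∑' j, A j) * ∑' n, c n))
    (fun ν => Finset.prod_nonneg fun j _ => mul_nonneg (hA j) (hc _)) fun u => ?_
  have hnonneg : ∀ (j : ι) (k : ℕ), 0 ≤ if k = 0 then 1 else A j * c k := fun j k => by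
    have := mul_nonneg (hA j) (hc k)
    positivity
  have hle : ∀ ν ∈ u, ν ≤ u.sup id := fun ν hν => Finset.le_sup (f := id) hν
  generalize u.sup id = μ at hle
  calc ∑ ν ∈ u, ∏ j ∈ ν.support, A j * c (ν j)
      = ∑ ν ∈ u, ∏ j ∈ μ.support, (if ν j = 0 then 1 else A j * c (ν j)) :=
        Finset.sum_congr rfl fun ν hν =>
          prod_support_eq_prod_ite (hle ν hν) fun j k => A j * c k
    _ ≤ ∑ ν ∈ Finset.Icc 0 μ, ∏ j ∈ μ.support, (if ν j = 0 then 1 else A j * c (ν j)) :=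
        Finset.sum_le_sum_of_subset_of_nonneg
          (fun ν hν => Finset.mem_Icc.2 ⟨zero_le, hle ν hν⟩)
          fun ν _ _ => Finset.prod_nonneg fun j _ => hnonneg j _
    _ = ∏ j ∈ μ.support, ∑ k ∈ Finset.range (μ j + 1), (if k = 0 then 1 else A j * c k) :=
        sum_Icc_zero_prod subset_rfl fun j k => if k = 0 then 1 else A j * c k
    _ ≤ ∏ j ∈ μ.support, Real.exp (A j * ∑' n, c n) :=
        Finset.prod_le_prod (fun j _ => Finset.sum_nonneg fun k _ => hnonneg j k)
          fun j _ => sum_ite_eq_zero_le_exp (hA j) hc hcs _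
    _ = Real.exp ((∑ j ∈ μ.support, A j) * ∑' n, c n) := by
        rw [← Real.exp_sum, Finset.sum_mul]
    _ ≤ Real.exp ((∑' j, A j) * ∑' n, c n) := by
        gcongr
        · exact tsum_nonneg hc
        · exact hAs.sum_le_tsum _ fun j _ => hA j

/-! ### Product weights -/

/-- The weight `∏_{j ∈ supp ν} B_j ν_j^s` of a multiindex, of which `weight` is an instance. -/
def prodWeight (B : ι → ℝ) (s : ℝ) (ν : ι →₀ ℕ) : ℝ := ∏ j ∈ ν.support, B j * (ν j : ℝ) ^ s

/-- The general term of the series over all multiindices that controls both the number of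
interpolation points (with `D = 1`) and the interpolation error. -/
def weightTerm (B : ι → ℝ) (s t D : ℝ) (ν : ι →₀ ℕ) : ℝ :=
  prodWeight B s ν ^ (-t) * ∏ j ∈ ν.support, D * (1 + (ν j : ℝ))

variable {B : ι → ℝ} {s t D : ℝ}

theorem one_le_factor_of_mem_support (hB : ∀ j, 1 ≤ B j) (hs : 0 ≤ s) {ν : ι →₀ ℕ} {j : ι}
    (hj : j ∈ ν.support) : 1 ≤ B j * (ν j : ℝ) ^ s :=
  one_le_mul_of_one_le_of_one_le (hB j) (Real.one_le_rpow
    (Nat.one_le_cast.2 (Nat.one_le_iff_ne_zero.2 (Finsupp.mem_support_iff.1 hj))) hs)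

theorem one_le_prodWeight (hB : ∀ j, 1 ≤ B j) (hs : 0 ≤ s) (ν : ι →₀ ℕ) : 1 ≤ prodWeight B s ν :=
  Finset.one_le_prod fun _ hj => one_le_factor_of_mem_support hB hs hj

theorem prodWeight_pos (hB : ∀ j, 0 < B j) (s : ℝ) (ν : ι →₀ ℕ) : 0 < prodWeight B s ν :=
  Finset.prod_pos fun j hj => mul_pos (hB j) (Real.rpow_pos_of_pos
    (Nat.cast_pos.2 (Nat.pos_of_ne_zero (Finsupp.mem_support_iff.1 hj))) s)

theorem prodWeight_mono (hB : ∀ j, 1 ≤ B j) (hs : 0 ≤ s) : Monotone (prodWeight B s) := by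
  intro μ ν h
  have hB0 : ∀ j, 0 ≤ B j := fun j => zero_le_one.trans (hB j)
  calc prodWeight B s μ ≤ ∏ j ∈ μ.support, B j * (ν j : ℝ) ^ s := by
        refine Finset.prod_le_prod (fun j _ => mul_nonneg (hB0 j) (by positivity)) fun j _ => ?_
        have := hB0 j
        gcongr
        exact h j
    _ ≤ prodWeight B s ν :=
        Finset.prod_le_prod_of_subset_of_one_le (Finsupp.support_mono h)
          (fun j _ => mul_nonneg (hB0 j) (by positivity))
          fun j hj _ => one_le_factor_of_mem_support hB hs hj

theorem weightTerm_nonneg (hB : ∀ j, 0 < B j) (s t : ℝ) (hD : 0 ≤ D) (ν : ι →₀ ℕ) :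
    0 ≤ weightTerm B s t D ν :=
  mul_nonneg (Real.rpow_nonneg (prodWeight_pos hB s ν).le _)
    (Finset.prod_nonneg fun j _ => by positivity)

theorem summable_one_add_mul_rpow_neg {q : ℝ} (hq : 2 < q) :
    Summable fun n : ℕ => (1 + (n : ℝ)) * (n : ℝ) ^ (-q) := by
  refine ((Real.summable_nat_rpow.2 (by linarith : -q < -1)).add
    (Real.summable_nat_rpow.2 (by linarith : 1 + -q < -1))).congr fun n => ?_
  rw [Real.rpow_one_add' n.cast_nonneg (by linarith)]
  ring

theorem summable_weightTerm (hB : ∀ j, 0 < B j) (hBs : Summable fun j => B j ^ (-t))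
    (hst : 2 < s * t) (hD : 0 ≤ D) : Summable (weightTerm B s t D) := by
  refine (summable_prod_support (fun j => Real.rpow_nonneg (hB j).le (-t)) (fun n => by positivity)
    hBs ((summable_one_add_mul_rpow_neg hst).mul_left D)).congr fun ν => ?_
  rw [weightTerm, prodWeight,
    ← Real.finsetProd_rpow _ _ fun j _ => mul_nonneg (hB j).le (by positivity),
    ← Finset.prod_mul_distrib]
  refine Finset.prod_congr rfl fun j _ => ?_
  rw [Real.mul_rpow (hB j).le (by positivity), ← Real.rpow_mul (by positivity)]
  ring_nf

theorem tsum_weightTerm_pos (hB : ∀ j, 0 < B j) (hBs : Summable fun j => B j ^ (-t))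
    (hst : 2 < s * t) (hD : 0 ≤ D) : 0 < ∑' ν, weightTerm B s t D ν :=
  (summable_weightTerm hB hBs hst hD).tsum_pos (weightTerm_nonneg hB s t hD) 0
    (by simp [weightTerm, prodWeight])

end

/-! ### The index sets and their interpolation points -/

section IndexSet

variable {B : ℕ → ℝ} {s t ε : ℝ}

theorem isLowerSet_indexSet_prodWeight (hB : ∀ j, 1 ≤ B j) (hs : 0 ≤ s) (ε : ℝ) :
    IsLowerSet (indexSet (prodWeight B s) ε) := fun _ μ hμν hν =>
  le_trans hν (inv_anti₀ (zero_lt_one.trans_le (one_le_prodWeight hB hs μ))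
    (prodWeight_mono hB hs hμν))

theorem card_Icc_zero_mul_rpow_le_weightTerm (hB : ∀ j, 0 < B j) (ht : 0 ≤ t) (hε : 0 ≤ ε)
    {ν : ℕ →₀ ℕ} (hν : ν ∈ indexSet (prodWeight B s) ε) :
    (Finset.Icc 0 ν).card * ε ^ t ≤ weightTerm B s t 1 ν := by
  have hpos := prodWeight_pos hB s ν
  have hεt : ε ^ t ≤ prodWeight B s ν ^ (-t) := by
    rw [Real.rpow_neg hpos.le, ← Real.inv_rpow hpos.le]
    exact Real.rpow_le_rpow hε hν ht
  have hcard : ((Finset.Icc 0 ν).card : ℝ) = ∏ j ∈ ν.support, 1 * (1 + (ν j : ℝ)) := by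
    simp [Finsupp.card_Icc, add_comm]
  rw [weightTerm, ← hcard, mul_comm]
  gcongr

theorem finite_indexSet_prodWeight (hB : ∀ j, 0 < B j) (ht : 0 ≤ t)
    (hBs : Summable fun j => B j ^ (-t)) (hst : 2 < s * t) (hε : 0 < ε) :
    (indexSet (prodWeight B s) ε).Finite := by
  have hlt := (summable_weightTerm hB hBs hst zero_le_one).tendsto_cofinite_zero.eventually_lt_const
    (Real.rpow_pos_of_pos hε t)
  refine (Filter.eventually_cofinite.1 hlt).subset fun ν hν => not_lt.2 ?_
  refine le_trans ?_ (card_Icc_zero_mul_rpow_le_weightTerm hB ht hε.le hν)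
  have hcard : 1 ≤ (Finset.Icc 0 ν).card := Finset.card_pos.2 (Finset.nonempty_Icc.2 zero_le)
  exact le_mul_of_one_le_left (by positivity) (Nat.one_le_cast.2 hcard)

theorem encard_pts_le (Λ : Finset (ℕ →₀ ℕ)) :
    (pts (Λ : Set (ℕ →₀ ℕ))).encard ≤ (∑ ν ∈ Λ, (Finset.Icc 0 ν).card : ℕ) := by
  classical
  have hsub : pts (Λ : Set (ℕ →₀ ℕ)) ⊆
      (Λ.biUnion fun ν => (Finset.Icc 0 ν).image (gridPoint ν) : Finset (ℕ → ℝ)) := by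
    rintro x ⟨ν, hν, μ, hμ, rfl⟩
    exact Finset.mem_biUnion.2
      ⟨ν, hν, Finset.mem_image_of_mem _ (Finset.mem_Icc.2 ⟨zero_le, hμ⟩)⟩
  refine (Set.encard_le_encard hsub).trans ?_
  rw [Set.encard_coe_eq_coe_finsetCard]
  exact_mod_cast Finset.card_biUnion_le.trans (Finset.sum_le_sum fun ν _ => Finset.card_image_le)

theorem encard_pts_indexSet_le (hB : ∀ j, 0 < B j) (ht : 0 ≤ t)
    (hBs : Summable fun j => B j ^ (-t)) (hst : 2 < s * t) (hε : 0 < ε) {n : ℕ}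
    (hn : ∑' ν, weightTerm B s t 1 ν ≤ n * ε ^ t) :
    (pts (indexSet (prodWeight B s) ε)).encard ≤ n := by
  have hfin := finite_indexSet_prodWeight hB ht hBs hst hε
  have hcount : ((∑ ν ∈ hfin.toFinset, (Finset.Icc 0 ν).card : ℕ) : ℝ) * ε ^ t ≤ n * ε ^ t :=
    calc ((∑ ν ∈ hfin.toFinset, (Finset.Icc 0 ν).card : ℕ) : ℝ) * ε ^ t
        = ∑ ν ∈ hfin.toFinset, (Finset.Icc 0 ν).card * ε ^ t := by
          rw [Nat.cast_sum, Finset.sum_mul]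
      _ ≤ ∑ ν ∈ hfin.toFinset, weightTerm B s t 1 ν := Finset.sum_le_sum fun ν hν =>
          card_Icc_zero_mul_rpow_le_weightTerm hB ht hε.le (hfin.mem_toFinset.1 hν)
      _ ≤ ∑' ν, weightTerm B s t 1 ν := (summable_weightTerm hB hBs hst zero_le_one).sum_le_tsum _
          fun ν _ => weightTerm_nonneg hB s t zero_le_one ν
      _ ≤ n * ε ^ t := hn
  have hsum := Nat.cast_le.1 (le_of_mul_le_mul_right hcount (Real.rpow_pos_of_pos hε t))
  have hpts := encard_pts_le hfin.toFinset
  rw [hfin.coe_toFinset] at hpts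
  exact hpts.trans (Nat.cast_le.2 hsum)

end IndexSet

/-! ### Weights of the Hermite coefficients -/

/-- The order of differentiation used to bound the Hermite coefficients of degree `n` by means of
at most `S` derivatives: `S` derivatives in high degree, but a single one in low degree. -/
def diffOrder (S n : ℕ) : ℕ := if n < S then min n 1 else S

theorem diffOrder_le (S n : ℕ) : diffOrder S n ≤ n := by
  unfold diffOrder
  split_ifs <;> omega

/-- The univariate weight that `diffOrder S n` derivatives on a disc of radius `R` put on the square
of a Hermite coefficient of degree `n`. -/
def coeffWeight (S : ℕ) (R : ℝ) (n : ℕ) : ℝ :=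
  (R ^ diffOrder S n / (diffOrder S n).factorial) ^ 2 *
    ((n.factorial : ℝ) / (n - diffOrder S n).factorial)

theorem coeffWeight_zero (S : ℕ) (R : ℝ) : coeffWeight S R 0 = 1 := by
  simp [coeffWeight, Nat.le_zero.1 (diffOrder_le S 0)]

theorem coeffWeight_pos (S : ℕ) {R : ℝ} (hR : 0 < R) (n : ℕ) : 0 < coeffWeight S R n := by
  unfold coeffWeight
  positivity

theorem coeffWeight_of_lt {S n : ℕ} (R : ℝ) (hn : n ≠ 0) (h : n < S) :
    coeffWeight S R n = R ^ 2 * n := by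
  have hdiff : diffOrder S n = 1 := by
    rw [diffOrder, if_pos h]
    omega
  rw [coeffWeight, hdiff, ← Nat.mul_factorial_pred hn]
  push_cast
  field_simp
  simp

theorem coeffWeight_of_le {S n : ℕ} (R : ℝ) (h : S ≤ n) :
    coeffWeight S R n = (R ^ S / S.factorial) ^ 2 * n.descFactorial S := by
  have hdiff : diffOrder S n = S := if_neg h.not_gt
  rw [coeffWeight, hdiff, ← Nat.factorial_mul_descFactorial h]
  push_cast
  field_simp

theorem pow_le_descFactorial_mul_pow {S n : ℕ} (h : S ≤ n) :
    n ^ S ≤ n.descFactorial S * S ^ S := by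
  rcases S.eq_zero_or_pos with rfl | hS
  · simp
  obtain ⟨m, rfl⟩ := Nat.exists_eq_add_of_le h
  calc (S + m) ^ S ≤ ((m + 1) * S) ^ S := Nat.pow_le_pow_left (by nlinarith) S
    _ = (m + 1) ^ S * S ^ S := mul_pow _ _ _
    _ ≤ (S + m).descFactorial S * S ^ S := by
        gcongr
        simpa only [Nat.add_assoc, Nat.add_sub_cancel_left] using
          Nat.pow_sub_le_descFactorial (S + m) S

theorem mul_sq_mul_pow_le_coeffWeight (S : ℕ) {R₀ R : ℝ} (hR₀ : 0 ≤ R₀) (hR₀1 : R₀ ≤ 1)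
    (hR : R₀ ≤ R) {n : ℕ} (hn : n ≠ 0) :
    R₀ ^ (2 * S) / (((S + 1).factorial : ℝ) ^ 2 * (S + 1 : ℕ) ^ (S + 1)) *
      (R ^ 2 * (n : ℝ) ^ (S + 1)) ≤ coeffWeight (S + 1) R n := by
  have hn1 : (1 : ℝ) ≤ n := Nat.one_le_cast.2 (Nat.one_le_iff_ne_zero.2 hn)
  have hfac : (1 : ℝ) ≤ (S + 1).factorial := Nat.one_le_cast.2 (S + 1).factorial_pos
  rw [div_mul_eq_mul_div, div_le_iff₀ (by positivity)]
  have hR0 : 0 ≤ R := hR₀.trans hR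
  rcases lt_or_ge n (S + 1) with h | h
  · rw [coeffWeight_of_lt R hn h]
    calc R₀ ^ (2 * S) * (R ^ 2 * (n : ℝ) ^ (S + 1))
        ≤ 1 * (R ^ 2 * (S + 1 : ℕ) ^ (S + 1)) := by
          gcongr
          exact pow_le_one₀ hR₀ hR₀1
      _ = R ^ 2 * 1 * (1 ^ 2 * (S + 1 : ℕ) ^ (S + 1)) := by ring
      _ ≤ R ^ 2 * n * (((S + 1).factorial : ℝ) ^ 2 * (S + 1 : ℕ) ^ (S + 1)) := by gcongr
  · rw [coeffWeight_of_le R h]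
    have hpow : (n : ℝ) ^ (S + 1) ≤ n.descFactorial (S + 1) * (S + 1 : ℕ) ^ (S + 1) := by
      exact_mod_cast pow_le_descFactorial_mul_pow h
    calc R₀ ^ (2 * S) * (R ^ 2 * (n : ℝ) ^ (S + 1))
        ≤ R ^ (2 * S) * (R ^ 2 * (n.descFactorial (S + 1) * (S + 1 : ℕ) ^ (S + 1))) := by gcongr
      _ = (R ^ (S + 1) / (S + 1).factorial) ^ 2 * n.descFactorial (S + 1) *
            (((S + 1).factorial : ℝ) ^ 2 * (S + 1 : ℕ) ^ (S + 1)) := by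
          field_simp
          ring

theorem exists_sq_stabilityBound_mul_prodWeight_le {B R : ℕ → ℝ} {s κ R₀ : ℝ} (hκ : 0 ≤ κ)
    (hR₀ : 0 < R₀) (hR : ∀ j, R₀ ≤ R j) (hB0 : ∀ j, 0 ≤ B j)
    (hB : ∀ j, B j ≤ κ * R j ^ 2) {S : ℕ} (hS : s + 3 ≤ S) :
    ∃ D : ℝ, 0 ≤ D ∧ ∀ ν : ℕ →₀ ℕ, (stabilityBound ν : ℝ) ^ 2 * prodWeight B s ν ≤
      (∏ j ∈ ν.support, D * (1 + (ν j : ℝ))) *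
        ∏ j ∈ ν.support, coeffWeight (S + 1) (R j) (ν j) := by
  obtain ⟨R₁, hR₁, hR₁1, hR₁R⟩ : ∃ R₁, 0 < R₁ ∧ R₁ ≤ 1 ∧ ∀ j, R₁ ≤ R j :=
    ⟨min R₀ 1, lt_min hR₀ one_pos, min_le_right _ _, fun j => (min_le_left _ _).trans (hR j)⟩
  set κ₀ : ℝ := R₁ ^ (2 * S) / (((S + 1).factorial : ℝ) ^ 2 * (S + 1 : ℕ) ^ (S + 1))
  have hκ₀pos : 0 < κ₀ := by positivity
  refine ⟨64 * κ / κ₀, by positivity, fun ν => ?_⟩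
  rw [prodWeight, stabilityBound, Nat.cast_prod, ← Finset.prod_pow, ← Finset.prod_mul_distrib,
    ← Finset.prod_mul_distrib]
  refine Finset.prod_le_prod (fun j _ => mul_nonneg (by positivity)
    (mul_nonneg (hB0 j) (by positivity))) fun j hj => ?_
  have hn : ν j ≠ 0 := Finsupp.mem_support_iff.1 hj
  have hn1 : (1 : ℝ) ≤ ν j := Nat.one_le_cast.2 (Nat.one_le_iff_ne_zero.2 hn)
  have hpow : (ν j : ℝ) ^ 4 * (ν j : ℝ) ^ s ≤ (ν j : ℝ) ^ (S + 1) := by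
    rw [← Real.rpow_natCast _ (S + 1), ← Real.rpow_natCast _ 4, ← Real.rpow_add (by linarith)]
    exact Real.rpow_le_rpow_of_exponent_le hn1 (by push_cast; linarith)
  have hw := mul_sq_mul_pow_le_coeffWeight S hR₁.le hR₁1 (hR₁R j) hn
  push_cast
  calc (8 * (ν j : ℝ) ^ 2) ^ 2 * (B j * (ν j : ℝ) ^ s)
      = 64 * (B j * ((ν j : ℝ) ^ 4 * (ν j : ℝ) ^ s)) := by ring
    _ ≤ 64 * (κ * R j ^ 2 * (ν j : ℝ) ^ (S + 1)) := by
        gcongr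
        exact hB j
    _ = 64 * κ / κ₀ * (κ₀ * (R j ^ 2 * (ν j : ℝ) ^ (S + 1))) := by field_simp
    _ ≤ 64 * κ / κ₀ * (1 + ν j) * coeffWeight (S + 1) (R j) (ν j) := by
        gcongr
        exact le_mul_of_one_le_right (by positivity) (by linarith)

/-! ### The error in finitely many variables -/

theorem eLpNorm_sub_smolyak_le_tsum {X ι : Type*} [Countable ι] [NormedAddCommGroup X]
    [InnerProductSpace ℂ X] {Λ : Finset (ℕ →₀ ℕ)} (hΛ : IsLowerSet (Λ : Set (ℕ →₀ ℕ)))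
    {e : ι → ℕ →₀ ℕ} {x : ι → X} {f : (ℕ → ℝ) → X}
    (hf : ∀ y, HasSum (fun i => hermiteSeq (e i) y • x i) (f y)) :
    eLpNorm (fun y => f y - smolyak Λ f y) 2 gammaInf ≤
      ∑' i, if e i ∈ Λ then 0 else ENNReal.ofReal (‖x i‖ * (2 * stabilityBound (e i))) := by
  refine (eLpNorm_le_tsum_of_hasSum one_le_two (fun i => Continuous.aestronglyMeasurable ?_)
    fun y => (hf y).sub (hasSum_smolyak hf Λ y)).trans (ENNReal.tsum_le_tsum fun i => ?_)
  · exact ((continuous_hermiteSeq _).smul continuous_const).sub (continuous_smolyak _ _)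
  · split_ifs with hi
    · simp only [smolyak_hermiteSeq_of_mem hΛ hi, sub_self, eLpNorm_zero', le_refl]
    · exact eLpNorm_hermiteSeq_sub_smolyak_le Λ _ _

section StripBound

variable {X : Type*} [NormedAddCommGroup X] [InnerProductSpace ℂ X]
  {N : ℕ} {ρ : Fin N → ℝ} {φ : (Fin N → ℝ) → ℝ} {F : (Fin N → ℂ) → X}

theorem memLp_comp_ofReal (hF : StripBound ρ φ F) (hρ : ∀ j, 0 < ρ j) :
    MemLp (fun y : Fin N → ℝ => F fun i => (y i : ℂ)) 2 (gammaFin N) := by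
  refine hF.memLp.of_le (continuous_comp_ofReal hF hρ).aestronglyMeasurable
    (ae_of_all _ fun y => ?_)
  have hbound := hF.bound y 0 fun j => by simpa using hρ j
  simp only [Pi.zero_apply, add_zero] at hbound
  exact hbound.trans (le_abs_self _)

variable [CompleteSpace X]

theorem hasSum_hermiteSeq_extendIndex (hF : StripBound ρ φ F) (hρ : ∀ j, 0 < ρ j)
    (hs : Summable fun ν => ‖hermiteCoeff (fun y => F fun i => (y i : ℂ)) ν‖) (y : ℕ → ℝ) :
    HasSum (fun ν => hermiteSeq (extendIndex ν) y •
        hermiteCoeff (fun y => F fun i => (y i : ℂ)) ν)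
      (liftFin (fun y => F fun i => (y i : ℂ)) y) := by
  simp only [hermiteSeq_extendIndex]
  exact hasSum_hermiteProd_smul (continuous_comp_ofReal hF hρ) (memLp_comp_ofReal hF hρ) hs _

theorem sum_norm_hermiteCoeff_mul_le_sqrt (hF : StripBound ρ φ F) {R : Fin N → ℝ}
    (hR : ∀ j, 0 < R j) (hRρ : ∀ j, R j < ρ j) (S : ℕ) {P G : (Fin N → ℕ) → ℝ}
    {T : Finset (Fin N → ℕ)} (hPG : ∀ ν ∈ T, P ν ^ 2 ≤ G ν * ∏ j, coeffWeight S (R j) (ν j)) :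
    ∑ ν ∈ T, ‖hermiteCoeff (fun y => F fun i => (y i : ℂ)) ν‖ * P ν ≤
      √((∫ y, φ y ^ 2 ∂gammaFin N) * ∑ ν ∈ T, G ν) := by
  have hw : ∀ ν : Fin N → ℕ, 0 < ∏ j, coeffWeight S (R j) (ν j) := fun ν =>
    Finset.prod_pos fun j _ => coeffWeight_pos S (hR j) _
  have hG : ∀ ν ∈ T, 0 ≤ G ν := fun ν hν =>
    nonneg_of_mul_nonneg_left ((sq_nonneg _).trans (hPG ν hν)) (hw ν)
  refine Real.le_sqrt_of_sq_le ((Finset.sum_sq_le_sum_mul_sum_of_sq_le_mul T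
    (f := fun ν => (∏ j, coeffWeight S (R j) (ν j)) *
      ‖hermiteCoeff (fun y => F fun i => (y i : ℂ)) ν‖ ^ 2) (g := G)
    (fun ν _ => mul_nonneg (hw ν).le (sq_nonneg _)) hG fun ν hν => ?_).trans ?_)
  · rw [mul_pow]
    nlinarith [mul_le_mul_of_nonneg_left (hPG ν hν)
      (sq_nonneg ‖hermiteCoeff (fun y => F fun i => (y i : ℂ)) ν‖)]
  · exact mul_le_mul_of_nonneg_right (sum_weight_mul_hermiteCoeff_sq_le hF hR hRρ T
      fun ν j => diffOrder_le S (ν j)) (Finset.sum_nonneg hG)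

variable {B R : ℕ → ℝ} {s t D : ℝ} {S : ℕ}

theorem sum_norm_hermiteCoeff_mul_stabilityBound_le (hF : StripBound ρ φ F) (hR : ∀ j, 0 < R j)
    (hRρ : ∀ j : Fin N, R j < ρ j) (hB : ∀ j, 0 < B j) (hD : 0 ≤ D)
    (hsum : Summable (weightTerm B s t D))
    (hw : ∀ ν : ℕ →₀ ℕ, (stabilityBound ν : ℝ) ^ 2 * prodWeight B s ν ≤
      (∏ j ∈ ν.support, D * (1 + (ν j : ℝ))) * ∏ j ∈ ν.support, coeffWeight S (R j) (ν j))
    {θ : ℝ} (hθ : 0 ≤ θ) {T : Finset (Fin N → ℕ)}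
    (hT : ∀ ν ∈ T, (prodWeight B s (extendIndex ν))⁻¹ ≤ θ * prodWeight B s (extendIndex ν) ^ (-t)) :
    ∑ ν ∈ T, ‖hermiteCoeff (fun y => F fun i => (y i : ℂ)) ν‖ *
        (2 * stabilityBound (extendIndex ν)) ≤
      √((∫ y, φ y ^ 2 ∂gammaFin N) * (4 * θ * ∑' ν, weightTerm B s t D ν)) := by
  have hterm : ∀ ν ∈ T, (2 * (stabilityBound (extendIndex ν) : ℝ)) ^ 2 ≤
      4 * θ * weightTerm B s t D (extendIndex ν) * ∏ j : Fin N, coeffWeight S (R j) (ν j) := by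
    intro ν hν
    rw [← prod_support_extendIndex ν (fun j n => coeffWeight S (R j) n)
      fun j => coeffWeight_zero S _]
    have hW : 0 ≤ (∏ j ∈ (extendIndex ν).support, D * (1 + (extendIndex ν j : ℝ))) *
        ∏ j ∈ (extendIndex ν).support, coeffWeight S (R j) (extendIndex ν j) :=
      mul_nonneg (Finset.prod_nonneg fun j _ => by positivity)
        (Finset.prod_nonneg fun j _ => (coeffWeight_pos S (hR j) _).le)
    have hstab := (le_mul_inv_iff₀ (prodWeight_pos hB s _)).2 (hw (extendIndex ν))
    have hθ' := hstab.trans (mul_le_mul_of_nonneg_left (hT ν hν) hW)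
    rw [weightTerm]
    linarith
  refine (sum_norm_hermiteCoeff_mul_le_sqrt hF (fun j => hR j) hRρ S hterm).trans ?_
  rw [← Finset.mul_sum]
  refine Real.sqrt_le_sqrt (mul_le_mul_of_nonneg_left (mul_le_mul_of_nonneg_left
    (sum_extendIndex_le_tsum (weightTerm_nonneg hB s t hD) hsum T) (by positivity)) ?_)
  exact integral_nonneg fun y => sq_nonneg _

theorem summable_norm_hermiteCoeff (hF : StripBound ρ φ F) (hR : ∀ j, 0 < R j)
    (hRρ : ∀ j : Fin N, R j < ρ j) (hB : ∀ j, 1 ≤ B j) (hs : 0 ≤ s) (ht : t ≤ 1) (hD : 0 ≤ D)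
    (hsum : Summable (weightTerm B s t D))
    (hw : ∀ ν : ℕ →₀ ℕ, (stabilityBound ν : ℝ) ^ 2 * prodWeight B s ν ≤
      (∏ j ∈ ν.support, D * (1 + (ν j : ℝ))) * ∏ j ∈ ν.support, coeffWeight S (R j) (ν j)) :
    Summable fun ν => ‖hermiteCoeff (fun y => F fun i => (y i : ℂ)) ν‖ := by
  refine summable_of_sum_le (fun ν => norm_nonneg _) fun T => le_trans
    (Finset.sum_le_sum fun ν _ => le_mul_of_one_le_right (norm_nonneg _) ?_)
    (sum_norm_hermiteCoeff_mul_stabilityBound_le hF hR hRρ (fun j => one_pos.trans_le (hB j)) hD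
      hsum hw zero_le_one fun ν _ => ?_)
  · have : (1 : ℝ) ≤ stabilityBound (extendIndex ν) := Nat.one_le_cast.2 (one_le_stabilityBound _)
    linarith
  · rw [one_mul, ← Real.rpow_neg_one]
    exact Real.rpow_le_rpow_of_exponent_le (one_le_prodWeight hB hs _) (by linarith)

theorem inv_prodWeight_le_of_notMem_indexSet (hB : ∀ j, 0 < B j) (ht : t ≤ 1) {ε : ℝ}
    {ν : ℕ →₀ ℕ} (hν : ν ∉ indexSet (prodWeight B s) ε) :
    (prodWeight B s ν)⁻¹ ≤ ε ^ (1 - t) * prodWeight B s ν ^ (-t) := by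
  have hpos := prodWeight_pos hB s ν
  have hinv := inv_pos.2 hpos
  calc (prodWeight B s ν)⁻¹ = (prodWeight B s ν)⁻¹ ^ (1 - t) * (prodWeight B s ν)⁻¹ ^ t := by
        rw [← Real.rpow_add hinv, sub_add_cancel, Real.rpow_one]
    _ ≤ ε ^ (1 - t) * (prodWeight B s ν)⁻¹ ^ t := by
        have hlt : (prodWeight B s ν)⁻¹ < ε := not_le.1 hν
        gcongr
    _ = ε ^ (1 - t) * prodWeight B s ν ^ (-t) := by
        rw [Real.inv_rpow hpos.le, Real.rpow_neg hpos.le]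

theorem eLpNorm_liftFin_sub_smolyak_le (hF : StripBound ρ φ F) (hR : ∀ j, 0 < R j)
    (hRρ : ∀ j : Fin N, R j < ρ j) (hB : ∀ j, 1 ≤ B j) (hs : 0 ≤ s) (ht : t ≤ 1) (hD : 0 ≤ D)
    (hsum : Summable (weightTerm B s t D))
    (hw : ∀ ν : ℕ →₀ ℕ, (stabilityBound ν : ℝ) ^ 2 * prodWeight B s ν ≤
      (∏ j ∈ ν.support, D * (1 + (ν j : ℝ))) * ∏ j ∈ ν.support, coeffWeight S (R j) (ν j))
    {ε : ℝ} (hε : 0 ≤ ε) {Λ : Finset (ℕ →₀ ℕ)} (hΛ : (Λ : Set _) = indexSet (prodWeight B s) ε) :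
    eLpNorm (fun y => liftFin (fun y => F fun i => (y i : ℂ)) y -
        smolyak Λ (liftFin fun y => F fun i => (y i : ℂ)) y) 2 gammaInf ≤
      ENNReal.ofReal √((∫ y, φ y ^ 2 ∂gammaFin N) *
        (4 * ε ^ (1 - t) * ∑' ν, weightTerm B s t D ν)) := by
  have hB0 : ∀ j, 0 < B j := fun j => one_pos.trans_le (hB j)
  refine (eLpNorm_sub_smolyak_le_tsum (hΛ ▸ isLowerSet_indexSet_prodWeight hB hs ε)
    (hasSum_hermiteSeq_extendIndex hF (fun j => (hR j).trans (hRρ j))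
      (summable_norm_hermiteCoeff hF hR hRρ hB hs ht hD hsum hw))).trans ?_
  rw [ENNReal.tsum_eq_iSup_sum]
  refine iSup_le fun T => ?_
  simp only [← ite_not (_ ∈ Λ)]
  rw [← Finset.sum_filter, ← ENNReal.ofReal_sum_of_nonneg fun ν _ => by positivity]
  refine ENNReal.ofReal_le_ofReal (sum_norm_hermiteCoeff_mul_stabilityBound_le hF hR hRρ hB0 hD
    hsum hw (Real.rpow_nonneg hε _) fun ν hν => inv_prodWeight_le_of_notMem_indexSet hB0 ht ?_)
  rw [← hΛ]
  exact (Finset.mem_filter.1 hν).2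

end StripBound

/-! ### Point values -/

section PointEval

variable {X : Type*} [NormedAddCommGroup X] [InnerProductSpace ℂ X]
  {b : ℕ → ℝ} {ξ δ : ℝ} {u : (ℕ → ℝ) → X} {uN : (N : ℕ) → (Fin N → ℝ) → X}

theorem liftFin_eq_liftFin_of_le (hu : IsHolomorphicVia b ξ δ u uN) {m N : ℕ} (hm : 0 < m)
    (hmN : m ≤ N) {y : ℕ → ℝ} (hy : ∀ j, m ≤ j → y j = 0) :
    liftFin (uN m) y = liftFin (uN N) y := by
  rcases hmN.eq_or_lt with rfl | hlt
  · rfl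
  refine (hu.consistent m N hm hlt _).trans (congrArg (uN N) (funext fun i => ?_))
  by_cases hi : (i : ℕ) < m
  · simp only [padZero, dif_pos hi]
  · simp only [padZero, dif_neg hi, hy i (not_lt.1 hi)]

theorem pointEval_eq_liftFin (hu : IsHolomorphicVia b ξ δ u uN) {N : ℕ} (hN : 0 < N)
    {y : ℕ → ℝ} (hy : ∀ j, N ≤ j → y j = 0) : pointEval uN y = liftFin (uN N) y := by
  classical
  have hex : ∃ N : ℕ, 0 < N ∧ ∀ j, N ≤ j → y j = 0 := ⟨N, hN, hy⟩
  have hfind := Nat.find_spec hex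
  rw [pointEval, dif_pos hex]
  convert liftFin_eq_liftFin_of_le hu hfind.1 (Nat.find_min' hex ⟨hN, hy⟩) hfind.2

theorem smolyak_pointEval_eq (hu : IsHolomorphicVia b ξ δ u uN) (Λ : Finset (ℕ →₀ ℕ)) :
    ∀ᶠ N in atTop, smolyak Λ (pointEval uN) = smolyak Λ (liftFin (uN N)) := by
  classical
  obtain ⟨M, hM⟩ := (Λ.biUnion Finsupp.support).exists_nat_subset_range
  filter_upwards [eventually_ge_atTop M, eventually_gt_atTop 0] with N hMN hN
  refine smolyak_congr (fun ν hν => ?_) fun y hy => pointEval_eq_liftFin hu hN hy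
  exact (Finset.subset_biUnion_of_mem Finsupp.support hν).trans
    (hM.trans (Finset.range_subset_range.2 hMN))

theorem eLpNorm_sub_smolyak_pointEval_le (hu : IsHolomorphicVia b ξ δ u uN)
    (Λ : Finset (ℕ →₀ ℕ)) (hc : ∀ N, 0 < N → Continuous (uN N)) {E : ℝ≥0∞}
    (hE : ∀ N, 0 < N →
      eLpNorm (fun y => liftFin (uN N) y - smolyak Λ (liftFin (uN N)) y) 2 gammaInf ≤ E) :
    eLpNorm (fun y => u y - smolyak Λ (pointEval uN) y) 2 gammaInf ≤ E := by
  have hlim : Tendsto (fun N => eLpNorm (fun y => u y - liftFin (uN N) y) 2 gammaInf + E) atTop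
      (𝓝 E) := by simpa only [zero_add] using hu.tendsto.add_const E
  refine ge_of_tendsto hlim ?_
  filter_upwards [smolyak_pointEval_eq hu Λ, eventually_gt_atTop 0] with N hN hN0
  have hcont : Continuous (liftFin (uN N)) :=
    (hc N hN0).comp (by fun_prop : Continuous fun (y : ℕ → ℝ) (i : Fin N) => y i)
  have hsplit : (fun y => u y - smolyak Λ (pointEval uN) y) =
      (fun y => u y - liftFin (uN N) y) +
        fun y => liftFin (uN N) y - smolyak Λ (liftFin (uN N)) y := by
    rw [hN]
    exact funext fun y => (sub_add_sub_cancel _ _ _).symm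
  rw [hsplit]
  exact (eLpNorm_add_le (hu.memLp.aestronglyMeasurable.sub hcont.aestronglyMeasurable)
    (hcont.sub (continuous_smolyak _ _)).aestronglyMeasurable one_le_two).trans
    (add_le_add_right (hE N hN0) _)

end PointEval

/-! ### Admissible radii -/

section Radius

variable {b : ℕ → ℝ} {p ξ : ℝ}

theorem summable_rpow_of_memℓp (hb : ∀ j, 0 ≤ b j) (hp0 : 0 < p)
    (hbp : Memℓp b (ENNReal.ofReal p)) : Summable fun j => b j ^ p := by
  have h := hbp.summable (by rwa [ENNReal.toReal_ofReal hp0.le])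
  simpa only [ENNReal.toReal_ofReal hp0.le, Real.norm_of_nonneg (hb _)] using h

theorem tsum_rpow_pos (hb : ∀ j, 0 < b j) (hs : Summable fun j => b j ^ p) :
    0 < ∑' j, b j ^ p :=
  hs.tsum_pos (fun j => (Real.rpow_pos_of_pos (hb j) p).le) 0 (Real.rpow_pos_of_pos (hb 0) p)

/-- The radii `ξ b_j^{p-1} / ∑_i b_i^p`, which are admissible and proportional to `varrho`. -/
def radius (b : ℕ → ℝ) (p ξ : ℝ) (j : ℕ) : ℝ := ξ / (∑' i, b i ^ p) * b j ^ (p - 1)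

theorem radius_pos (hb : ∀ j, 0 < b j) (hξ : 0 < ξ) (hs : Summable fun j => b j ^ p) (j : ℕ) :
    0 < radius b p ξ j :=
  mul_pos (div_pos hξ (tsum_rpow_pos hb hs)) (Real.rpow_pos_of_pos (hb j) _)

theorem admissible_radius (hb : ∀ j, 0 < b j) (hξ : 0 < ξ) (hs : Summable fun j => b j ^ p)
    (N : ℕ) : Admissible b ξ fun j : Fin N => radius b p ξ j := by
  refine ⟨fun j => radius_pos hb hξ hs j, ?_⟩
  have hmul : ∀ j, b j * radius b p ξ j = ξ / (∑' i, b i ^ p) * b j ^ p := fun j => by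
    rw [radius, mul_left_comm, mul_comm (b j), ← Real.rpow_add_one (hb j).ne', sub_add_cancel]
  have hsum : ∑ j : Fin N, b j ^ p ≤ ∑' j, b j ^ p := by
    rw [← Finset.sum_range fun j => b j ^ p]
    exact hs.sum_le_tsum _ fun j _ => (Real.rpow_pos_of_pos (hb j) p).le
  simp only [hmul]
  rw [← Finset.mul_sum, div_mul_eq_mul_div, div_le_iff₀ (tsum_rpow_pos hb hs)]
  exact mul_le_mul_of_nonneg_left hsum hξ.le

theorem exists_le_radius (hb : ∀ j, 0 < b j) (hξ : 0 < ξ) (hp0 : 0 < p) (hp1 : p ≤ 1)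
    (hs : Summable fun j => b j ^ p) : ∃ R₀ : ℝ, 0 < R₀ ∧ ∀ j, R₀ ≤ radius b p ξ j := by
  have hβ := tsum_rpow_pos hb hs
  refine ⟨ξ / (∑' i, b i ^ p) * (∑' i, b i ^ p) ^ ((p - 1) / p),
    mul_pos (div_pos hξ hβ) (Real.rpow_pos_of_pos hβ _), fun j =>
      mul_le_mul_of_nonneg_left ?_ (div_pos hξ hβ).le⟩
  have hpow : b j ^ (p - 1) = (b j ^ p) ^ ((p - 1) / p) := by
    rw [← Real.rpow_mul (hb j).le, mul_div_cancel₀ _ hp0.ne']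
  rw [hpow]
  exact Real.rpow_le_rpow_of_nonpos (Real.rpow_pos_of_pos (hb j) p)
    (hs.le_tsum j fun i _ => (Real.rpow_pos_of_pos (hb i) p).le)
    (div_nonpos_of_nonpos_of_nonneg (by linarith) hp0.le)

theorem exists_varrho_eq_mul_radius (hb : ∀ j, 0 < b j) (hξ : ξ ≠ 0)
    (hs : Summable fun j => b j ^ p) (r : ℕ) :
    ∃ q : ℝ, 0 < q ∧ ∀ j, varrho b p ξ r j = q * radius b p ξ j := by
  have hβ := tsum_rpow_pos hb hs
  refine ⟨(∑' i, b i ^ p) / (4 * √(r.factorial : ℝ) * (∑' i, b i ^ p) ^ (1 / p)),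
    by positivity, fun j => ?_⟩
  simp only [varrho, radius, abs_of_pos (hb _)]
  field_simp

theorem exists_sq_max_varrho_le (hb : ∀ j, 0 < b j) (hξ : 0 < ξ) (hp0 : 0 < p) (hp1 : p ≤ 1)
    (hs : Summable fun j => b j ^ p) (K : ℝ) (r : ℕ) :
    ∃ κ : ℝ, ∀ j, max 1 (K * varrho b p ξ r j) ^ 2 ≤ κ * (radius b p ξ j / 2) ^ 2 := by
  obtain ⟨R₀, hR₀, hR⟩ := exists_le_radius hb hξ hp0 hp1 hs
  obtain ⟨q, -, hq⟩ := exists_varrho_eq_mul_radius hb hξ.ne' hs r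
  refine ⟨(2 * max R₀⁻¹ (K * q)) ^ 2, fun j => ?_⟩
  have hscale : 2 * max R₀⁻¹ (K * q) * (radius b p ξ j / 2) =
      max (R₀⁻¹ * radius b p ξ j) (K * q * radius b p ξ j) := by
    rw [← max_mul_of_nonneg _ _ (radius_pos hb hξ hs j).le]
    ring
  rw [← mul_pow, hscale, hq, ← mul_assoc]
  gcongr
  rw [inv_mul_eq_div]
  exact (one_le_div hR₀).2 (hR j)

theorem summable_sq_radius_rpow (ξ : ℝ) (hb : ∀ j, 0 < b j) (hp1 : p ≠ 1)
    (hs : Summable fun j => b j ^ p) :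
    Summable fun j => (radius b p ξ j ^ 2) ^ (-(p / (2 * (1 - p)))) := by
  have h1p : 1 - p ≠ 0 := sub_ne_zero.2 hp1.symm
  refine (hs.mul_left (((ξ / ∑' i, b i ^ p) ^ 2) ^ (-(p / (2 * (1 - p)))))).congr fun j => ?_
  have hpow : b j ^ p = ((b j ^ (p - 1)) ^ 2) ^ (-(p / (2 * (1 - p)))) := by
    rw [← Real.rpow_natCast, ← Real.rpow_mul (hb j).le, ← Real.rpow_mul (hb j).le]
    congr 1
    push_cast
    field_simp
    ring
  rw [radius, mul_pow, Real.mul_rpow (sq_nonneg _) (sq_nonneg _), hpow]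

theorem summable_sq_max_varrho_rpow (hb : ∀ j, 0 < b j) (hξ : 0 < ξ) (hp0 : 0 ≤ p) (hp1 : p < 1)
    (hs : Summable fun j => b j ^ p) {K : ℝ} (hK : 0 < K) (r : ℕ) :
    Summable fun j => (max 1 (K * varrho b p ξ r j) ^ 2) ^ (-(p / (2 * (1 - p)))) := by
  obtain ⟨q, hq, hqr⟩ := exists_varrho_eq_mul_radius hb hξ.ne' hs r
  have : 0 < 1 - p := sub_pos.2 hp1
  refine Summable.of_nonneg_of_le (fun j => by positivity) (fun j => ?_)
    ((summable_sq_radius_rpow ξ hb hp1.ne hs).mul_left (((K * q) ^ 2) ^ (-(p / (2 * (1 - p))))))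
  have hr := radius_pos hb hξ hs j
  rw [← Real.mul_rpow (by positivity) (by positivity), ← mul_pow, hqr, ← mul_assoc]
  refine Real.rpow_le_rpow_of_nonpos (by positivity) ?_ (neg_nonpos.2 (by positivity))
  gcongr
  exact le_max_right _ _

end Radius

/-! ### The convergence rate -/

theorem integral_sq_le_of_eLpNorm_le {Ω : Type*} [MeasurableSpace Ω] {μ : Measure Ω} {f : Ω → ℝ}
    (hf : MemLp f 2 μ) {δ : ℝ} (hδ : eLpNorm f 2 μ ≤ ENNReal.ofReal δ) :
    ∫ x, f x ^ 2 ∂μ ≤ δ ^ 2 := by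
  rw [eLpNorm_two_eq_ofReal_sqrt_integral hf, ENNReal.ofReal_le_ofReal_iff'] at hδ
  rcases hδ with h | h
  · exact (Real.sqrt_le_iff.1 h).2
  · exact (Real.sqrt_eq_zero'.1 (le_antisymm h (Real.sqrt_nonneg _))).trans (sq_nonneg δ)

section Main

variable {X : Type*} [NormedAddCommGroup X] [InnerProductSpace ℂ X]
  {b : ℕ → ℝ} {ξ δ : ℝ} {u : (ℕ → ℝ) → X} {uN : (N : ℕ) → (Fin N → ℝ) → X}

theorem exists_stripBound (hu : IsHolomorphicVia b ξ δ u uN) {N : ℕ} (hN : 0 < N)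
    {ρ : Fin N → ℝ} (hρ : Admissible b ξ ρ) :
    ∃ (φ : (Fin N → ℝ) → ℝ) (F : (Fin N → ℂ) → X), StripBound ρ φ F ∧
      ∫ y, φ y ^ 2 ∂gammaFin N ≤ δ ^ 2 ∧ uN N = fun y => F fun i => (y i : ℂ) := by
  obtain ⟨φ, -, hφ, hφδ, hext⟩ := hu.extension N hN
  obtain ⟨F, hdiff, hreal, hbound⟩ := hext ρ hρ
  exact ⟨φ, F, ⟨hφ, hdiff, hbound⟩, integral_sq_le_of_eLpNorm_le hφ hφδ,
    funext fun y => (hreal y).symm⟩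

theorem exists_eLpNorm_sub_smolyak_pointEval_le [CompleteSpace X]
    (hu : IsHolomorphicVia b ξ δ u uN) {ρ R B : ℕ → ℝ} {R₀ κ s t : ℝ}
    (hρ : ∀ N, Admissible b ξ fun j : Fin N => ρ j) (hR₀ : 0 < R₀) (hR : ∀ j, R₀ ≤ R j)
    (hRρ : ∀ j, R j < ρ j) (hB : ∀ j, 1 ≤ B j) (hBκ : ∀ j, B j ≤ κ * R j ^ 2) (hs : 0 ≤ s)
    (ht : t ≤ 1) (hBs : Summable fun j => B j ^ (-t)) (hst : 2 < s * t) :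
    ∃ C : ℝ, 0 ≤ C ∧ ∀ ε : ℝ, 0 ≤ ε → ∀ Λ : Finset (ℕ →₀ ℕ),
      (Λ : Set _) = indexSet (prodWeight B s) ε →
      eLpNorm (fun y => u y - smolyak Λ (pointEval uN) y) 2 gammaInf ≤
        ENNReal.ofReal (C * ε ^ ((1 - t) / 2)) := by
  have hB0 : ∀ j, 0 < B j := fun j => one_pos.trans_le (hB j)
  have hR0 : ∀ j, 0 < R j := fun j => hR₀.trans_le (hR j)
  have hκ : 0 ≤ κ := nonneg_of_mul_nonneg_left ((hB0 0).le.trans (hBκ 0)) (pow_pos (hR0 0) 2)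
  obtain ⟨S, hS⟩ := exists_nat_ge (s + 3)
  obtain ⟨D, hD, hw⟩ := exists_sq_stabilityBound_mul_prodWeight_le hκ hR₀ hR (fun j => (hB0 j).le)
    hBκ hS
  have hsum : Summable (weightTerm B s t D) := summable_weightTerm hB0 hBs hst hD
  have hZ : 0 ≤ ∑' ν, weightTerm B s t D ν := tsum_nonneg (weightTerm_nonneg hB0 s t hD)
  refine ⟨√(δ ^ 2 * (4 * ∑' ν, weightTerm B s t D ν)), Real.sqrt_nonneg _, fun ε hε Λ hΛ =>
    eLpNorm_sub_smolyak_pointEval_le hu Λ (fun N hN => ?_) fun N hN => ?_⟩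
  · obtain ⟨φ, F, hF, -, huF⟩ := exists_stripBound hu hN (hρ N)
    exact huF ▸ continuous_comp_ofReal hF (hρ N).1
  · obtain ⟨φ, F, hF, hφ, huF⟩ := exists_stripBound hu hN (hρ N)
    rw [huF]
    refine (eLpNorm_liftFin_sub_smolyak_le hF hR0 (fun j => hRρ j) hB hs ht hD hsum hw hε hΛ).trans
      (ENNReal.ofReal_le_ofReal ?_)
    have hpow : ε ^ ((1 - t) / 2) = √(ε ^ (1 - t)) := by
      rw [Real.sqrt_eq_rpow, ← Real.rpow_mul hε]
      ring_nf
    rw [hpow, ← Real.sqrt_mul (by positivity)]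
    refine Real.sqrt_le_sqrt ((mul_le_mul_of_nonneg_right hφ (by positivity)).trans_eq ?_)
    ring

theorem exists_encard_pts_indexSet_le {B : ℕ → ℝ} {s t : ℝ} (hB : ∀ j, 0 < B j) (ht : 0 < t)
    (hBs : Summable fun j => B j ^ (-t)) (hst : 2 < s * t) :
    ∃ Z : ℝ, 0 < Z ∧ ∀ n : ℕ, 0 < n →
      (pts (indexSet (prodWeight B s) ((Z / n) ^ (1 / t)))).encard ≤ n := by
  have hZ := tsum_weightTerm_pos hB hBs hst zero_le_one
  refine ⟨_, hZ, fun n hn => encard_pts_indexSet_le hB ht.le hBs hst (by positivity) ?_⟩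
  rw [← Real.rpow_mul (by positivity), one_div_mul_cancel ht.ne', Real.rpow_one]
  exact (mul_div_cancel₀ _ (Nat.cast_ne_zero.2 hn.ne')).ge

theorem exists_eLpNorm_sub_smolyak_pointEval_le_rpow [CompleteSpace X]
    (hu : IsHolomorphicVia b ξ δ u uN) {ρ R B : ℕ → ℝ} {R₀ κ s t : ℝ}
    (hρ : ∀ N, Admissible b ξ fun j : Fin N => ρ j) (hR₀ : 0 < R₀) (hR : ∀ j, R₀ ≤ R j)
    (hRρ : ∀ j, R j < ρ j) (hB : ∀ j, 1 ≤ B j) (hBκ : ∀ j, B j ≤ κ * R j ^ 2) (hs : 0 ≤ s)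
    (ht0 : 0 < t) (ht1 : t ≤ 1) (hBs : Summable fun j => B j ^ (-t)) (hst : 2 < s * t) :
    ∃ C : ℝ, 0 < C ∧ ∀ n : ℕ, 0 < n → ∃ ε : ℝ, 0 < ε ∧
      (pts (indexSet (prodWeight B s) ε)).encard ≤ n ∧
      ∀ Λ : Finset (ℕ →₀ ℕ), (Λ : Set _) = indexSet (prodWeight B s) ε →
        eLpNorm (fun y => u y - smolyak Λ (pointEval uN) y) 2 gammaInf ≤
          ENNReal.ofReal (C * (n : ℝ) ^ (-((1 - t) / (2 * t)))) := by
  obtain ⟨C, hC, herror⟩ :=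
    exists_eLpNorm_sub_smolyak_pointEval_le hu hρ hR₀ hR hRρ hB hBκ hs ht1 hBs hst
  obtain ⟨Z, hZ, hpts⟩ :=
    exists_encard_pts_indexSet_le (fun j => one_pos.trans_le (hB j)) ht0 hBs hst
  refine ⟨C * Z ^ ((1 - t) / (2 * t)) + 1, by positivity, fun n hn =>
    ⟨(Z / n) ^ (1 / t), by positivity, hpts n hn, fun Λ hΛ =>
      (herror _ (by positivity) Λ hΛ).trans (ENNReal.ofReal_le_ofReal ?_)⟩⟩
  have hexp : 1 / t * ((1 - t) / 2) = (1 - t) / (2 * t) := by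
    field_simp
  rw [← Real.rpow_mul (by positivity), hexp, Real.div_rpow hZ.le n.cast_nonneg, div_eq_mul_inv,
    ← Real.rpow_neg n.cast_nonneg, ← mul_assoc]
  gcongr
  linarith

end Main

end SparseGrid

end

theorem theorem6p13_general {X : Type*} [NormedAddCommGroup X] [InnerProductSpace ℂ X]
    [CompleteSpace X] (b : ℕ → ℝ) (hb : ∀ j, 0 < b j) (ξ δ : ℝ) (hξ : 0 < ξ)
    (p : ℝ) (hp0 : 0 < p) (hp : p ≤ 2 / 3) (hbp : Memℓp b (ENNReal.ofReal p))
    (u : (ℕ → ℝ) → X) (uN : (N : ℕ) → (Fin N → ℝ) → X) (hu : IsHolomorphicVia b ξ δ u uN)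
    (r : ℕ) (τ K : ℝ) (hr : 2 < ((r : ℝ) - τ) * (p / (1 - p)) / 2) (hK : 0 < K)
    (Λ : ℝ → Set (ℕ →₀ ℕ))
    (hΛ : ∀ ε, Λ ε = indexSet (weight 1 K τ r (varrho b p ξ r)) ε) :
    ∃ hfin : ∀ ε, 0 < ε → (Λ ε).Finite,
      (∀ ε, 0 < ε → IsLowerSet (Λ ε)) ∧
      ∃ C : ℝ, 0 < C ∧ ∀ n : ℕ, 0 < n → ∃ (ε : ℝ) (hε : 0 < ε),
        (pts (Λ ε)).encard ≤ n ∧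
        eLpNorm (fun y => u y - smolyak (hfin ε hε).toFinset (pointEval uN) y) 2 gammaInf
          ≤ ENNReal.ofReal (C * (n : ℝ) ^ (-1 / p + 3 / 2)) := by
  have h1p : 0 < 1 - p := by linarith
  obtain ⟨t, ht⟩ : ∃ t, t = p / (2 * (1 - p)) := ⟨_, rfl⟩
  have ht0 : 0 < t := ht ▸ by positivity
  have ht1 : t ≤ 1 := ht ▸ (div_le_one (by positivity)).2 (by linarith)
  have hst : 2 < ((r : ℝ) - τ) * t := hr.trans_eq (by rw [ht]; field_simp)
  have hs : 0 ≤ (r : ℝ) - τ := (pos_of_mul_pos_left (two_pos.trans hst) ht0.le).le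
  have hrate : -1 / p + 3 / 2 = -((1 - t) / (2 * t)) := by rw [ht]; field_simp; ring
  have hbs := summable_rpow_of_memℓp (fun j => (hb j).le) hp0 hbp
  have hB : ∀ j, 1 ≤ max 1 (K * varrho b p ξ r j) ^ 2 := fun j => one_le_pow₀ (le_max_left _ _)
  have hBs := ht ▸ summable_sq_max_varrho_rpow hb hξ hp0.le (by linarith) hbs hK r
  obtain rfl : Λ = indexSet (prodWeight _ _) := funext hΛ
  obtain ⟨R₀, hR₀, hR⟩ := exists_le_radius hb hξ hp0 (by linarith) hbs
  obtain ⟨κ, hκ⟩ := exists_sq_max_varrho_le hb hξ hp0 (by linarith) hbs K r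
  obtain ⟨C, hC, hsmolyak⟩ := exists_eLpNorm_sub_smolyak_pointEval_le_rpow hu
    (admissible_radius hb hξ hbs) (half_pos hR₀)
    (fun j => div_le_div_of_nonneg_right (hR j) two_pos.le)
    (fun j => half_lt_self (radius_pos hb hξ hbs j)) hB hκ hs ht0 ht1 hBs hst
  refine ⟨fun ε => finite_indexSet_prodWeight (fun j => one_pos.trans_le (hB j)) ht0.le hBs hst,
    fun ε _ => isLowerSet_indexSet_prodWeight hB hs ε, C, hC, fun n hn => ?_⟩
  obtain ⟨ε, hε, hpts, herror⟩ := hsmolyak n hn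
  exact ⟨ε, hε, hpts, hrate ▸ herror _ (Set.Finite.coe_toFinset _)⟩

theorem theorem6p13 {X : Type*} [NormedAddCommGroup X] [InnerProductSpace ℂ X] [CompleteSpace X]
    [TopologicalSpace.SeparableSpace X]
    (b : ℕ → ℝ) (hb : ∀ j, 0 < b j) (ξ δ : ℝ) (hξ : 0 < ξ) (hδ : 0 < δ)
    (p : ℝ) (hp0 : 0 < p) (hp : p < 2 / 3) (hbp : Memℓp b (ENNReal.ofReal p))
    (u : (ℕ → ℝ) → X) (uN : (N : ℕ) → (Fin N → ℝ) → X)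
    (hu : IsHolomorphicVia b ξ δ u uN)
    (r : ℕ) (τ K : ℝ) (hτ : 0 < τ) (hr : 2 < ((r : ℝ) - τ) * (p / (1 - p)) / 2) (hK : 0 < K)
    (Λ : ℝ → Set (ℕ →₀ ℕ))
    (hΛ : ∀ ε, Λ ε = indexSet (weight 1 K τ r (varrho b p ξ r)) ε) :
    ∃ hfin : ∀ ε, 0 < ε → (Λ ε).Finite,
      (∀ ε, 0 < ε → IsLowerSet (Λ ε)) ∧
      ∃ C : ℝ, 0 < C ∧ ∀ n : ℕ, 0 < n → ∃ (ε : ℝ) (hε : 0 < ε),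
        (pts (Λ ε)).encard ≤ n ∧
        eLpNorm (fun y => u y - smolyak (hfin ε hε).toFinset (pointEval uN) y) 2 gammaInf
          ≤ ENNReal.ofReal (C * (n : ℝ) ^ (-1 / p + 3 / 2)) :=
  theorem6p13_general b hb ξ δ hξ p hp0 hp.le hbp u uN hu r τ K hr hK Λ hΛ
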